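/- Let $\mathbf U$ be the quantum enveloping algebra of type $A_2$ over $\mathbb Q(v)$ (Lusztig's conventions; generators $E_i,F_i,K_i^{\pm1}$, $i=1,2$), with divided powers $E_i^{(r)}=E_i^r/[r]!$, $F_i^{(r)}=F_i^r/[r]!$. Put $\mathcal A=\mathbb Z[v^{\pm1}]$ and let $\mathbf U_{\mathcal A}$ be the $\mathcal A$-subalgebra generated by the $E_i^{(r)}$, $F_i^{(r)}$, $K_i^{\pm1}$. Let $\Lambda=(\mu_1,\mu_2)$ with integers $\mu_1,\mu_2\ge1$, let $L=L(\Lambda)$ be the irreducible (integrable) $\mathbf U$-module with highest weight $\Lambda$ and highest vector $\mathsf v$ (so $E_i\mathsf v=0$, $K_i\mathsf v=v^{\mu_i}\mathsf v$), and let $L_{\mathcal A}=\mathbf U_{\mathcal A}\mathsf v$ be its integral form. Write $L_{(a,b)}$ for the weight space where $K_1=v^a$, $K_2=v^b$, and put $p=\mu_1+\mu_2-1$. The following six weight spaces are two-dimensional over $\mathbb Q(v)$, and the given pairs are their canonical bases (they consist of elements of the canonical basis of $L$, and form a $\mathbb Q(v)$-basis of the weight space of $L$ and an $\mathcal A$-basis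 of the weight space of $L_{\mathcal A}$): - $L_{(\mu_1-1,\mu_2-1)}$: $(F_1F_2\mathsf v,\ F_2F_1\mathsf v)$; - $L_{(-\mu_1+1,\mu_1+\mu_2-2)}$: $(F_1^{(\mu_1)}F_2\mathsf v,\ F_2F_1^{(\mu_1)}\mathsf v)$; - $L_{(\mu_1+\mu_2-2,-\mu_2+1)}$: $(F_2^{(\mu_2)}F_1\mathsf v,\ F_1F_2^{(\mu_2)}\mathsf v)$; - $L_{(\mu_2-1,-\mu_1-\mu_2+2)}$: $(F_2^{(p)}F_1^{(\mu_1)}\mathsf v,\ F_1F_2^{(p)}F_1^{(\mu_1-1)}\mathsf v)$; - $L_{(-\mu_1-\mu_2+2,\mu_1-1)}$: $(F_1^{(p)}F_2^{(\mu_2)}\mathsf v,\ F_2F_1^{(p)}F_2^{(\mu_2-1)}\mathsf v)$; - $L_{(-\mu_2+1,-\mu_1+1)}$: $(F_1^{(\mu_2-1)}F_2^{(p)}F_1^{(\mu_1)}\mathsf v=F_2^{(\mu_1)}F_1^{(p)}F_2^{(\mu_2-1)}\mathsf v,\ \ F_1^{(\mu_2)}F_2^{(p)}F_1^{(\mu_1-1)}\mathsf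 v=F_2^{(\mu_1-1)}F_1^{(p)}F_2^{(\mu_2)}\mathsf v)$. For $e=\pm1$ let $T'_{i,e}:L\to L$ be Lusztig's symmetry: if $K_iz=v^nz$, then $$T'_{i,e}z=\sum_{a,b,c\ge0,\ a-b+c=n}(-1)^bv^{e(b-ac)}F_i^{(a)}E_i^{(b)}F_i^{(c)}z .$$ Write $T'_{i\pm}=T'_{i,\pm1}$. Then, for both choices of the sign, $$\begin{aligned} T'_{1\pm}(F_1F_2\mathsf v)&=-v^{\pm(\mu_1+1)}F_1^{(\mu_1)}F_2\mathsf v,\\ T'_{1\pm}(F_2F_1\mathsf v)&=-v^{\pm\mu_1}F_1^{(\mu_1)}F_2\mathsf v+F_2F_1^{(\mu_1)}\mathsf v,\\ T'_{2\pm}(F_2F_1\mathsf v)&=-v^{\pm(\mu_2+1)}F_2^{(\mu_2)}F_1\mathsf v,\\ T'_{2\pm}(F_1F_2\mathsf v)&=-v^{\pm\mu_2}F_2^{(\mu_2)}F_1\mathsf v+F_1F_2^{(\mu_2)}\mathsf v,\\ T'_{2\pm}(F_2F_1^{(\mu_1)}\mathsf v)&=-v^{\pm(\mu_1+\mu_2)}F_2^{(p)}F_1^{(\mu_1)}\mathsf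 v,\\ T'_{2\pm}(F_1^{(\mu_1)}F_2\mathsf v)&=-v^{\pm\mu_2}F_2^{(p)}F_1^{(\mu_1)}\mathsf v+F_1F_2^{(p)}F_1^{(\mu_1-1)}\mathsf v,\\ T'_{1\pm}(F_1F_2^{(\mu_2)}\mathsf v)&=-v^{\pm(\mu_1+\mu_2)}F_1^{(p)}F_2^{(\mu_2)}\mathsf v,\\ T'_{1\pm}(F_2^{(\mu_2)}F_1\mathsf v)&=-v^{\pm\mu_1}F_1^{(p)}F_2^{(\mu_2)}\mathsf v+F_2F_1^{(p)}F_2^{(\mu_2-1)}\mathsf v,\\ T'_{1\pm}(F_1F_2^{(p)}F_1^{(\mu_1-1)}\mathsf v)&=-v^{\pm(\mu_2+1)}F_1^{(\mu_2)}F_2^{(p)}F_1^{(\mu_1-1)}\mathsf v,\\ T'_{1\pm}(F_2^{(p)}F_1^{(\mu_1)}\mathsf v)&=-v^{\pm1}F_1^{(\mu_2)}F_2^{(p)}F_1^{(\mu_1-1)}\mathsf v+F_1^{(\mu_2-1)}F_2^{(p)}F_1^{(\mu_1)}\mathsf v,\\ T'_{2\pm}(F_2F_1^{(p)}F_2^{(\mu_2-1)}\mathsf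 v)&=-v^{\pm(\mu_1+1)}F_2^{(\mu_1)}F_1^{(p)}F_2^{(\mu_2-1)}\mathsf v,\\ T'_{2\pm}(F_1^{(p)}F_2^{(\mu_2)}\mathsf v)&=-v^{\pm1}F_2^{(\mu_1)}F_1^{(p)}F_2^{(\mu_2-1)}\mathsf v+F_2^{(\mu_1-1)}F_1^{(p)}F_2^{(\mu_2)}\mathsf v. \end{aligned}$$ -/

import Mathlib

noncomputable section

namespace QSL3

/-! ### Scalars -/

/-- The field `ℚ(v)`. -/
abbrev Kv : Type := RatFunc ℚ

/-- The quantum parameter `v`. -/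
def v : Kv := RatFunc.X

/-- The ring `𝒜 = ℤ[v, v⁻¹]`, as a subring of `ℚ(v)`. -/
abbrev A : Subalgebra ℤ Kv := Algebra.adjoin ℤ {v, v⁻¹}

/-- The quantum integer `[n] = (vⁿ - v⁻ⁿ) / (v - v⁻¹)`. -/
def qInt (n : ℕ) : Kv := (v ^ n - v⁻¹ ^ n) / (v - v⁻¹)

/-- The quantum factorial `[n]! = [1][2]⋯[n]`. -/
def qFact (n : ℕ) : Kv := ∏ k ∈ Finset.range n, qInt (k + 1)

/-- The bar involution `f(v) ↦ f(v⁻¹)` of `ℚ(v)`. -/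
def barScalar (f : Kv) : Kv := RatFunc.eval (RatFunc.C : ℚ →+* Kv) v⁻¹ f

open scoped Classical in
/-- The subring of `ℚ(v)` of the rational functions that are regular at `v = ∞`. -/
abbrev Ainf : Subring Kv := (RatFunc.inftyValuation ℚ).integer

/-! ### The quantum enveloping algebra of type `A₂`

The two nodes `1, 2` of the Dynkin diagram are the elements `0, 1` of `Fin 2`. -/

/-- The Cartan matrix of type `A₂`. -/
def cartan (i j : Fin 2) : ℤ := if i = j then 2 else -1

/-- Names of the generators. -/
inductive Gen : Type
  | E (i : Fin 2)
  | F (i : Fin 2)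
  | K (i : Fin 2)
  | Kinv (i : Fin 2)

/-- The free algebra on the generators. -/
abbrev Free : Type := FreeAlgebra Kv Gen

/-- A generator, as an element of the free algebra. -/
abbrev gen (g : Gen) : Free := FreeAlgebra.ι Kv g

/-- The defining relations (Drinfeld, Jimbo, Lusztig). -/
inductive Rel : Free → Free → Prop
  | K_Kinv (i : Fin 2) : Rel (gen (.K i) * gen (.Kinv i)) 1
  | Kinv_K (i : Fin 2) : Rel (gen (.Kinv i) * gen (.K i)) 1
  | K_K (i j : Fin 2) : Rel (gen (.K i) * gen (.K j)) (gen (.K j) * gen (.K i))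
  | K_E (i j : Fin 2) :
      Rel (gen (.K i) * gen (.E j)) (v ^ cartan i j • (gen (.E j) * gen (.K i)))
  | K_F (i j : Fin 2) :
      Rel (gen (.K i) * gen (.F j)) (v ^ (-cartan i j) • (gen (.F j) * gen (.K i)))
  | E_F_same (i : Fin 2) :
      Rel (gen (.E i) * gen (.F i) - gen (.F i) * gen (.E i))
        ((v - v⁻¹)⁻¹ • (gen (.K i) - gen (.Kinv i)))
  | E_F_diff (i j : Fin 2) (h : i ≠ j) :
      Rel (gen (.E i) * gen (.F j)) (gen (.F j) * gen (.E i))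
  | serre_E (i j : Fin 2) (h : i ≠ j) :
      Rel (gen (.E i) * gen (.E i) * gen (.E j) + gen (.E j) * gen (.E i) * gen (.E i))
        ((v + v⁻¹) • (gen (.E i) * gen (.E j) * gen (.E i)))
  | serre_F (i j : Fin 2) (h : i ≠ j) :
      Rel (gen (.F i) * gen (.F i) * gen (.F j) + gen (.F j) * gen (.F i) * gen (.F i))
        ((v + v⁻¹) • (gen (.F i) * gen (.F j) * gen (.F i)))

/-- The quantum enveloping algebra of `𝔰𝔩₃` over `ℚ(v)`. -/
def U : Type := RingQuot Rel

instance : Ring U := inferInstanceAs (Ring (RingQuot Rel))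

instance : Algebra Kv U := inferInstanceAs (Algebra Kv (RingQuot Rel))

/-- The quotient map from the free algebra. -/
def toU : Free →ₐ[Kv] U := RingQuot.mkAlgHom Kv Rel

/-- The generator `E_i`. -/
def E (i : Fin 2) : U := toU (gen (.E i))

/-- The generator `F_i`. -/
def F (i : Fin 2) : U := toU (gen (.F i))

/-- The generator `K_i`. -/
def K (i : Fin 2) : U := toU (gen (.K i))

/-- The generator `K_i⁻¹`. -/
def Kinv (i : Fin 2) : U := toU (gen (.Kinv i))

/-- The divided power `E_i^{(r)} = E_i^r / [r]!`. -/
def dE (i : Fin 2) (r : ℕ) : U := (qFact r)⁻¹ • E i ^ r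

/-- The divided power `F_i^{(r)} = F_i^r / [r]!`. -/
def dF (i : Fin 2) (r : ℕ) : U := (qFact r)⁻¹ • F i ^ r

/-- Lusztig's integral form over `𝒜`: the `𝒜`-subalgebra generated by the divided powers
and the `K_i^{±1}`. -/
def UA : Subalgebra A U :=
  Algebra.adjoin A
    ({x | ∃ i r, x = dE i r} ∪ {x | ∃ i r, x = dF i r} ∪ {x | ∃ i, x = K i ∨ x = Kinv i})

/-! ### The irreducible module `L(Λ)` -/

/-- The left ideal defining the Verma module: it is generated by the `E_i` and the
`K_i - v^{Λ_i}`. -/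
def vermaIdeal (Λ : Fin 2 → ℕ) : Submodule U U :=
  Submodule.span U
    ({x | ∃ i, x = E i} ∪ {x | ∃ i, x = K i - algebraMap Kv U (v ^ Λ i)})

/-- The largest proper left ideal that contains `vermaIdeal Λ`, namely the sum of all of them;
it corresponds to the largest proper submodule of the Verma module. -/
def maxIdeal (Λ : Fin 2 → ℕ) : Submodule U U :=
  vermaIdeal Λ ⊔ sSup {J : Submodule U U | vermaIdeal Λ ≤ J ∧ J ≠ ⊤}

/-- The irreducible `U`-module `L(Λ)` of highest weight `Λ`: the irreducible quotient of the
Verma module. -/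
def L (Λ : Fin 2 → ℕ) : Type := U ⧸ maxIdeal Λ

instance (Λ : Fin 2 → ℕ) : AddCommGroup (L Λ) := inferInstanceAs (AddCommGroup (U ⧸ maxIdeal Λ))

instance (Λ : Fin 2 → ℕ) : Module U (L Λ) := inferInstanceAs (Module U (U ⧸ maxIdeal Λ))

instance (Λ : Fin 2 → ℕ) : Module Kv (L Λ) := inferInstanceAs (Module Kv (U ⧸ maxIdeal Λ))

instance (Λ : Fin 2 → ℕ) : IsScalarTower Kv U (L Λ) :=
  inferInstanceAs (IsScalarTower Kv U (U ⧸ maxIdeal Λ))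

/-- The quotient map `U → L(Λ)`. -/
def toL (Λ : Fin 2 → ℕ) : U →ₗ[U] L Λ := (maxIdeal Λ).mkQ

/-- The highest vector of `L(Λ)`. -/
def sv (Λ : Fin 2 → ℕ) : L Λ := toL Λ 1

/-- The integral form of `L(Λ)`: the `U_𝒜`-submodule generated by the highest vector. -/
def LA (Λ : Fin 2 → ℕ) : Submodule A (L Λ) :=
  Submodule.map ((LinearMap.toSpanSingleton U (L Λ) (sv Λ)).restrictScalars A)
    (Subalgebra.toSubmodule UA)

/-- The weight space `L(Λ)_{(a, b)}`, where `K_1` acts by `v^a` and `K_2` by `v^b`. -/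
def wtSpace (Λ : Fin 2 → ℕ) (a b : ℤ) : Submodule Kv (L Λ) where
  carrier := {x | K 0 • x = v ^ a • x ∧ K 1 • x = v ^ b • x}
  add_mem' := by
    rintro x y ⟨hx, hx'⟩ ⟨hy, hy'⟩
    exact ⟨by rw [smul_add, smul_add, hx, hy], by rw [smul_add, smul_add, hx', hy']⟩
  zero_mem' := by simp
  smul_mem' := by
    rintro c x ⟨hx, hx'⟩
    exact ⟨by rw [smul_comm, hx, smul_comm], by rw [smul_comm, hx', smul_comm]⟩

/-! ### Lusztig's symmetries -/

/-- The eigenspace `{x | K_i x = vⁿ x}` of `L(Λ)`. -/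
def grade (Λ : Fin 2 → ℕ) (i : Fin 2) (n : ℤ) : Submodule Kv (L Λ) :=
  Module.End.eigenspace (Algebra.lsmul Kv Kv (L Λ) (K i)) (v ^ n)

lemma mem_grade {Λ : Fin 2 → ℕ} {i : Fin 2} {n : ℤ} {x : L Λ} :
    x ∈ grade Λ i n ↔ K i • x = v ^ n • x := by
  simp [grade]

lemma v_ne_zero : v ≠ 0 := RatFunc.X_ne_zero

lemma v_zpow_injective : Function.Injective (fun n : ℤ => v ^ n) := by
  have key : ∀ n : ℕ, v ^ n = 1 → n = 0 := by
    intro n hn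
    have h1 : (algebraMap (Polynomial ℚ) (RatFunc ℚ)) (Polynomial.X ^ n)
        = algebraMap (Polynomial ℚ) (RatFunc ℚ) 1 := by
      rw [map_pow, map_one, RatFunc.algebraMap_X]; exact hn
    have h2 := RatFunc.algebraMap_injective ℚ h1
    have h3 := congrArg Polynomial.natDegree h2
    simpa using h3
  intro a b hab
  have hab' : v ^ a = v ^ b := hab
  have h : v ^ (a - b) = 1 := by
    rw [zpow_sub₀ v_ne_zero, hab', div_self (zpow_ne_zero _ v_ne_zero)]
  rcases Int.eq_nat_or_neg (a - b) with ⟨n, hn | hn⟩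
  · rw [hn, zpow_natCast] at h
    have := key n h
    omega
  · rw [hn, zpow_neg, zpow_natCast, inv_eq_one] at h
    have := key n h
    omega

lemma toU_rel {a b : Free} (h : Rel a b) : toU a = toU b := RingQuot.mkAlgHom_rel Kv h

lemma K_mul_E (i j : Fin 2) : K i * E j = v ^ cartan i j • (E j * K i) := by
  have := toU_rel (Rel.K_E i j)
  simpa [K, E] using this

lemma K_mul_F (i j : Fin 2) : K i * F j = v ^ (-cartan i j) • (F j * K i) := by
  have := toU_rel (Rel.K_F i j)
  simpa [K, F] using this

lemma K_mul_K (i j : Fin 2) : K i * K j = K j * K i := by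
  have := toU_rel (Rel.K_K i j)
  simpa [K] using this

lemma K_mul_Kinv' (j : Fin 2) : K j * Kinv j = 1 := by
  have := toU_rel (Rel.K_Kinv j)
  simpa [K, Kinv] using this

lemma Kinv_mul_K' (j : Fin 2) : Kinv j * K j = 1 := by
  have := toU_rel (Rel.Kinv_K j)
  simpa [K, Kinv] using this

lemma K_mul_Kinv (i j : Fin 2) : K i * Kinv j = Kinv j * K i := by
  calc K i * Kinv j = (Kinv j * K j) * (K i * Kinv j) := by rw [Kinv_mul_K', one_mul]
    _ = Kinv j * (K j * K i) * Kinv j := by simp only [mul_assoc]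
    _ = Kinv j * (K i * K j) * Kinv j := by rw [K_mul_K]
    _ = Kinv j * K i * (K j * Kinv j) := by simp only [mul_assoc]
    _ = Kinv j * K i := by rw [K_mul_Kinv', mul_one]

lemma smul_mem_grade {Λ : Fin 2 → ℕ} {i : Fin 2} {n m : ℤ} {u : U}
    (hu : K i * u = v ^ m • (u * K i)) {x : L Λ} (hx : x ∈ grade Λ i n) :
    u • x ∈ grade Λ i (m + n) := by
  rw [mem_grade] at hx ⊢
  rw [← mul_smul, hu, smul_assoc, mul_smul, hx, smul_comm u, ← mul_smul,
    zpow_add₀ v_ne_zero]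

lemma gen_smul_mem_grade (Λ : Fin 2 → ℕ) (i : Fin 2) (g : Gen) :
    ∃ m : ℤ, ∀ (n : ℤ) (x : L Λ), x ∈ grade Λ i n →
      toU (gen g) • x ∈ grade Λ i (m + n) := by
  cases g with
  | E j => exact ⟨_, fun n x hx => smul_mem_grade (K_mul_E i j) hx⟩
  | F j => exact ⟨_, fun n x hx => smul_mem_grade (K_mul_F i j) hx⟩
  | K j => exact ⟨0, fun n x hx =>
      smul_mem_grade (u := K j) (by rw [zpow_zero, one_smul, K_mul_K]) hx⟩
  | Kinv j => exact ⟨0, fun n x hx =>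
      smul_mem_grade (u := Kinv j) (by rw [zpow_zero, one_smul, K_mul_Kinv]) hx⟩

lemma sv_mem_grade (Λ : Fin 2 → ℕ) (i : Fin 2) : sv Λ ∈ grade Λ i (Λ i) := by
  rw [mem_grade, zpow_natCast, ← algebraMap_smul U (v ^ Λ i) (sv Λ), ← sub_eq_zero, ← sub_smul]
  unfold sv
  rw [← map_smul, smul_eq_mul, mul_one]
  refine (Submodule.Quotient.mk_eq_zero (maxIdeal Λ)).2 ?_
  exact (le_sup_left : vermaIdeal Λ ≤ maxIdeal Λ) (Submodule.subset_span (Or.inr ⟨i, rfl⟩))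

lemma iSup_grade (Λ : Fin 2 → ℕ) (i : Fin 2) : ⨆ n, grade Λ i n = ⊤ := by
  have stable : ∀ (a : Free) (x : L Λ), x ∈ ⨆ n, grade Λ i n →
      toU a • x ∈ ⨆ n, grade Λ i n := by
    intro a
    induction a using FreeAlgebra.induction with
    | grade0 r =>
      intro x hx
      rw [AlgHom.commutes, algebraMap_smul]
      exact Submodule.smul_mem _ r hx
    | grade1 g =>
      intro x hx
      obtain ⟨m, hm⟩ := gen_smul_mem_grade Λ i g
      induction hx using Submodule.iSup_induction' with
      | mem n y hy => exact Submodule.mem_iSup_of_mem (m + n) (hm n y hy)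
      | zero => simp
      | add y z _ _ hy hz => rw [smul_add]; exact add_mem hy hz
    | mul a b ha hb =>
      intro x hx
      rw [map_mul, mul_smul]
      exact ha _ (hb _ hx)
    | add a b ha hb =>
      intro x hx
      rw [map_add, add_smul]
      exact add_mem (ha _ hx) (hb _ hx)
  rw [eq_top_iff]
  intro x _
  obtain ⟨u, rfl⟩ : ∃ u, toL Λ u = x := Submodule.mkQ_surjective (maxIdeal Λ) x
  obtain ⟨a, rfl⟩ : ∃ a, toU a = u := RingQuot.mkAlgHom_surjective Kv Rel u
  have h := stable a (sv Λ) (Submodule.mem_iSup_of_mem _ (sv_mem_grade Λ i))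
  unfold sv at h
  rwa [← map_smul, smul_eq_mul, mul_one] at h

/-- `L(Λ)` is the direct sum of the eigenspaces of `K_i` for the eigenvalues `vⁿ`. -/
lemma isInternal_grade (Λ : Fin 2 → ℕ) (i : Fin 2) : DirectSum.IsInternal (grade Λ i) :=
  DirectSum.isInternal_submodule_of_iSupIndep_of_iSup_eq_top
    ((Module.End.eigenspaces_iSupIndep (Algebra.lsmul Kv Kv (L Λ) (K i))).comp v_zpow_injective)
    (iSup_grade Λ i)

/-- The component of `x` in the `vⁿ`-eigenspace of `K_i`. -/
def component (Λ : Fin 2 → ℕ) (i : Fin 2) (n : ℤ) (x : L Λ) : L Λ :=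
  ((LinearEquiv.ofBijective (DirectSum.coeLinearMap (grade Λ i))
    (isInternal_grade Λ i)).symm x n : grade Λ i n)

/-- Lusztig's symmetry `T'_{i,e}` of `L(Λ)`, `e = ±1`. On a vector `z` with `K_i z = vⁿ z` it is
`∑ (-1)^b v^{e(b - ac)} F_i^{(a)} E_i^{(b)} F_i^{(c)} z`, the sum over all `a, b, c ≥ 0` with
`a - b + c = n` (only finitely many terms are nonzero), and it is additive. -/
def T (Λ : Fin 2 → ℕ) (i : Fin 2) (e : ℤ) (x : L Λ) : L Λ :=
  ∑ᶠ n : ℤ, ∑ᶠ t : {t : ℕ × ℕ × ℕ // (t.1 : ℤ) - t.2.1 + t.2.2 = n},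
    ((-1) ^ t.1.2.1 * v ^ (e * ((t.1.2.1 : ℤ) - t.1.1 * t.1.2.2))) •
      (dF i t.1.1 • dE i t.1.2.1 • dF i t.1.2.2 • component Λ i n x)

/-! ### The canonical basis of `L(Λ)` -/

/-- The graph of the bar involution of `L(Λ)`: it is semilinear with respect to `v ↦ v⁻¹`, fixes
the highest vector and commutes with the `E_i` and the `F_i`. -/
inductive Bar (Λ : Fin 2 → ℕ) : L Λ → L Λ → Prop
  | sv : Bar Λ (sv Λ) (sv Λ)
  | add {x x' y y' : L Λ} : Bar Λ x x' → Bar Λ y y' → Bar Λ (x + y) (x' + y')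
  | smul (f : Kv) {x x' : L Λ} : Bar Λ x x' → Bar Λ (f • x) (barScalar f • x')
  | E (i : Fin 2) {x x' : L Λ} : Bar Λ x x' → Bar Λ (E i • x) (E i • x')
  | F (i : Fin 2) {x x' : L Λ} : Bar Λ x x' → Bar Λ (F i • x) (F i • x')

/-- The graph of Kashiwara's operator `F̃_i`: if `x = ∑ₙ F_i^{(n)} xₙ` with `E_i xₙ = 0`, then
`F̃_i x = ∑ₙ F_i^{(n+1)} xₙ`. -/
def Ftilde (Λ : Fin 2 → ℕ) (i : Fin 2) (x y : L Λ) : Prop :=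
  ∃ f : ℕ →₀ L Λ, (∀ n, E i • f n = 0) ∧
    x = f.sum (fun n z => dF i n • z) ∧ y = f.sum (fun n z => dF i (n + 1) • z)

/-- The vectors `F̃_{i₁} ⋯ F̃_{iₖ} sv`. -/
inductive CrystalVector (Λ : Fin 2 → ℕ) : L Λ → Prop
  | sv : CrystalVector Λ (sv Λ)
  | step (i : Fin 2) {x y : L Λ} : CrystalVector Λ x → Ftilde Λ i x y → CrystalVector Λ y

/-- The crystal lattice of `L(Λ)` at `v = ∞`. -/
def crystalLattice (Λ : Fin 2 → ℕ) : Submodule Ainf (L Λ) :=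
  Submodule.span Ainf {x | CrystalVector Λ x}

/-- `b` belongs to the canonical basis of `L(Λ)`: it is a nonzero bar-invariant vector of the
integral form which is congruent, modulo `v⁻¹` times the crystal lattice, to a vector
`F̃_{i₁} ⋯ F̃_{iₖ} sv`. -/
def IsCanonical (Λ : Fin 2 → ℕ) (b : L Λ) : Prop :=
  b ≠ 0 ∧ b ∈ LA Λ ∧ Bar Λ b b ∧
    ∃ c, CrystalVector Λ c ∧ ∃ y ∈ crystalLattice Λ, b - c = v⁻¹ • y

/-- `(x, y)` is the canonical basis of the weight space `L(Λ)_{(a, b)}`: both vectors belong to the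
canonical basis of `L(Λ)`, they form a basis of the weight space over `ℚ(v)`, and they span over
`𝒜` (hence form an `𝒜`-basis of) the weight space of the integral form. -/
structure IsCanonicalBasis (Λ : Fin 2 → ℕ) (a b : ℤ) (x y : L Λ) : Prop where
  canonical_left : IsCanonical Λ x
  canonical_right : IsCanonical Λ y
  linearIndependent : LinearIndependent Kv ![x, y]
  span_eq : Submodule.span Kv {x, y} = wtSpace Λ a b
  span_integral_eq :
    Submodule.span A {x, y} = LA Λ ⊓ (wtSpace Λ a b).restrictScalars A

end QSL3

end

set_option linter.unusedSectionVars false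
set_option linter.unusedSimpArgs false

noncomputable section

namespace QSL3

/-! Everything reduces to one computation in rank one. Let `X` be killed by `E_i`, of weight `f +
α_i` with `f i = n ≥ 0`, and let `Y` have weight `f` with `E_i Y = [k] X` (`IsString`). Then `Y` is
an `E_i`-highest vector plus a multiple of `F_i X`. On such a vector the `q`-binomial theorem kills
every term of Lusztig's sum with `a ≥ 1`, and `T'_{i,e} z = F_i^{(n)} z - v^e E_i F_i^{(n+1)} z`
remains (`T_apply`). Since `[k-1] - v^e [k] = -v^{ek}`, this gives `T'(F_i X) = -v^{e(n+2)}
F_i^{(n+1)} X` and `T'(Y) = -v^{ek} F_i^{(n+1)} X + W`, where `W = F_i^{(n)} Y - [k-1] F_i^{(n+1)}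
X` (`IsString.T_F_X`, `IsString.T_Y`).

For an ordered pair `i ≠ j` with weights `μ_i, μ_j`, three strings occur: `(F_j sv, F_j F_i sv)` for
`i` with `k = μ_i`, `(F_i^{(μ_i)} sv, F_i^{(μ_i)} F_j sv)` for `j` with `k = μ_j`, and `(F_j^{(p)}
F_i^{(μ_i-1)} sv, F_j^{(p)} F_i^{(μ_i)} sv)` for `i` with `k = 1`. The vector `W` is recognised by
the consequence `dF_mul_dF_mul_F` of the Serre relation. These are six of the formulas; exchanging
the nodes gives the other six.

The bases are carried along the same strings. In weight `Λ - α_1 - α_2` only two monomials exist,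
and applying `E_1` and `E_2` shows that they are independent (`isWtBasis_base`). This needs `sv ≠
0`, hence a nonzero highest weight module, which `Model` provides. A reflection transports a basis
because `F_i^{(n)}` is onto by integrability, while the integral element `IsString.back` undoes the
passage up to a triangular matrix with units of `𝒜` on the diagonal (`IsString.isWtBasis`).

Each basis vector is canonical in the strongest sense: it is a bar-invariant product of divided
powers of the `F_i`, and it equals a vector `F̃ ⋯ F̃ sv`, because each divided power acts on a
vector killed by the corresponding `E_i` (`IsExact`). One vector has this shape only after the
quantum Verma identity `verma_dF`. -/

/-! ### Quantum integers and Gaussian binomials -/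

/-- The quantum integer `[n]` for an integer `n`. -/
def zint (n : ℤ) : Kv := (v ^ n - v ^ (-n)) / (v - v⁻¹)

lemma v_zpow_ne_zero (n : ℤ) : v ^ n ≠ 0 := zpow_ne_zero _ v_ne_zero

lemma v_sub_inv_ne_zero : v - v⁻¹ ≠ 0 := by
  intro h
  have h1 : v ^ (1 : ℤ) = v ^ (-1 : ℤ) := by
    rw [zpow_one, zpow_neg_one]; exact sub_eq_zero.1 h
  have := v_zpow_injective h1
  omega

lemma v_sq_sub_one_ne_zero : v ^ 2 - 1 ≠ 0 := by
  have h := v_sub_inv_ne_zero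
  have h0 := v_ne_zero
  intro h'
  apply h
  field_simp
  simpa using h'

lemma qInt_eq_zint (n : ℕ) : qInt n = zint n := by
  simp [qInt, zint]

lemma zint_zero : zint 0 = 0 := by simp [zint]

lemma zint_one : zint 1 = 1 := by
  rw [zint, zpow_one, zpow_neg_one, div_self v_sub_inv_ne_zero]

lemma zint_neg (n : ℤ) : zint (-n) = -zint n := by
  simp only [zint, neg_neg]; ring

lemma zint_ne_zero {n : ℤ} (hn : n ≠ 0) : zint n ≠ 0 := by
  refine div_ne_zero ?_ v_sub_inv_ne_zero
  intro h
  have := v_zpow_injective (sub_eq_zero.1 h)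
  omega

lemma qFact_zero : qFact 0 = 1 := by simp [qFact]

lemma qFact_succ (n : ℕ) : qFact (n + 1) = qFact n * zint (n + 1) := by
  rw [qFact, Finset.prod_range_succ, ← qFact, qInt_eq_zint]; push_cast; rfl

lemma qFact_one : qFact 1 = 1 := by
  rw [qFact_succ, qFact_zero]; simp [zint_one]

lemma qFact_ne_zero (n : ℕ) : qFact n ≠ 0 := by
  rw [qFact, Finset.prod_ne_zero_iff]
  intro k _
  rw [qInt_eq_zint]
  exact zint_ne_zero (by omega)

/-- `[a + b] = v^b [a] + v^(-a) [b]`. -/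
lemma zint_add (a b : ℤ) : zint (a + b) = v ^ b * zint a + v ^ (-a) * zint b := by
  have h0 := v_ne_zero
  simp only [zint, neg_add, zpow_add₀ h0]
  ring

lemma zint_add' (a b : ℤ) : zint (a + b) = v ^ (-b) * zint a + v ^ a * zint b := by
  have h0 := v_ne_zero
  simp only [zint, neg_add, zpow_add₀ h0]
  ring

/-- The quadratic identity behind the `sl_2` commutation rules, the recursion of their Gaussian
binomials, and the determinant in `isWtBasis_base`. -/
lemma zint_mul_sub (a b c : ℤ) :
    zint (a - c) * zint (b - c) + zint c * zint (a + b - c) = zint a * zint b := by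
  have h0 := v_ne_zero
  have h := v_sub_inv_ne_zero
  have ha := v_zpow_ne_zero a
  have hb := v_zpow_ne_zero b
  have hc := v_zpow_ne_zero c
  simp only [zint, neg_sub, zpow_sub₀ h0, zpow_add₀ h0, zpow_neg]
  generalize v ^ a = x at *
  generalize v ^ b = y at *
  generalize v ^ c = z at *
  generalize v - v⁻¹ = w at *
  field_simp
  ring

/-- The Gaussian binomial coefficient with an integer at the top. -/
def zbin (n : ℤ) (t : ℕ) : Kv := (∏ k ∈ Finset.range t, zint (n - k)) / qFact t

lemma zbin_zero (n : ℤ) : zbin n 0 = 1 := by simp [zbin, qFact_zero]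

lemma zbin_succ (n : ℤ) (t : ℕ) : zbin n (t + 1) * zint (t + 1) = zbin n t * zint (n - t) := by
  have h1 := qFact_ne_zero t
  have h2 : zint (t + 1) ≠ 0 := zint_ne_zero (by omega)
  rw [zbin, zbin, Finset.prod_range_succ, qFact_succ]
  field_simp

lemma zbin_succ_succ (n : ℤ) (t : ℕ) :
    zbin (n + 1) (t + 1) * zint (t + 1) = zint (n + 1) * zbin n t := by
  have h1 := qFact_ne_zero t
  have h2 : zint (t + 1) ≠ 0 := zint_ne_zero (by omega)
  rw [zbin, zbin, Finset.prod_range_succ', qFact_succ]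
  have : ∀ k : ℕ, zint (n + 1 - ((k + 1 : ℕ) : ℤ)) = zint (n - k) := fun k => by
    congr 1; push_cast; ring
  simp only [this]
  simp
  field_simp

lemma zbin_pascal (n : ℤ) (t : ℕ) :
    zbin (n + 1) (t + 1) = v ^ ((t : ℤ) + 1) * zbin n (t + 1) + v ^ (t - n) * zbin n t := by
  have h2 : zint (t + 1) ≠ 0 := zint_ne_zero (by omega)
  refine mul_right_cancel₀ h2 ?_
  rw [zbin_succ_succ, add_mul, mul_assoc, zbin_succ, mul_assoc]
  have : zint (n + 1) = v ^ ((t : ℤ) + 1) * zint (n - t) + v ^ (t - n) * zint (t + 1) := by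
    have := zint_add (n - t) (t + 1)
    rw [neg_sub] at this
    rw [← this]; congr 1; ring
  rw [this]; ring

lemma zbin_pascal' (n : ℤ) (t : ℕ) :
    zbin (n + 1) (t + 1) = v ^ (-((t : ℤ) + 1)) * zbin n (t + 1) + v ^ (n - t) * zbin n t := by
  have h2 : zint (t + 1) ≠ 0 := zint_ne_zero (by omega)
  refine mul_right_cancel₀ h2 ?_
  rw [zbin_succ_succ, add_mul, mul_assoc, zbin_succ, mul_assoc]
  have : zint (n + 1) = v ^ (-((t : ℤ) + 1)) * zint (n - t) + v ^ (n - t) * zint (t + 1) := by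
    have := zint_add' (n - t) (t + 1)
    rw [← this]; congr 1; ring
  rw [this]; ring

lemma zbin_eq_zero {n : ℕ} {t : ℕ} (h : n < t) : zbin n t = 0 := by
  rw [zbin, Finset.prod_eq_zero (Finset.mem_range.2 h), zero_div]
  simp [zint_zero]

lemma zbin_self (n : ℕ) : zbin n n = 1 := by
  induction n with
  | zero => simp [zbin_zero]
  | succ n ih =>
    have h2 : zint (n + 1) ≠ 0 := zint_ne_zero (by omega)
    refine mul_right_cancel₀ h2 ?_
    push_cast
    rw [zbin_succ_succ, ih, mul_one, one_mul]

lemma zbin_succ_self (n : ℕ) : zbin (n + 1) n = zint (n + 1) := by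
  have h := zbin_succ (n + 1) n
  have h3 := zbin_self (n + 1)
  push_cast at h3
  rw [h3, one_mul, add_sub_cancel_left, zint_one, mul_one] at h
  exact h.symm

/-! ### Membership in `𝒜` -/

lemma v_mem_A : v ∈ A := Algebra.subset_adjoin (by simp)

lemma v_inv_mem_A : v⁻¹ ∈ A := Algebra.subset_adjoin (by simp)

lemma v_zpow_mem_A (n : ℤ) : v ^ n ∈ A := by
  rcases Int.eq_nat_or_neg n with ⟨k, rfl | rfl⟩
  · rw [zpow_natCast]; exact pow_mem v_mem_A k
  · rw [zpow_neg, zpow_natCast, ← inv_pow]; exact pow_mem v_inv_mem_A k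

/-- Pascal's rule runs upwards from `n = 0` and, solved for its other term, whose coefficient is a
power of `v`, also downwards to negative `n`. -/
lemma zbin_mem_A (n : ℤ) (t : ℕ) : zbin n t ∈ A := by
  induction t generalizing n with
  | zero => rw [zbin_zero]; exact one_mem _
  | succ t ih =>
    induction n using Int.induction_on with
    | zero =>
      have := zbin_eq_zero (n := 0) (t := t + 1) (by omega)
      simp only [Nat.cast_zero] at this
      rw [this]; exact zero_mem _
    | succ n hn =>
      rw [zbin_pascal]
      exact add_mem (mul_mem (v_zpow_mem_A _) hn) (mul_mem (v_zpow_mem_A _) (ih _))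
    | pred n hn =>
      have h := zbin_pascal (-n - 1) t
      rw [sub_add_cancel] at h
      have h' : zbin (-n - 1) (t + 1) = v ^ (-((t : ℤ) + 1)) *
          (zbin (-n) (t + 1) - v ^ (t - (-(n : ℤ) - 1)) * zbin (-n - 1) t) := by
        rw [h, add_sub_cancel_right, ← mul_assoc, ← zpow_add₀ v_ne_zero]; simp
      rw [h']
      exact mul_mem (v_zpow_mem_A _) (sub_mem hn (mul_mem (v_zpow_mem_A _) (ih _)))

lemma zint_mem_A (n : ℤ) : zint n ∈ A := by
  have := zbin_mem_A n 1
  simpa [zbin, qFact_one] using this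

/-! ### The `q`-binomial theorem at its roots -/

/-- `∑_b (-1)^b v^{bs} [N choose b]`. -/
def altSum (N : ℕ) (s : ℤ) : Kv :=
  ∑ b ∈ Finset.range (N + 1), (-1) ^ b * v ^ (b * s) * zbin N b

/-- Pascal's rule peels off one factor of the product `∏_{l<N} (1 - v^{s-N+1+2l})`, whose roots are
`s = N-1, N-3, …, 1-N`. This lemma and `altSum_succ'` start from opposite ends, so the two outermost
roots at each end are quickly reached. -/
lemma altSum_succ (N : ℕ) (s : ℤ) :
    altSum (N + 1) s = (1 - v ^ (s - N)) * altSum N (s + 1) := by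
  have h0 := v_ne_zero
  have e1 : altSum N (s + 1) = 1 + ∑ b ∈ Finset.range (N + 1),
      (-1) ^ (b + 1) * v ^ (((b : ℤ) + 1) * (s + 1)) * zbin N (b + 1) := by
    rw [Finset.sum_range_succ, zbin_eq_zero (Nat.lt_succ_self N), mul_zero, add_zero, altSum,
      Finset.sum_range_succ']
    simp [zbin_zero, add_comm]
  have e2 : altSum (N + 1) s = 1 + ∑ b ∈ Finset.range (N + 1),
      (-1) ^ (b + 1) * v ^ (((b : ℤ) + 1) * s) * zbin (N + 1) (b + 1) := by
    rw [altSum, Finset.sum_range_succ']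
    simp [zbin_zero, add_comm]
  rw [sub_mul, one_mul, e2]
  nth_rw 1 [e1]
  rw [altSum, Finset.mul_sum, add_sub_assoc, ← Finset.sum_sub_distrib]
  congr 1
  refine Finset.sum_congr rfl fun b _ => ?_
  rw [zbin_pascal]
  have p1 : v ^ (((b : ℤ) + 1) * (s + 1)) = v ^ (((b : ℤ) + 1) * s) * v ^ ((b : ℤ) + 1) := by
    rw [← zpow_add₀ h0]; congr 1; ring
  have p2 : v ^ (s - N) * v ^ (b * (s + 1)) = v ^ (((b : ℤ) + 1) * s) * v ^ ((b : ℤ) - N) := by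
    rw [← zpow_add₀ h0, ← zpow_add₀ h0]; congr 1; ring
  rw [p1]
  linear_combination ((-1) ^ b * zbin N b) * p2

lemma altSum_succ' (N : ℕ) (s : ℤ) :
    altSum (N + 1) s = (1 - v ^ (s + N)) * altSum N (s - 1) := by
  have h0 := v_ne_zero
  have e1 : altSum N (s - 1) = 1 + ∑ b ∈ Finset.range (N + 1),
      (-1) ^ (b + 1) * v ^ (((b : ℤ) + 1) * (s - 1)) * zbin N (b + 1) := by
    rw [Finset.sum_range_succ, zbin_eq_zero (Nat.lt_succ_self N), mul_zero, add_zero, altSum,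
      Finset.sum_range_succ']
    simp [zbin_zero, add_comm]
  have e2 : altSum (N + 1) s = 1 + ∑ b ∈ Finset.range (N + 1),
      (-1) ^ (b + 1) * v ^ (((b : ℤ) + 1) * s) * zbin (N + 1) (b + 1) := by
    rw [altSum, Finset.sum_range_succ']
    simp [zbin_zero, add_comm]
  rw [sub_mul, one_mul, e2]
  nth_rw 1 [e1]
  rw [altSum, Finset.mul_sum, add_sub_assoc, ← Finset.sum_sub_distrib]
  congr 1
  refine Finset.sum_congr rfl fun b _ => ?_
  rw [zbin_pascal']
  have p1 : v ^ (((b : ℤ) + 1) * (s - 1)) = v ^ (((b : ℤ) + 1) * s) * v ^ (-((b : ℤ) + 1)) := by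
    rw [← zpow_add₀ h0]; congr 1; ring
  have p2 : v ^ (s + N) * v ^ (b * (s - 1)) = v ^ (((b : ℤ) + 1) * s) * v ^ ((N : ℤ) - b) := by
    rw [← zpow_add₀ h0, ← zpow_add₀ h0]; congr 1; ring
  rw [p1]
  linear_combination ((-1) ^ b * zbin N b) * p2

lemma altSum_top (N : ℕ) : altSum (N + 1) N = 0 := by
  rw [altSum_succ]; simp

lemma altSum_bot (N : ℕ) : altSum (N + 1) (-N) = 0 := by
  rw [altSum_succ']; simp

lemma altSum_top' (N : ℕ) : altSum (N + 2) (N - 1) = 0 := by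
  rw [altSum_succ, sub_add_cancel, altSum_top, mul_zero]

lemma altSum_bot' (N : ℕ) : altSum (N + 2) (1 - N) = 0 := by
  have : (1 - (N : ℤ)) - 1 = -N := by ring
  rw [altSum_succ', this, altSum_bot, mul_zero]

section Relations

attribute [local instance] Semiring.toNatAlgebra Ring.toIntAlgebra

/-! ### Relations in `U` -/

lemma E_mul_F_same (i : Fin 2) :
    E i * F i = F i * E i + (v - v⁻¹)⁻¹ • (K i - Kinv i) := by
  have := toU_rel (Rel.E_F_same i)
  simp only [map_sub, map_mul, map_smul] at this
  rw [← sub_eq_iff_eq_add']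
  exact this

lemma E_mul_F_diff {i j : Fin 2} (h : i ≠ j) : E i * F j = F j * E i := by
  have := toU_rel (Rel.E_F_diff i j h)
  simpa only [map_mul] using! this

lemma serre_F {i j : Fin 2} (h : i ≠ j) :
    F i * F i * F j + F j * F i * F i = (v + v⁻¹) • (F i * F j * F i) := by
  have := toU_rel (Rel.serre_F i j h)
  simpa only [map_mul, map_add, map_smul] using! this

lemma E_mul_dF_diff {i j : Fin 2} (h : i ≠ j) (s : ℕ) : E i * dF j s = dF j s * E i := by
  have : Commute (E i) (F j) := E_mul_F_diff h
  rw [dF, mul_smul_comm, smul_mul_assoc, (this.pow_right s).eq]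

lemma dE_mul_dF_diff {i j : Fin 2} (h : i ≠ j) (r s : ℕ) :
    dE i r * dF j s = dF j s * dE i r := by
  have : Commute (E i) (F j) := E_mul_F_diff h
  simp only [dF, dE, mul_smul_comm, smul_mul_assoc, ((this.pow_right s).pow_left r).eq]
  rw [smul_comm]

lemma dF_zero (i : Fin 2) : dF i 0 = 1 := by simp [dF, qFact_zero]

lemma dE_zero (i : Fin 2) : dE i 0 = 1 := by simp [dE, qFact_zero]

lemma dF_one (i : Fin 2) : dF i 1 = F i := by simp [dF, qFact_one]

lemma dE_one (i : Fin 2) : dE i 1 = E i := by simp [dE, qFact_one]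

lemma F_mul_dF (i : Fin 2) (n : ℕ) : F i * dF i n = zint (n + 1) • dF i (n + 1) := by
  have h1 := qFact_ne_zero n
  have h2 : zint (n + 1) ≠ 0 := zint_ne_zero (by omega)
  rw [dF, dF, mul_smul_comm, ← pow_succ', smul_smul, qFact_succ]
  congr 1
  field_simp

lemma dF_mul_F (i : Fin 2) (n : ℕ) : dF i n * F i = zint (n + 1) • dF i (n + 1) := by
  rw [← F_mul_dF, dF, mul_smul_comm, smul_mul_assoc, ← pow_succ, ← pow_succ']

lemma E_mul_dE (i : Fin 2) (n : ℕ) : E i * dE i n = zint (n + 1) • dE i (n + 1) := by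
  have h1 := qFact_ne_zero n
  have h2 : zint (n + 1) ≠ 0 := zint_ne_zero (by omega)
  rw [dE, dE, mul_smul_comm, ← pow_succ', smul_smul, qFact_succ]
  congr 1
  field_simp

/-! ### The root vector and the Serre relation as `q`-commutation -/

/-- The root vector `F_i F_j - v F_j F_i`. -/
def rootF (i j : Fin 2) : U := F i * F j - v • (F j * F i)

lemma F_mul_F (i j : Fin 2) : F i * F j = v • (F j * F i) + rootF i j := by
  rw [rootF]; abel

lemma F_mul_rootF {i j : Fin 2} (h : i ≠ j) : F i * rootF i j = v⁻¹ • (rootF i j * F i) := by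
  have hs := serre_F h
  have h0 := v_ne_zero
  simp only [rootF, mul_sub, sub_mul, mul_smul_comm, smul_mul_assoc, smul_sub, smul_smul,
    inv_mul_cancel₀ h0, one_smul, ← mul_assoc]
  rw [add_smul] at hs
  linear_combination (norm := module) hs

lemma rootF_mul_F {i j : Fin 2} (h : i ≠ j) : rootF i j * F j = v⁻¹ • (F j * rootF i j) := by
  have hs := serre_F h.symm
  have h0 := v_ne_zero
  simp only [rootF, mul_sub, sub_mul, mul_smul_comm, smul_mul_assoc, smul_sub, smul_smul,
    inv_mul_cancel₀ h0, one_smul, ← mul_assoc]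
  rw [add_smul] at hs
  linear_combination (norm := module) hs

lemma F_pow_mul_rootF {i j : Fin 2} (h : i ≠ j) (a : ℕ) :
    F i ^ a * rootF i j = v ^ (-(a : ℤ)) • (rootF i j * F i ^ a) := by
  induction a with
  | zero => simp
  | succ a ih =>
    rw [pow_succ', mul_assoc, ih, mul_smul_comm, ← mul_assoc, F_mul_rootF h, smul_mul_assoc,
      smul_smul, mul_assoc]
    congr 1
    push_cast
    rw [neg_add, zpow_add₀ v_ne_zero, zpow_neg_one]

lemma rootF_mul_F_pow {i j : Fin 2} (h : i ≠ j) (b : ℕ) :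
    rootF i j * F j ^ b = v ^ (-(b : ℤ)) • (F j ^ b * rootF i j) := by
  induction b with
  | zero => simp
  | succ b ih =>
    rw [pow_succ, ← mul_assoc, ih, smul_mul_assoc, mul_assoc, rootF_mul_F h, mul_smul_comm,
      smul_smul, mul_assoc]
    congr 1
    push_cast
    rw [neg_add, zpow_add₀ v_ne_zero, zpow_neg_one]

lemma rootF_pow_mul_F {i j : Fin 2} (h : i ≠ j) (k : ℕ) :
    rootF i j ^ k * F j = v ^ (-(k : ℤ)) • (F j * rootF i j ^ k) := by
  induction k with
  | zero => simp
  | succ k ih =>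
    rw [pow_succ', mul_assoc, ih, mul_smul_comm, ← mul_assoc, rootF_mul_F h, smul_mul_assoc,
      smul_smul, mul_assoc]
    congr 1
    push_cast
    rw [neg_add, zpow_add₀ v_ne_zero, zpow_neg_one]

lemma F_pow_succ_mul_F {i j : Fin 2} (h : i ≠ j) (a : ℕ) :
    F i ^ (a + 1) * F j = v ^ ((a : ℤ) + 1) • (F j * F i ^ (a + 1)) +
      zint (a + 1) • (rootF i j * F i ^ a) := by
  induction a with
  | zero => simpa [zint_one] using F_mul_F i j
  | succ a ih =>
    have e : zint (a + 1 + 1) = v ^ ((a : ℤ) + 1) + v⁻¹ * zint (a + 1) := by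
      have := zint_add' (a + 1) 1
      rw [this, zint_one, zpow_neg_one]; ring
    rw [pow_succ', mul_assoc, ih, mul_add, mul_smul_comm, mul_smul_comm, ← mul_assoc,
      ← mul_assoc, F_mul_F, F_mul_rootF h]
    push_cast
    rw [e, zpow_add_one₀ v_ne_zero (_ + 1)]
    simp only [pow_succ', add_mul, smul_mul_assoc, mul_assoc]
    module

lemma F_mul_F_pow_succ {i j : Fin 2} (h : i ≠ j) (b : ℕ) :
    F i * F j ^ (b + 1) = v ^ ((b : ℤ) + 1) • (F j ^ (b + 1) * F i) +
      zint (b + 1) • (F j ^ b * rootF i j) := by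
  induction b with
  | zero => simpa [zint_one] using F_mul_F i j
  | succ b ih =>
    have e : zint (b + 1 + 1) = v ^ ((b : ℤ) + 1) + v⁻¹ * zint (b + 1) := by
      have := zint_add' (b + 1) 1
      rw [this, zint_one, zpow_neg_one]; ring
    rw [pow_succ, ← mul_assoc, ih, add_mul, smul_mul_assoc, smul_mul_assoc, mul_assoc _ (F i),
      mul_assoc _ (rootF i j), F_mul_F, rootF_mul_F h]
    push_cast
    rw [e, zpow_add_one₀ v_ne_zero (_ + 1)]
    simp only [pow_succ, mul_add, mul_smul_comm, mul_assoc]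
    module

/-- `[a+1] F_i^a F_j^(b+1) F_i = [b+1] F_j F_i^(a+1) F_j^b + [a-b] F_i^(a+1) F_j^(b+1)`. -/
lemma F_pow_mul_F_pow_mul_F {i j : Fin 2} (h : i ≠ j) (a b : ℕ) :
    zint (a + 1) • (F i ^ a * F j ^ (b + 1) * F i) =
      zint (b + 1) • (F j * F i ^ (a + 1) * F j ^ b) +
        zint (a - b) • (F i ^ (a + 1) * F j ^ (b + 1)) := by
  have h0 := v_ne_zero
  have e1 : F j * F i ^ (a + 1) = v ^ (-((a : ℤ) + 1)) • (F i ^ (a + 1) * F j) -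
      (v ^ (-((a : ℤ) + 1)) * zint (a + 1)) • (rootF i j * F i ^ a) := by
    rw [F_pow_succ_mul_F h, smul_add, smul_smul, ← zpow_add₀ h0, smul_smul]
    simp
  have e2 : rootF i j * F i ^ a * F j ^ b =
      v ^ ((a : ℤ) - b) • (F i ^ a * F j ^ b * rootF i j) := by
    have := F_pow_mul_rootF h a
    have h3 : rootF i j * F i ^ a = v ^ (a : ℤ) • (F i ^ a * rootF i j) := by
      rw [this, smul_smul, ← zpow_add₀ h0]; simp
    rw [h3, smul_mul_assoc, mul_assoc, rootF_mul_F_pow h, mul_smul_comm, smul_smul,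
      ← zpow_add₀ h0, mul_assoc, sub_eq_add_neg]
  have e3 : F i ^ (a + 1) * F j ^ (b + 1) = v ^ ((b : ℤ) + 1) • (F i ^ a * F j ^ (b + 1) * F i) +
      zint (b + 1) • (F i ^ a * F j ^ b * rootF i j) := by
    rw [pow_succ, mul_assoc, F_mul_F_pow_succ h, mul_add, mul_smul_comm, mul_smul_comm]
    simp only [mul_assoc]
  have e4 : F i ^ (a + 1) * F j * F j ^ b = F i ^ (a + 1) * F j ^ (b + 1) := by
    rw [mul_assoc, ← pow_succ']
  -- All terms now lie in the span of `F_i^a F_j^(b+1) F_i` and `F_i^a F_j^b rootF`, so two scalar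
  -- identities remain.
  rw [e1, sub_mul, smul_mul_assoc, smul_mul_assoc, e2, e4, e3]
  have z1 : zint (a - b) = v ^ (-((b : ℤ) + 1)) * zint (a + 1) -
      v ^ (-((a : ℤ) + 1)) * zint (b + 1) := by
    have := zint_add (a + 1) (-(b + 1))
    rw [zint_neg] at this
    have h' : (a : ℤ) - b = a + 1 + -(b + 1) := by ring
    rw [h', this]; ring
  have p1 : v ^ ((a : ℤ) - b) = v ^ (-((b : ℤ) + 1)) * v ^ ((a : ℤ) + 1) := by
    rw [← zpow_add₀ h0]; congr 1; ring
  have p2 : v ^ ((a : ℤ) + 1) * v ^ (-((a : ℤ) + 1)) = 1 := by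
    rw [← zpow_add₀ h0]; simp
  have p3 : v ^ ((b : ℤ) + 1) * v ^ (-((b : ℤ) + 1)) = 1 := by
    rw [← zpow_add₀ h0]; simp
  rw [z1, p1]
  generalize v ^ ((a : ℤ) + 1) = x at *
  generalize v ^ (-((a : ℤ) + 1)) = x' at *
  generalize v ^ ((b : ℤ) + 1) = y at *
  generalize v ^ (-((b : ℤ) + 1)) = y' at *
  match_scalars
  · linear_combination (-zint (a + 1)) * p3
  · linear_combination (zint (a + 1) * zint (b + 1) * y') * p2

/-- This computes `F_i^{(n)} Y` for the strings of the theorem: the first term on the right is the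
new basis vector `W`, the second the multiple `[k-1]` of `F_i^{(n+1)} X`. -/
lemma dF_mul_dF_mul_F {i j : Fin 2} (h : i ≠ j) (a b : ℕ) :
    dF i a * dF j (b + 1) * F i =
      F j * dF i (a + 1) * dF j b + zint (a - b) • (dF i (a + 1) * dF j (b + 1)) := by
  have h1 := qFact_ne_zero a
  have h2 := qFact_ne_zero b
  have h3 : zint (a + 1) ≠ 0 := zint_ne_zero (by omega)
  have h4 : zint (b + 1) ≠ 0 := zint_ne_zero (by omega)
  have key := F_pow_mul_F_pow_mul_F h a b
  have key2 : F i ^ a * F j ^ (b + 1) * F i = (zint (a + 1))⁻¹ •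
      (zint (b + 1) • (F j * F i ^ (a + 1) * F j ^ b) +
        zint (a - b) • (F i ^ (a + 1) * F j ^ (b + 1))) := by
    rw [← key, smul_smul, inv_mul_cancel₀ h3, one_smul]
  simp only [dF, mul_smul_comm, smul_mul_assoc, smul_smul, qFact_succ]
  rw [key2]
  match_scalars <;> field_simp

/-! ### Reordering `F_i^a F_j^c` and the Verma identity -/

/-- The falling product `[a][a-1]⋯[a-k+1]`. -/
def zfall (a : ℤ) (k : ℕ) : Kv := ∏ l ∈ Finset.range k, zint (a - l)

lemma zfall_succ (a : ℤ) (k : ℕ) : zfall a (k + 1) = zfall a k * zint (a - k) :=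
  Finset.prod_range_succ _ _

lemma zfall_succ' (a : ℤ) (k : ℕ) : zfall (a + 1) (k + 1) = zint (a + 1) * zfall a k := by
  rw [zfall, Finset.prod_range_succ', mul_comm, zfall]
  congr 1
  · simp
  · refine Finset.prod_congr rfl fun l _ => ?_
    congr 1; push_cast; ring

lemma zfall_eq_zero {a k : ℕ} (h : a < k) : zfall a k = 0 :=
  Finset.prod_eq_zero (Finset.mem_range.2 h) (by simp [zint_zero])

/-- The coefficient of `F_j^(c-k) rootF^k F_i^(a-k)` in `F_i^a F_j^c`. -/
def reorderCoeff (a c k : ℕ) : Kv :=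
  v ^ (((a : ℤ) - k) * (c - k)) * (zfall a k * zfall c k) / qFact k

lemma reorderCoeff_comm (a c k : ℕ) : reorderCoeff a c k = reorderCoeff c a k := by
  rw [reorderCoeff, reorderCoeff, mul_comm ((a : ℤ) - k), mul_comm (zfall a k)]

lemma reorderCoeff_zero (a c : ℕ) : reorderCoeff a c 0 = v ^ ((a : ℤ) * c) := by
  simp [reorderCoeff, zfall, qFact_zero]

lemma reorderCoeff_succ (a c k : ℕ) :
    reorderCoeff a (c + 1) (k + 1) = v ^ ((a : ℤ) - 2 * (k + 1)) * reorderCoeff a c (k + 1) +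
      zint (a - k) * reorderCoeff a c k := by
  have h0 := v_ne_zero
  have h1 := qFact_ne_zero k
  have h2 : zint (k + 1) ≠ 0 := zint_ne_zero (by omega)
  have e : zint (c + 1) = v ^ (-((k : ℤ) + 1)) * zint (c - k) + v ^ ((c : ℤ) - k) * zint (k + 1) := by
    have := zint_add' (c - k) (k + 1)
    rw [← this]; congr 1; ring
  simp only [reorderCoeff]
  push_cast
  rw [zfall_succ' c k, zfall_succ a k, zfall_succ c k, qFact_succ, e]
  have p1 : v ^ (((a : ℤ) - (k + 1)) * (c + 1 - (k + 1))) * v ^ (-((k : ℤ) + 1)) =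
      v ^ ((a : ℤ) - 2 * (k + 1)) * v ^ (((a : ℤ) - (k + 1)) * (c - (k + 1))) := by
    rw [← zpow_add₀ h0, ← zpow_add₀ h0]; congr 1; ring
  have p2 : v ^ (((a : ℤ) - (k + 1)) * (c + 1 - (k + 1))) * v ^ ((c : ℤ) - k) =
      v ^ (((a : ℤ) - k) * (c - k)) := by
    rw [← zpow_add₀ h0]; congr 1; ring
  field_simp
  linear_combination (zint (c - k) * zfall a k * zfall c k * zint (a - k)) * p1 +
    (zint (k + 1) * zfall a k * zfall c k * zint (a - k)) * p2

/-- Induction on `c`, moving one more `F_j` to the left past `F_i^(a-k)` and `rootF^k`. What matters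
is that the coefficient is symmetric in `a` and `c`. -/
lemma F_pow_mul_F_pow {i j : Fin 2} (h : i ≠ j) (a c : ℕ) :
    F i ^ a * F j ^ c = ∑ k ∈ Finset.range (a + 1),
      reorderCoeff a c k • (F j ^ (c - k) * rootF i j ^ k * F i ^ (a - k)) := by
  have h0 := v_ne_zero
  induction c with
  | zero =>
    rw [Finset.sum_range_succ', Finset.sum_eq_zero]
    · simp [reorderCoeff_zero]
    · intro k _
      rw [reorderCoeff, zfall_eq_zero (a := 0) (by omega)]
      simp
  | succ c ih =>
    have step : ∀ k ∈ Finset.range (a + 1),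
        reorderCoeff a c k • (F j ^ (c - k) * rootF i j ^ k * F i ^ (a - k)) * F j =
        (v ^ ((a : ℤ) - 2 * k) * reorderCoeff a c k) •
            (F j ^ (c + 1 - k) * rootF i j ^ k * F i ^ (a - k)) +
          (zint (a - k) * reorderCoeff a c k) •
            (F j ^ (c - k) * rootF i j ^ (k + 1) * F i ^ (a - (k + 1))) := by
      intro k hk
      rw [Finset.mem_range] at hk
      -- For `k > c` the truncated exponent `c - k` is harmless, since the coefficient contains
      -- `[0]`.
      by_cases hkc : k ≤ c
      swap
      · have : reorderCoeff a c k = 0 := by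
          rw [reorderCoeff, zfall_eq_zero (a := c) (by omega)]; simp
        simp [this]
      have hroot : F j ^ (c - k) * (rootF i j ^ k * F j) =
          v ^ (-(k : ℤ)) • (F j ^ (c + 1 - k) * rootF i j ^ k) := by
        rw [rootF_pow_mul_F h, mul_smul_comm, ← mul_assoc, ← pow_succ, Nat.sub_add_comm hkc]
      rcases Nat.lt_or_ge k a with hka | hka
      · obtain ⟨m, rfl⟩ : ∃ m, a = k + 1 + m := ⟨a - (k + 1), by omega⟩
        have e1 : k + 1 + m - k = m + 1 := by omega
        have e2 : k + 1 + m - (k + 1) = m := by omega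
        rw [e1, e2, smul_mul_assoc, mul_assoc, F_pow_succ_mul_F h, mul_add, mul_smul_comm,
          mul_smul_comm]
        have e3 : F j ^ (c - k) * rootF i j ^ k * (F j * F i ^ (m + 1)) =
            v ^ (-(k : ℤ)) • (F j ^ (c + 1 - k) * rootF i j ^ k * F i ^ (m + 1)) := by
          rw [← smul_mul_assoc, ← hroot]; simp only [mul_assoc]
        have e4 : F j ^ (c - k) * rootF i j ^ k * (rootF i j * F i ^ m) =
            F j ^ (c - k) * rootF i j ^ (k + 1) * F i ^ m := by
          rw [pow_succ (rootF i j)]; simp only [mul_assoc]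
        have e5 : v ^ (((k + 1 + m : ℕ) : ℤ) - 2 * k) = v ^ ((m : ℤ) + 1) * v ^ (-(k : ℤ)) := by
          rw [← zpow_add₀ h0]; congr 1; push_cast; ring
        have e6 : ((k + 1 + m : ℕ) : ℤ) - k = m + 1 := by push_cast; ring
        rw [e3, e4, e5, e6]
        module
      · obtain rfl : k = a := by omega
        simp only [Nat.sub_self, pow_zero, mul_one, sub_self, zint_zero, zero_mul, zero_smul,
          add_zero, smul_mul_assoc]
        rw [mul_assoc, hroot, smul_smul, mul_comm]
        congr 3; ring
    rw [pow_succ, ← mul_assoc, ih, Finset.sum_mul, Finset.sum_congr rfl step,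
      Finset.sum_add_distrib, Finset.sum_range_succ', Finset.sum_range_succ (n := a), sub_self,
      zint_zero, zero_mul, zero_smul, add_zero, Finset.sum_range_succ', add_right_comm,
      ← Finset.sum_add_distrib]
    congr 1
    · refine Finset.sum_congr rfl fun k _ => ?_
      rw [reorderCoeff_succ, add_smul, Nat.add_sub_add_right]
      push_cast
      rfl
    · rw [reorderCoeff_zero, reorderCoeff_zero, ← zpow_add₀ h0]
      congr 2; push_cast; ring

/-- The quantum Verma identity. -/
lemma verma_F_pow {i j : Fin 2} (h : i ≠ j) (a b : ℕ) :
    F i ^ a * F j ^ (a + b) * F i ^ b = F j ^ b * F i ^ (a + b) * F j ^ a := by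
  -- Both sides become combinations of `F_j^(a+b-k) rootF^k F_i^(a+b-k)`, with coefficients for `(a,
  -- a+b, k)` and `(a+b, a, k)`; these agree by symmetry and vanish for `k > a`.
  rw [F_pow_mul_F_pow h, mul_assoc, F_pow_mul_F_pow h, Finset.sum_mul, Finset.mul_sum,
    ← Finset.sum_subset (Finset.range_mono (by omega : a + 1 ≤ a + b + 1))]
  · refine Finset.sum_congr rfl fun k hk => ?_
    rw [Finset.mem_range] at hk
    rw [reorderCoeff_comm, smul_mul_assoc, mul_smul_comm, mul_assoc, ← pow_add, ← mul_assoc,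
      ← mul_assoc, ← pow_add]
    have e1 : a - k + b = a + b - k := by omega
    have e2 : b + (a - k) = a + b - k := by omega
    rw [e1, e2]
  · intro k _ hk
    rw [Finset.mem_range] at hk
    rw [reorderCoeff_comm, reorderCoeff, zfall_eq_zero (a := a) (by omega)]
    simp

lemma verma_dF {i j : Fin 2} (h : i ≠ j) (a b : ℕ) :
    dF i a * dF j (a + b) * dF i b = dF j b * dF i (a + b) * dF j a := by
  simp only [dF, mul_smul_comm, smul_mul_assoc, smul_smul, verma_F_pow h]
  congr 1
  ring

end Relations

/-! ### Weight vectors in a `U`-module -/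

section Modules

variable {M : Type*} [AddCommGroup M] [Module Kv M] [Module U M] [IsScalarTower Kv U M]

/-- `K_i` acts on `x` by `v^n`. -/
def HasWt (i : Fin 2) (n : ℤ) (x : M) : Prop := K i • x = v ^ n • x

lemma smul_smul_comm_U (c : Kv) (u : U) (x : M) : u • c • x = c • u • x := by
  rw [← algebraMap_smul U c x, ← mul_smul, ← Algebra.commutes, mul_smul, algebraMap_smul]

lemma Kinv_smul {i : Fin 2} {n : ℤ} {x : M} (hx : HasWt i n x) :
    Kinv i • x = v ^ (-n) • x := by
  have h : x = v ^ (-n) • K i • x := by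
    rw [hx, smul_smul, ← zpow_add₀ v_ne_zero]; simp
  conv_lhs => rw [h]
  rw [smul_smul_comm_U, ← mul_smul, Kinv_mul_K', one_smul]

lemma HasWt.of_comm {i : Fin 2} {n m : ℤ} {u : U} (hu : K i * u = v ^ m • (u * K i)) {x : M}
    (hx : HasWt i n x) : HasWt i (n + m) (u • x) := by
  rw [HasWt] at *
  rw [← mul_smul, hu, smul_assoc, mul_smul, hx, smul_smul_comm_U, smul_smul,
    ← zpow_add₀ v_ne_zero, add_comm]

lemma HasWt.E {i : Fin 2} {n : ℤ} {x : M} (hx : HasWt i n x) (j : Fin 2) :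
    HasWt i (n + cartan i j) (E j • x) := hx.of_comm (K_mul_E i j)

lemma HasWt.F {i : Fin 2} {n : ℤ} {x : M} (hx : HasWt i n x) (j : Fin 2) :
    HasWt i (n - cartan i j) (F j • x) := hx.of_comm (K_mul_F i j)

lemma HasWt.smul {i : Fin 2} {n : ℤ} {x : M} (hx : HasWt i n x) (c : Kv) :
    HasWt i n (c • x) := by
  rw [HasWt] at *
  rw [smul_smul_comm_U, hx, smul_comm]

lemma HasWt.add {i : Fin 2} {n : ℤ} {x y : M} (hx : HasWt i n x) (hy : HasWt i n y) :
    HasWt i n (x + y) := by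
  rw [HasWt] at *
  rw [smul_add, smul_add, hx, hy]

lemma HasWt.E_pow {i : Fin 2} {n : ℤ} {x : M} (hx : HasWt i n x) (j : Fin 2) (r : ℕ) :
    HasWt i (n + r * cartan i j) (QSL3.E j ^ r • x) := by
  induction r with
  | zero => simpa using hx
  | succ r ih =>
    rw [pow_succ', mul_smul]
    convert ih.E j using 1
    push_cast; ring

lemma HasWt.F_pow {i : Fin 2} {n : ℤ} {x : M} (hx : HasWt i n x) (j : Fin 2) (r : ℕ) :
    HasWt i (n - r * cartan i j) (QSL3.F j ^ r • x) := by
  induction r with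
  | zero => simpa using hx
  | succ r ih =>
    rw [pow_succ', mul_smul]
    convert ih.F j using 1
    push_cast; ring

lemma HasWt.dE {i : Fin 2} {n : ℤ} {x : M} (hx : HasWt i n x) (j : Fin 2) (r : ℕ) :
    HasWt i (n + r * cartan i j) (dE j r • x) := by
  rw [QSL3.dE, smul_assoc]
  exact (hx.E_pow j r).smul _

lemma HasWt.dF {i : Fin 2} {n : ℤ} {x : M} (hx : HasWt i n x) (j : Fin 2) (r : ℕ) :
    HasWt i (n - r * cartan i j) (dF j r • x) := by
  rw [QSL3.dF, smul_assoc]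
  exact (hx.F_pow j r).smul _

lemma cartan_self (i : Fin 2) : cartan i i = 2 := by simp [cartan]

lemma cartan_ne {i j : Fin 2} (h : i ≠ j) : cartan i j = -1 := by simp [cartan, h]

lemma E_smul_F_smul {i : Fin 2} {n : ℤ} {x : M} (hx : HasWt i n x) :
    E i • F i • x = F i • E i • x + zint n • x := by
  rw [← mul_smul, E_mul_F_same, add_smul, mul_smul, smul_assoc, sub_smul, hx, Kinv_smul hx,
    ← sub_smul, ← mul_smul _ _ x, ← mul_smul (v - v⁻¹)⁻¹, zint, div_eq_inv_mul]

lemma E_smul_F_pow_succ {i : Fin 2} {n : ℤ} {x : M} (hx : HasWt i n x) (s : ℕ) :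
    E i • F i ^ (s + 1) • x = F i ^ (s + 1) • E i • x +
      (zint (s + 1) * zint (n - s)) • F i ^ s • x := by
  induction s with
  | zero => simpa [zint_one] using E_smul_F_smul hx
  | succ s ih =>
    have hw := hx.F_pow i (s + 1)
    rw [cartan_self] at hw
    have e : zint ((s : ℤ) + 1) * zint (n - s) + zint (n - ((s + 1 : ℕ) : ℤ) * 2) =
        zint (s + 1 + 1) * zint (n - (s + 1)) := by
      have g3 := zint_mul_sub (s + 2) (n - (s + 1)) (s + 1)
      rw [show (s : ℤ) + 2 - (s + 1) = 1 by ring, zint_one, one_mul,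
        show n - ((s : ℤ) + 1) - (s + 1) = n - ((s + 1 : ℕ) : ℤ) * 2 by push_cast; ring,
        show (s : ℤ) + 2 + (n - (s + 1)) - (s + 1) = n - s by ring,
        show (s : ℤ) + 2 = s + 1 + 1 by ring] at g3
      rw [← g3]; ring
    rw [pow_succ' _ (s + 1), mul_smul, E_smul_F_smul hw, ih, smul_add, smul_smul_comm_U,
      ← mul_smul (F i) (F i ^ s), ← pow_succ', add_assoc, ← add_smul, e, ← mul_smul (F i)]
    push_cast
    rfl

lemma E_smul_dF_succ {i : Fin 2} {n : ℤ} {x : M} (hx : HasWt i n x) (s : ℕ) :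
    E i • dF i (s + 1) • x = dF i (s + 1) • E i • x + zint (n - s) • dF i s • x := by
  have h1 := qFact_ne_zero s
  have h2 : zint (s + 1) ≠ 0 := zint_ne_zero (by omega)
  simp only [dF, smul_assoc]
  rw [smul_smul_comm_U, E_smul_F_pow_succ hx, smul_add, smul_smul (qFact _)⁻¹,
    smul_smul (zint _), qFact_succ]
  congr 2
  field_simp

lemma F_smul_E_pow_succ {i : Fin 2} {n : ℤ} {x : M} (hx : HasWt i (-n) x) (hF : F i • x = 0)
    (s : ℕ) : F i • E i ^ (s + 1) • x = (zint (s + 1) * zint (n - s)) • E i ^ s • x := by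
  induction s with
  | zero =>
    have := E_smul_F_smul hx
    rw [hF, smul_zero, zint_neg, neg_smul] at this
    simpa [zint_one] using (add_neg_eq_zero.1 this.symm)
  | succ s ih =>
    have hw := hx.E_pow i (s + 1)
    rw [cartan_self] at hw
    have h := E_smul_F_smul hw
    have g3 := zint_mul_sub (s + 2) (n - (s + 1)) (s + 1)
    rw [show (s : ℤ) + 2 - (s + 1) = 1 by ring, zint_one, one_mul,
        show n - ((s : ℤ) + 1) - (s + 1) = -(-n + ((s + 1 : ℕ) : ℤ) * 2) by push_cast; ring,
        show (s : ℤ) + 2 + (n - (s + 1)) - (s + 1) = n - s by ring,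
        show (s : ℤ) + 2 = s + 1 + 1 by ring, zint_neg] at g3
    rw [ih, smul_smul_comm_U, ← mul_smul (E i), ← pow_succ'] at h
    rw [pow_succ' _ (s + 1), mul_smul, ← sub_eq_iff_eq_add.2 h, ← sub_smul]
    push_cast at g3 ⊢
    rw [← g3]
    congr 1
    ring

/-! ### Divided powers with integer exponents -/

/-- `F_i^{(k)}`, which is `0` for negative `k`. -/
def dFZ (i : Fin 2) : ℤ → U
  | Int.ofNat n => dF i n
  | Int.negSucc _ => 0

/-- `E_i^{(k)}`, which is `0` for negative `k`. -/
def dEZ (i : Fin 2) : ℤ → U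
  | Int.ofNat n => dE i n
  | Int.negSucc _ => 0

@[simp] lemma dFZ_natCast (i : Fin 2) (n : ℕ) : dFZ i n = dF i n := rfl

@[simp] lemma dEZ_natCast (i : Fin 2) (n : ℕ) : dEZ i n = dE i n := rfl

lemma dFZ_neg (i : Fin 2) {k : ℤ} (hk : k < 0) : dFZ i k = 0 := by
  obtain ⟨m, rfl⟩ := Int.eq_negSucc_of_lt_zero hk
  rfl

lemma dEZ_neg (i : Fin 2) {k : ℤ} (hk : k < 0) : dEZ i k = 0 := by
  obtain ⟨m, rfl⟩ := Int.eq_negSucc_of_lt_zero hk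
  rfl

lemma E_mul_dEZ (i : Fin 2) (k : ℤ) : E i * dEZ i k = zint (k + 1) • dEZ i (k + 1) := by
  rcases lt_or_ge k 0 with hk | hk
  · rw [dEZ_neg i hk, mul_zero]
    rcases lt_or_ge (k + 1) 0 with hk' | hk'
    · rw [dEZ_neg i hk', smul_zero]
    · rw [show k + 1 = 0 by omega, zint_zero, zero_smul]
  · lift k to ℕ using hk
    have := E_mul_dE i k
    rw [dEZ_natCast, this]
    congr 1

lemma E_smul_dFZ {i : Fin 2} {n : ℤ} {x : M} (hx : HasWt i n x) (s : ℤ) :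
    E i • dFZ i s • x = dFZ i s • E i • x + zint (n - s + 1) • dFZ i (s - 1) • x := by
  rcases lt_or_ge s 0 with hs | hs
  · rw [dFZ_neg i hs, dFZ_neg i (by omega : s - 1 < 0)]; simp
  · lift s to ℕ using hs
    cases s with
    | zero =>
      have h0 : dFZ i 0 = 1 := dF_zero i
      rw [dFZ_neg i (by simp : ((0 : ℕ) : ℤ) - 1 < 0)]
      simp [h0]
    | succ s =>
      have := E_smul_dF_succ hx s
      rw [show ((s + 1 : ℕ) : ℤ) - 1 = s by push_cast; ring,
        show n - ((s + 1 : ℕ) : ℤ) + 1 = n - s by push_cast; ring]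
      exact this

lemma HasWt.dEZ {i : Fin 2} {n : ℤ} {x : M} (hx : HasWt i n x) (j : Fin 2) (r : ℤ) :
    HasWt i (n + r * cartan i j) (dEZ j r • x) := by
  rcases lt_or_ge r 0 with hr | hr
  · rw [dEZ_neg j hr, zero_smul, HasWt, smul_zero, smul_zero]
  · lift r to ℕ using hr
    exact hx.dE j r

/-- The commutation formula of Kac and Lusztig on a weight vector. -/
lemma dE_smul_dFZ {i : Fin 2} {n : ℤ} {x : M} (hx : HasWt i n x) (r : ℕ) (s : ℤ) :
    dE i r • dFZ i s • x = ∑ t ∈ Finset.range (r + 1),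
      zbin (r - s + n) t • dFZ i (s - t) • dEZ i (r - t) • x := by
  induction r with
  | zero =>
    have : dEZ i 0 = 1 := dE_zero i
    simp [zbin_zero, dE_zero, this]
  | succ r ih =>
    have h2 : zint (r + 1) ≠ 0 := zint_ne_zero (by omega)
    have hs : ∀ t : ℕ, E i • zbin (r - s + n) t • dFZ i (s - t) • dEZ i (r - t) • x =
        (zbin (r - s + n) t * zint (r + 1 - t)) • dFZ i (s - t) • dEZ i (r + 1 - t) • x +
        (zbin (r - s + n) t * zint (n + 2 * r - s - t + 1)) •
          dFZ i (s - (t + 1)) • dEZ i (r - t) • x := by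
      intro t
      have hw := hx.dEZ i (r - t)
      rw [cartan_self] at hw
      rw [smul_smul_comm_U, E_smul_dFZ hw, smul_add, ← mul_smul (E i), E_mul_dEZ, smul_assoc,
        smul_smul_comm_U, smul_smul (zbin _ _), smul_smul (zbin _ _), sub_sub s,
        show n + ((r : ℤ) - t) * 2 - (s - t) + 1 = n + 2 * r - s - t + 1 by ring,
        show (r : ℤ) - t + 1 = r + 1 - t by ring]
    have hE : E i • dE i r • dFZ i s • x = zint (r + 1) • dE i (r + 1) • dFZ i s • x := by
      rw [← mul_smul, E_mul_dE, smul_assoc]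
    -- The induction multiplies by `[r+1]`, since `E_i E_i^{(r)} = [r+1] E_i^{(r+1)}`; after `E_i`
    -- has passed through each summand, the terms with equal `t` are collected and `[r+1]` is
    -- cancelled.
    have key : zint (r + 1) • dE i (r + 1) • dFZ i s • x = zint (r + 1) •
        ∑ t ∈ Finset.range (r + 1 + 1), zbin ((r + 1 : ℕ) - s + n) t •
          dFZ i (s - t) • dEZ i ((r + 1 : ℕ) - t) • x := by
      rw [← hE, ih, Finset.smul_sum, Finset.sum_congr rfl fun t _ => hs t,
        Finset.sum_add_distrib, Finset.smul_sum, Finset.sum_range_succ' _ (r + 1),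
        Finset.sum_range_succ' _ r, add_right_comm]
      have hlast : (0 : M) = (zbin (r - s + n) (r + 1) * zint (r + 1 - (r + 1 : ℕ))) •
          dFZ i (s - (r + 1 : ℕ)) • dEZ i (r + 1 - (r + 1 : ℕ)) • x := by
        push_cast; rw [sub_self, zint_zero, mul_zero, zero_smul]
      rw [← add_zero (∑ t ∈ Finset.range r, _), hlast,
        ← Finset.sum_range_succ (fun t : ℕ => (zbin (r - s + n) (t + 1) *
          zint (r + 1 - (t + 1 : ℕ))) • dFZ i (s - (t + 1 : ℕ)) •
            dEZ i (r + 1 - (t + 1 : ℕ)) • x), ← Finset.sum_add_distrib]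
      congr 1
      · refine Finset.sum_congr rfl fun t _ => ?_
        push_cast
        rw [show (r : ℤ) + 1 - (t + 1) = r - t by ring, ← add_smul, smul_smul (zint _)]
        congr 1
        have h3 : zint (t + 1) ≠ 0 := zint_ne_zero (by omega)
        refine mul_right_cancel₀ h3 ?_
        have g1 := zbin_succ (r - s + n) t
        have g2 := zbin_succ_succ (r - s + n) t
        have g3 := zint_mul_sub (r + 1) (r - s + n + 1) (t + 1)
        rw [show (r : ℤ) + 1 - (t + 1) = r - t by ring,
          show (r : ℤ) - s + n + 1 - (t + 1) = r - s + n - t by ring,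
          show (r : ℤ) + 1 + (r - s + n + 1) - (t + 1) = n + 2 * r - s - t + 1 by ring] at g3
        rw [show (r : ℤ) + 1 - s + n = r - s + n + 1 by ring]
        linear_combination zint (r - t) * g1 + zbin (r - s + n) t * g3 - zint (r + 1) * g2
      · simp [zbin_zero]
    have := congrArg (fun y => (zint (r + 1))⁻¹ • y) key
    simpa only [smul_smul, inv_mul_cancel₀ h2, one_smul] using this

/-- The commutation formula on a highest vector. -/
lemma dE_smul_dFZ_of_E_eq_zero {i : Fin 2} {n : ℤ} {x : M} (hx : HasWt i n x)
    (hE : E i • x = 0) (r : ℕ) (s : ℤ) :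
    dE i r • dFZ i s • x = zbin (r - s + n) r • dFZ i (s - r) • x := by
  rw [dE_smul_dFZ hx, Finset.sum_range_succ, Finset.sum_eq_zero, zero_add, sub_self]
  · have : dEZ i 0 = 1 := dE_zero i
    rw [this, one_smul]
  · intro t ht
    rw [Finset.mem_range] at ht
    obtain ⟨m, rfl⟩ : ∃ m, r = t + m + 1 := ⟨r - t - 1, by omega⟩
    have e : dEZ i (((t + m + 1 : ℕ) : ℤ) - t) = dE i (m + 1) := by
      rw [← dEZ_natCast]; congr 1; push_cast; ring
    rw [e, dE, smul_assoc, pow_succ, mul_smul, hE]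
    simp

lemma dE_smul_dF_of_E_eq_zero {i : Fin 2} {n : ℤ} {x : M} (hx : HasWt i n x)
    (hE : E i • x = 0) (r s : ℕ) :
    dE i r • dF i (s + r) • x = zbin (n - s) r • dF i s • x := by
  have := dE_smul_dFZ_of_E_eq_zero hx hE r (s + r : ℕ)
  rw [dFZ_natCast] at this
  rw [this]
  push_cast
  rw [show (r : ℤ) - (s + r) + n = n - s by ring, add_sub_cancel_right, dFZ_natCast]

lemma dE_smul_eq_zero {i : Fin 2} {x : M} (hE : E i • x = 0) (r : ℕ) : dE i (r + 1) • x = 0 := by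
  rw [dE, smul_assoc, pow_succ, mul_smul, hE]; simp

end Modules

/-! ### A module with a highest vector

The operators below are those of the Verma module in its basis `F_2^a (F_1F_2 - vF_2F_1)^b F_1^c`,
extended to `ℤ³`; they act on the functions on `ℤ³` (infinite linear combinations). -/

namespace Model

/-- The underlying vector space. -/
abbrev Space : Type := ℤ → ℤ → ℤ → Kv

/-- The action of `F_1` and `F_2`. -/
def opF (i : Fin 2) : Module.End Kv Space where
  toFun f a b c := if i = 0 then v ^ (a - b) * f a b (c - 1) + zint (a + 1) * f (a + 1) (b - 1) c
    else f (a - 1) b c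
  map_add' f g := by ext a b c; split_ifs <;> simp; ring
  map_smul' r f := by ext a b c; split_ifs <;> simp; ring

/-- The coefficient of `f (a - 1) (b + 1) c` in `E_1 f`. -/
def cA (m : Fin 2 → ℤ) (b c : ℤ) : Kv := zint (b + 1) * v ^ (2 * c - m 0)

/-- The coefficient of `f a b (c + 1)` in `E_1 f`. -/
def cB (m : Fin 2 → ℤ) (c : ℤ) : Kv := zint (c + 1) * zint (m 0 - c)

/-- The coefficient of `f (a + 1) b c` in `E_2 f`. -/
def cC (m : Fin 2 → ℤ) (a b c : ℤ) : Kv := zint (a + 1) * zint (m 1 - b + c - a)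

/-- The coefficient of `-f a (b + 1) (c - 1)` in `E_2 f`. -/
def cD (m : Fin 2 → ℤ) (b c : ℤ) : Kv := v ^ (m 1 - b + c) * zint (b + 1)

/-- The action of `E_1` and `E_2`. -/
def opE (m : Fin 2 → ℤ) (i : Fin 2) : Module.End Kv Space where
  toFun f a b c := if i = 0 then cA m b c * f (a - 1) (b + 1) c + cB m c * f a b (c + 1)
    else cC m a b c * f (a + 1) b c - cD m b c * f a (b + 1) (c - 1)
  map_add' f g := by ext a b c; split_ifs <;> simp <;> ring
  map_smul' r f := by ext a b c; split_ifs <;> simp <;> ring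

/-- The weight of the basis vector `(a, b, c)`. -/
def wt (m : Fin 2 → ℤ) (i : Fin 2) (a b c : ℤ) : ℤ :=
  if i = 0 then m 0 + a - b - 2 * c else m 1 - 2 * a - b + c

/-- The action of `K_1^s` and `K_2^s`. -/
def opK (m : Fin 2 → ℤ) (s : ℤ) (i : Fin 2) : Module.End Kv Space where
  toFun f a b c := v ^ (s * wt m i a b c) * f a b c
  map_add' f g := by ext a b c; simp; ring
  map_smul' r f := by ext a b c; simp; ring

/-- The action of the generators. -/
def op (m : Fin 2 → ℤ) : Gen → Module.End Kv Space
  | .E i => opE m i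
  | .F i => opF i
  | .K i => opK m 1 i
  | .Kinv i => opK m (-1) i

lemma opK_mul_opK_neg (m : Fin 2 → ℤ) (s : ℤ) (i : Fin 2) : opK m s i * opK m (-s) i = 1 := by
  ext f a b c
  simp only [opK, Module.End.mul_apply, LinearMap.coe_mk, AddHom.coe_mk, Module.End.one_apply]
  rw [← mul_assoc, ← zpow_add₀ v_ne_zero]
  simp

lemma opK_mul_opE (m : Fin 2 → ℤ) (i j : Fin 2) :
    opK m 1 i * opE m j = v ^ cartan i j • (opE m j * opK m 1 i) := by
  have h0 := v_ne_zero
  ext f a b c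
  fin_cases i <;> fin_cases j <;>
  · simp [opK, opE, wt, cartan, zpow_add₀ h0, zpow_sub₀ h0, mul_add, mul_sub]
    field_simp

lemma opK_mul_opF (m : Fin 2 → ℤ) (i j : Fin 2) :
    opK m 1 i * opF j = v ^ (-cartan i j) • (opF j * opK m 1 i) := by
  have h0 := v_ne_zero
  ext f a b c
  fin_cases i <;> fin_cases j <;>
  · simp [opK, opF, wt, cartan, zpow_add₀ h0, zpow_sub₀ h0, mul_add, mul_sub]
    field_simp

lemma opE_mul_opF_same (m : Fin 2 → ℤ) (i : Fin 2) :
    opE m i * opF i - opF i * opE m i = (v - v⁻¹)⁻¹ • (opK m 1 i - opK m (-1) i) := by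
  have h0 := v_ne_zero
  have h1 := v_sq_sub_one_ne_zero
  ext f a b c
  fin_cases i <;>
  · simp [opK, opE, opF, cA, cB, cC, cD, wt, zint, zpow_add₀ h0, zpow_sub₀ h0, mul_add, mul_sub, two_mul]
    field_simp
    ring

lemma opE_mul_opF_diff (m : Fin 2 → ℤ) {i j : Fin 2} (h : i ≠ j) :
    opE m i * opF j = opF j * opE m i := by
  have h0 := v_ne_zero
  have h1 := v_sq_sub_one_ne_zero
  ext f a b c
  fin_cases i <;> fin_cases j
  · simp at h
  · simp [opE, opF]
  · simp [opE, opF, cC, cD, zint, zpow_add₀ h0, zpow_sub₀ h0, mul_add, mul_sub]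
    field_simp
    ring
  · simp at h

lemma opF_serre {i j : Fin 2} (h : i ≠ j) :
    opF i * opF i * opF j + opF j * opF i * opF i = (v + v⁻¹) • (opF i * opF j * opF i) := by
  have h0 := v_ne_zero
  have h1 := v_sq_sub_one_ne_zero
  ext f a b c
  fin_cases i <;> fin_cases j
  · simp at h
  · simp [opF, zint, zpow_add₀ h0, zpow_sub₀ h0, mul_add]
    field_simp
    ring
  · simp [opF, zint, zpow_add₀ h0, zpow_sub₀ h0, mul_add]
    field_simp
    ring
  · simp at h

/-- The eight `coeff_serre` identities compare, for each shift of the argument of `f`, the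
coefficients in the two Serre relations for `E_1, E_2`. With indices in all of `ℤ` there are no
boundary cases, so each is an identity of rational functions in `v` and the powers `v^a, v^b, v^c,
v^{m_0}, v^{m_1}`. -/
lemma coeff_serre₁ (m : Fin 2 → ℤ) (a b c : ℤ) :
    cA m b c * cA m (b + 1) c * cC m (a - 1 - 1) (b + 1 + 1) c
        - cA m b c * cB m c * cD m (b + 1) (c + 1) - cB m c * cA m b (c + 1) * cD m (b + 1) (c + 1)
        + cC m a b c * cA m b c * cA m (b + 1) c - cD m b c * cA m (b + 1) (c - 1) * cB m (c - 1)
        - cD m b c * cB m (c - 1) * cA m (b + 1) c =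
      (v + v⁻¹) * (cA m b c * cC m (a - 1) (b + 1) c * cA m (b + 1) c
        - cA m b c * cD m (b + 1) c * cB m (c - 1) - cB m c * cD m b (c + 1) * cA m (b + 1) c) := by
  have h0 := v_ne_zero
  have h1 := v_sq_sub_one_ne_zero
  have ha := v_zpow_ne_zero a
  have hb := v_zpow_ne_zero b
  have hc := v_zpow_ne_zero c
  have hm0 := v_zpow_ne_zero (m 0)
  have hm1 := v_zpow_ne_zero (m 1)
  simp only [cA, cB, cC, cD, zint, neg_add, neg_sub, zpow_add₀ h0, zpow_sub₀ h0, zpow_neg, mul_add,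
    mul_sub, two_mul, zpow_one]
  generalize v ^ a = x at *
  generalize v ^ b = y at *
  generalize v ^ c = z at *
  generalize v ^ m 0 = p at *
  generalize v ^ m 1 = q at *
  field_simp
  ring

lemma coeff_serre₂ (m : Fin 2 → ℤ) (b c : ℤ) :
    cA m b c * cA m (b + 1) c * cD m (b + 1 + 1) c
        + cD m b c * cA m (b + 1) (c - 1) * cA m (b + 1 + 1) (c - 1) =
      (v + v⁻¹) * (cA m b c * cD m (b + 1) c * cA m (b + 1 + 1) (c - 1)) := by
  have h0 := v_ne_zero
  have h1 := v_sq_sub_one_ne_zero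
  have hb := v_zpow_ne_zero b
  have hc := v_zpow_ne_zero c
  have hm0 := v_zpow_ne_zero (m 0)
  have hm1 := v_zpow_ne_zero (m 1)
  simp only [cA, cB, cC, cD, zint, neg_add, neg_sub, zpow_add₀ h0, zpow_sub₀ h0, zpow_neg, mul_add,
    mul_sub, two_mul, zpow_one]
  generalize v ^ b = y at *
  generalize v ^ c = z at *
  generalize v ^ m 0 = p at *
  generalize v ^ m 1 = q at *
  field_simp

lemma coeff_serre₃ (m : Fin 2 → ℤ) (a b c : ℤ) :
    cA m b c * cB m c * cC m (a - 1) (b + 1) (c + 1)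
        + cB m c * cA m b (c + 1) * cC m (a - 1) (b + 1) (c + 1)
        - cB m c * cB m (c + 1) * cD m b (c + 1 + 1) + cC m a b c * cA m b c * cB m c
        + cC m a b c * cB m c * cA m b (c + 1) - cD m b c * cB m (c - 1) * cB m c =
      (v + v⁻¹) * (cA m b c * cC m (a - 1) (b + 1) c * cB m c
        + cB m c * cC m a b (c + 1) * cA m b (c + 1) - cB m c * cD m b (c + 1) * cB m c) := by
  have h0 := v_ne_zero
  have h1 := v_sq_sub_one_ne_zero
  have ha := v_zpow_ne_zero a
  have hb := v_zpow_ne_zero b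
  have hc := v_zpow_ne_zero c
  have hm0 := v_zpow_ne_zero (m 0)
  have hm1 := v_zpow_ne_zero (m 1)
  simp only [cA, cB, cC, cD, zint, neg_add, neg_sub, zpow_add₀ h0, zpow_sub₀ h0, zpow_neg, mul_add,
    mul_sub, two_mul, zpow_one]
  generalize v ^ a = x at *
  generalize v ^ b = y at *
  generalize v ^ c = z at *
  generalize v ^ m 0 = p at *
  generalize v ^ m 1 = q at *
  field_simp
  ring

lemma coeff_serre₄ (m : Fin 2 → ℤ) (a b c : ℤ) :
    cB m c * cB m (c + 1) * cC m a b (c + 1 + 1) + cC m a b c * cB m c * cB m (c + 1) =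
      (v + v⁻¹) * (cB m c * cC m a b (c + 1) * cB m (c + 1)) := by
  have h0 := v_ne_zero
  have h1 := v_sq_sub_one_ne_zero
  have ha := v_zpow_ne_zero a
  have hb := v_zpow_ne_zero b
  have hc := v_zpow_ne_zero c
  have hm0 := v_zpow_ne_zero (m 0)
  have hm1 := v_zpow_ne_zero (m 1)
  simp only [cA, cB, cC, cD, zint, neg_add, neg_sub, zpow_add₀ h0, zpow_sub₀ h0, zpow_neg, mul_add,
    mul_sub, two_mul, zpow_one]
  generalize v ^ a = x at *
  generalize v ^ b = y at *
  generalize v ^ c = z at *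
  generalize v ^ m 0 = p at *
  generalize v ^ m 1 = q at *
  field_simp
  ring

lemma coeff_serre₅ (m : Fin 2 → ℤ) (a b c : ℤ) :
    cC m a b c * cC m (a + 1) b c * cA m b c - cC m a b c * cD m b c * cB m (c - 1)
        - cD m b c * cC m a (b + 1) (c - 1) * cB m (c - 1)
        + cA m b c * cC m (a - 1) (b + 1) c * cC m a (b + 1) c
        - cB m c * cC m a b (c + 1) * cD m b (c + 1) - cB m c * cD m b (c + 1) * cC m a (b + 1) c =
      (v + v⁻¹) * (cC m a b c * cA m b c * cC m a (b + 1) c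
        - cC m a b c * cB m c * cD m b (c + 1) - cD m b c * cB m (c - 1) * cC m a (b + 1) c) := by
  have h0 := v_ne_zero
  have h1 := v_sq_sub_one_ne_zero
  have ha := v_zpow_ne_zero a
  have hb := v_zpow_ne_zero b
  have hc := v_zpow_ne_zero c
  have hm0 := v_zpow_ne_zero (m 0)
  have hm1 := v_zpow_ne_zero (m 1)
  simp only [cA, cB, cC, cD, zint, neg_add, neg_sub, zpow_add₀ h0, zpow_sub₀ h0, zpow_neg, mul_add,
    mul_sub, two_mul, zpow_one]
  generalize v ^ a = x at *
  generalize v ^ b = y at *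
  generalize v ^ c = z at *
  generalize v ^ m 0 = p at *
  generalize v ^ m 1 = q at *
  field_simp
  ring

lemma coeff_serre₆ (m : Fin 2 → ℤ) (a b c : ℤ) :
    -cC m a b c * cD m b c * cA m (b + 1) (c - 1)
        - cD m b c * cC m a (b + 1) (c - 1) * cA m (b + 1) (c - 1)
        + cD m b c * cD m (b + 1) (c - 1) * cB m (c - 1 - 1)
        - cA m b c * cC m (a - 1) (b + 1) c * cD m (b + 1) c
        - cA m b c * cD m (b + 1) c * cC m (a - 1) (b + 1 + 1) (c - 1)
        + cB m c * cD m b (c + 1) * cD m (b + 1) c =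
      (v + v⁻¹) * (-cC m a b c * cA m b c * cD m (b + 1) c
        - cD m b c * cA m (b + 1) (c - 1) * cC m (a - 1) (b + 1 + 1) (c - 1)
        + cD m b c * cB m (c - 1) * cD m (b + 1) c) := by
  have h0 := v_ne_zero
  have h1 := v_sq_sub_one_ne_zero
  have ha := v_zpow_ne_zero a
  have hb := v_zpow_ne_zero b
  have hc := v_zpow_ne_zero c
  have hm0 := v_zpow_ne_zero (m 0)
  have hm1 := v_zpow_ne_zero (m 1)
  simp only [cA, cB, cC, cD, zint, neg_add, neg_sub, zpow_add₀ h0, zpow_sub₀ h0, zpow_neg, mul_add,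
    mul_sub, two_mul, zpow_one]
  generalize v ^ a = x at *
  generalize v ^ b = y at *
  generalize v ^ c = z at *
  generalize v ^ m 0 = p at *
  generalize v ^ m 1 = q at *
  field_simp
  ring

lemma coeff_serre₇ (m : Fin 2 → ℤ) (a b c : ℤ) :
    cC m a b c * cC m (a + 1) b c * cB m c + cB m c * cC m a b (c + 1) * cC m (a + 1) b (c + 1) =
      (v + v⁻¹) * (cC m a b c * cB m c * cC m (a + 1) b (c + 1)) := by
  have h0 := v_ne_zero
  have h1 := v_sq_sub_one_ne_zero
  have ha := v_zpow_ne_zero a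
  have hb := v_zpow_ne_zero b
  have hc := v_zpow_ne_zero c
  have hm0 := v_zpow_ne_zero (m 0)
  have hm1 := v_zpow_ne_zero (m 1)
  simp only [cA, cB, cC, cD, zint, neg_add, neg_sub, zpow_add₀ h0, zpow_sub₀ h0, zpow_neg, mul_add,
    mul_sub, two_mul, zpow_one]
  generalize v ^ a = x at *
  generalize v ^ b = y at *
  generalize v ^ c = z at *
  generalize v ^ m 0 = p at *
  generalize v ^ m 1 = q at *
  field_simp
  ring

lemma coeff_serre₈ (m : Fin 2 → ℤ) (b c : ℤ) :
    cD m b c * cD m (b + 1) (c - 1) * cA m (b + 1 + 1) (c - 1 - 1)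
        + cA m b c * cD m (b + 1) c * cD m (b + 1 + 1) (c - 1) =
      (v + v⁻¹) * (cD m b c * cA m (b + 1) (c - 1) * cD m (b + 1 + 1) (c - 1)) := by
  have h0 := v_ne_zero
  have h1 := v_sq_sub_one_ne_zero
  have hb := v_zpow_ne_zero b
  have hc := v_zpow_ne_zero c
  have hm0 := v_zpow_ne_zero (m 0)
  have hm1 := v_zpow_ne_zero (m 1)
  simp only [cA, cB, cC, cD, zint, neg_add, neg_sub, zpow_add₀ h0, zpow_sub₀ h0, zpow_neg, mul_add,
    mul_sub, two_mul, zpow_one]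
  generalize v ^ b = y at *
  generalize v ^ c = z at *
  generalize v ^ m 0 = p at *
  generalize v ^ m 1 = q at *
  field_simp
  ring

lemma opE_serre (m : Fin 2 → ℤ) {i j : Fin 2} (h : i ≠ j) :
    opE m i * opE m i * opE m j + opE m j * opE m i * opE m i =
      (v + v⁻¹) • (opE m i * opE m j * opE m i) := by
  ext f a b c
  fin_cases i <;> fin_cases j
  · simp at h
  · simp [opE]
    linear_combination f (a - 1) (b + 1 + 1) c * coeff_serre₁ m a b c -
      f (a - 1 - 1) (b + 1 + 1 + 1) (c - 1) * coeff_serre₂ m b c +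
      f a (b + 1) (c + 1) * coeff_serre₃ m a b c + f (a + 1) b (c + 1 + 1) * coeff_serre₄ m a b c
  · simp [opE]
    linear_combination f (a + 1) (b + 1) c * coeff_serre₅ m a b c +
      f a (b + 1 + 1) (c - 1) * coeff_serre₆ m a b c +
      f (a + 1 + 1) b (c + 1) * coeff_serre₇ m a b c +
      f (a - 1) (b + 1 + 1 + 1) (c - 1 - 1) * coeff_serre₈ m b c
  · simp at h

/-- The representation. -/
def rep (m : Fin 2 → ℤ) : U →ₐ[Kv] Module.End Kv Space :=
  RingQuot.liftAlgHom Kv ⟨FreeAlgebra.lift Kv (op m), by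
    intro x y hxy
    induction hxy with
    | K_Kinv i => simpa [op] using opK_mul_opK_neg m 1 i
    | Kinv_K i => simpa [op] using opK_mul_opK_neg m (-1) i
    | K_K i j =>
      simp only [map_mul, FreeAlgebra.lift_ι_apply, op]
      ext f a b c
      simp [opK]; ring
    | K_E i j => simpa [op] using opK_mul_opE m i j
    | K_F i j => simpa [op] using opK_mul_opF m i j
    | E_F_same i => simpa [op] using opE_mul_opF_same m i
    | E_F_diff i j h => simpa [op] using opE_mul_opF_diff m h
    | serre_E i j h => simpa [op] using opE_serre m h
    | serre_F i j h => simpa [op] using opF_serre h⟩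

lemma rep_toU (m : Fin 2 → ℤ) (g : Gen) : rep m (toU (gen g)) = op m g := by
  rw [rep, toU]
  erw [RingQuot.liftAlgHom_mkAlgHom_apply]
  simp

/-- The indicator function of the origin. -/
def top : Space := fun a b c => if a = 0 ∧ b = 0 ∧ c = 0 then 1 else 0

lemma top_ne_zero : top ≠ 0 := by
  intro h
  have := congrFun (congrFun (congrFun h 0) 0) 0
  simp [top] at this

/-- Wherever `E_i` reads the value at the origin, its coefficient contains the factor `[0]`. Thus
the origin behaves as a highest vector although the indices extend to negative integers. -/
lemma rep_E_top (m : Fin 2 → ℤ) (i : Fin 2) : rep m (E i) top = 0 := by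
  have h : ∀ n : ℤ, n + 1 = 0 ∨ n + 1 ≠ 0 := fun n => em _
  rw [E, rep_toU]
  ext a b c
  simp only [op, opE, cA, cB, cC, cD, top, LinearMap.coe_mk, AddHom.coe_mk]
  rcases h a with ha | ha <;> rcases h b with hb | hb <;> rcases h c with hc | hc <;>
    fin_cases i <;> simp [ha, hb, hc, zint_zero]

lemma rep_K_top (m : Fin 2 → ℤ) (i : Fin 2) : rep m (K i) top = v ^ m i • top := by
  rw [K, rep_toU]
  ext a b c
  simp only [op, opK, top, LinearMap.coe_mk, AddHom.coe_mk, Pi.smul_apply, smul_eq_mul]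
  by_cases h : a = 0 ∧ b = 0 ∧ c = 0
  · obtain ⟨rfl, rfl, rfl⟩ := h
    fin_cases i <;> simp [wt]
  · simp [h]

end Model

/-! ### Weight spaces and monomials -/

section Modules

variable {M : Type*} [AddCommGroup M] [Module Kv M] [Module U M] [IsScalarTower Kv U M]

variable (M) in
/-- The weight space of weight `f`. -/
def wsp (f : Fin 2 → ℤ) : Submodule Kv M where
  carrier := {x | ∀ i, HasWt i (f i) x}
  add_mem' hx hy i := (hx i).add (hy i)
  zero_mem' i := by simp [HasWt]
  smul_mem' c _ hx i := (hx i).smul c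

lemma mem_wsp {f : Fin 2 → ℤ} {x : M} : x ∈ wsp M f ↔ ∀ i, HasWt i (f i) x := Iff.rfl

lemma commute_K (i j : Fin 2) :
    Commute (Algebra.lsmul Kv Kv M (K i)) (Algebra.lsmul Kv Kv M (K j)) := by
  have : Commute (K i) (K j) := K_mul_K i j
  exact this.map (Algebra.lsmul Kv Kv M)

variable (M) in
-- The `K_i` commute, and distinct integral weights give distinct eigenvalue families because `n ↦
-- v^n` is injective.
lemma iSupIndep_wsp : iSupIndep (wsp M) := by
  have hinj : Function.Injective (fun (f : Fin 2 → ℤ) (i : Fin 2) => v ^ f i) :=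
    fun f g hfg => funext fun i => v_zpow_injective (congrFun hfg i)
  have h := (Module.End.independent_iInf_maxGenEigenspace_of_forall_mapsTo
    (fun i : Fin 2 => (Algebra.lsmul Kv Kv M (K i) : Module.End Kv M))
    (fun i j φ => Module.End.mapsTo_maxGenEigenspace_of_comm (commute_K j i) φ)).comp hinj
  refine h.mono fun f x hx => ?_
  simp only [Function.comp_apply, Submodule.mem_iInf]
  intro i
  have hi : x ∈ Module.End.eigenspace (Algebra.lsmul Kv Kv M (K i)) (v ^ f i) :=
    Module.End.mem_eigenspace_iff.2 (hx i)
  exact (Module.End.genEigenspace _ _).monotone le_top hi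

/-- The weight `f - ∑_j d_j α_j`. -/
def lower (f : Fin 2 → ℤ) (d : Fin 2 → ℕ) : Fin 2 → ℤ := fun i => f i - ∑ j, cartan i j * d j

lemma lower_zero (f : Fin 2 → ℤ) : lower f 0 = f := by
  funext i; simp [lower]

lemma lower_injective (f : Fin 2 → ℤ) : Function.Injective (lower f) := by
  intro d e h
  have h0 := congrFun h 0
  have h1 := congrFun h 1
  simp [lower, cartan] at h0 h1
  funext i
  fin_cases i <;> simp <;> omega

lemma lower_add_single (f : Fin 2 → ℤ) (d : Fin 2 → ℕ) (j : Fin 2) (r : ℕ) (i : Fin 2) :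
    lower f (d + Pi.single j r) i = lower f d i - r * cartan i j := by
  simp only [lower, Pi.add_apply, Nat.cast_add, mul_add, Finset.sum_add_distrib]
  have : ∑ k, cartan i k * ((Pi.single j r : Fin 2 → ℕ) k : ℤ) = r * cartan i j := by
    rw [Finset.sum_eq_single j]
    · simp [mul_comm]
    · intro k _ hk; simp [hk]
    · simp
  rw [this]; ring

/-! ### Monomials in divided powers and stability under `U_𝒜` -/

/-- `u` is a product of divided powers of the `F_i` of total degree `d`. -/
inductive FMon : (Fin 2 → ℕ) → U → Prop
  | one : FMon 0 1
  | step (i : Fin 2) (r : ℕ) {d : Fin 2 → ℕ} {u : U} :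
      FMon d u → FMon (d + Pi.single i r) (dF i r * u)

/-- `x` is a highest vector of weight `f`. -/
structure IsHighest (f : Fin 2 → ℤ) (x : M) : Prop where
  E_smul (i : Fin 2) : E i • x = 0
  mem_wsp : x ∈ wsp M f

lemma FMon.smul_mem_wsp {d : Fin 2 → ℕ} {u : U} (hu : FMon d u) {f : Fin 2 → ℤ} {x : M}
    (hx : x ∈ wsp M f) : u • x ∈ wsp M (lower f d) := by
  induction hu with
  | one => rwa [lower_zero, one_smul]
  | step i r hu ih =>
    intro j
    rw [mul_smul, lower_add_single]
    exact (ih j).dF i r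

/-- The span of the monomials applied to `x`. -/
def monSpan (R : Type*) [CommRing R] [Module R M] (x : M) : Submodule R M :=
  Submodule.span R {y | ∃ d u, FMon d u ∧ y = u • x}

lemma FMon.mem_monSpan {R : Type*} [CommRing R] [Module R M] {d : Fin 2 → ℕ} {u : U}
    (hu : FMon d u) (x : M) : u • x ∈ monSpan R x :=
  Submodule.subset_span ⟨d, u, hu, rfl⟩

lemma self_mem_monSpan (R : Type*) [CommRing R] [Module R M] (x : M) : x ∈ monSpan R x := by
  simpa using FMon.one.mem_monSpan (R := R) x

/-- The scalars `R` are general so that the same arguments serve `𝒜` and `ℚ(v)`. -/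
lemma smul_mem_span_of_forall {R : Type*} [CommRing R] [Module R M] [SMul R Kv]
    [IsScalarTower R Kv M] {u : U} {s : Set M} {N : Submodule R M}
    (h : ∀ y ∈ s, u • y ∈ N) {y : M} (hy : y ∈ Submodule.span R s) : u • y ∈ N := by
  induction hy using Submodule.span_induction with
  | mem y hy => exact h y hy
  | zero => simp
  | add y z _ _ hy hz => rw [smul_add]; exact add_mem hy hz
  | smul c y _ hy =>
    have e : c • y = (c • (1 : Kv)) • y := by rw [smul_assoc, one_smul]
    rw [e, smul_smul_comm_U, smul_assoc, one_smul]
    exact N.smul_mem c hy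

lemma dF_smul_mem_monSpan {R : Type*} [CommRing R] [Module R M] [SMul R Kv]
    [IsScalarTower R Kv M] {x y : M} (hy : y ∈ monSpan R x) (i : Fin 2) (r : ℕ) :
    dF i r • y ∈ monSpan R x := by
  refine smul_mem_span_of_forall ?_ hy
  rintro _ ⟨d, u, hu, rfl⟩
  rw [← mul_smul]
  exact (hu.step i r).mem_monSpan x

lemma dFZ_smul_mem_monSpan {R : Type*} [CommRing R] [Module R M] [SMul R Kv]
    [IsScalarTower R Kv M] {x y : M} (hy : y ∈ monSpan R x) (i : Fin 2) (r : ℤ) :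
    dFZ i r • y ∈ monSpan R x := by
  rcases lt_or_ge r 0 with hr | hr
  · rw [dFZ_neg i hr, zero_smul]; exact zero_mem _
  · lift r to ℕ using hr
    exact dF_smul_mem_monSpan hy i r

lemma A_smul_mem {N : Submodule A M} {c : Kv} (hc : c ∈ A) {y : M} (hy : y ∈ N) : c • y ∈ N :=
  N.smul_mem ⟨c, hc⟩ hy

/-- `E_i^{(r)}` commutes with divided powers of the other `F_j`; past `F_i^{(s)}` the Kac–Lusztig
formula produces Gaussian binomials, which lie in `𝒜`, and smaller divided powers of `E_i` acting on
a shorter monomial. -/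
lemma FMon.dE_smul_mem {d : Fin 2 → ℕ} {u : U} (hu : FMon d u) {f : Fin 2 → ℤ} {x : M}
    (hx : IsHighest f x) (i : Fin 2) (r : ℕ) : dE i r • u • x ∈ monSpan A x := by
  induction hu generalizing i r with
  | one =>
    cases r with
    | zero => rw [dE_zero, one_smul, one_smul]; exact self_mem_monSpan _ x
    | succ r => rw [one_smul, dE_smul_eq_zero (hx.E_smul i)]; exact zero_mem _
  | step j s hu ih =>
    rename_i d u
    by_cases hij : i = j
    · subst hij
      have hw := hu.smul_mem_wsp hx.mem_wsp i
      rw [mul_smul, ← dFZ_natCast, dE_smul_dFZ hw]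
      refine sum_mem fun t ht => A_smul_mem (zbin_mem_A _ _) (dFZ_smul_mem_monSpan ?_ _ _)
      rw [Finset.mem_range] at ht
      have : (r : ℤ) - t = (r - t : ℕ) := by omega
      rw [this]
      exact ih i (r - t)
    · rw [← mul_smul, ← mul_assoc, dE_mul_dF_diff hij, mul_assoc, mul_smul, mul_smul]
      exact dF_smul_mem_monSpan (ih i r) j s

lemma UA_smul_mem_monSpan {f : Fin 2 → ℤ} {x : M} (hx : IsHighest f x) {a : U} (ha : a ∈ UA)
    {y : M} (hy : y ∈ monSpan A x) : a • y ∈ monSpan A x := by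
  induction ha using Algebra.adjoin_induction generalizing y with
  | mem a ha =>
    refine smul_mem_span_of_forall ?_ hy
    rintro _ ⟨d, u, hu, rfl⟩
    rcases ha with (⟨i, r, rfl⟩ | ⟨i, r, rfl⟩) | ⟨i, rfl | rfl⟩
    · exact hu.dE_smul_mem hx i r
    · exact dF_smul_mem_monSpan (hu.mem_monSpan x) i r
    · rw [hu.smul_mem_wsp hx.mem_wsp i]
      exact A_smul_mem (v_zpow_mem_A _) (hu.mem_monSpan x)
    · rw [Kinv_smul (hu.smul_mem_wsp hx.mem_wsp i)]
      exact A_smul_mem (v_zpow_mem_A _) (hu.mem_monSpan x)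
  | algebraMap r =>
    rw [algebraMap_smul]
    exact Submodule.smul_mem _ r hy
  | add a b _ _ ha hb => rw [add_smul]; exact add_mem (ha hy) (hb hy)
  | mul a b _ _ ha hb => rw [mul_smul]; exact ha (hb hy)

lemma monSpan_A_le (x : M) : monSpan A x ≤ (monSpan Kv x).restrictScalars A :=
  Submodule.span_le_restrictScalars _ _ _

/-- The generators of `U` belong to `U_𝒜`, so stability over `𝒜` suffices. -/
lemma U_smul_mem_monSpan {f : Fin 2 → ℤ} {x : M} (hx : IsHighest f x) (a : U)
    {y : M} (hy : y ∈ monSpan Kv x) : a • y ∈ monSpan Kv x := by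
  have key : ∀ b ∈ UA, ∀ y ∈ monSpan Kv x, b • y ∈ monSpan Kv x := by
    intro b hb y hy
    refine smul_mem_span_of_forall ?_ hy
    rintro _ ⟨d, u, hu, rfl⟩
    exact monSpan_A_le x (UA_smul_mem_monSpan hx hb (hu.mem_monSpan x))
  obtain ⟨a, rfl⟩ : ∃ a', toU a' = a := RingQuot.mkAlgHom_surjective Kv Rel a
  induction a using FreeAlgebra.induction generalizing y with
  | grade0 r => rw [AlgHom.commutes, algebraMap_smul]; exact Submodule.smul_mem _ r hy
  | grade1 g =>
    refine key _ ?_ y hy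
    cases g with
    | E i => exact Algebra.subset_adjoin (Or.inl (Or.inl ⟨i, 1, (dE_one i).symm⟩))
    | F i => exact Algebra.subset_adjoin (Or.inl (Or.inr ⟨i, 1, (dF_one i).symm⟩))
    | K i => exact Algebra.subset_adjoin (Or.inr ⟨i, Or.inl rfl⟩)
    | Kinv i => exact Algebra.subset_adjoin (Or.inr ⟨i, Or.inr rfl⟩)
  | mul a b ha hb => rw [map_mul, mul_smul]; exact ha (hb hy)
  | add a b ha hb => rw [map_add, add_smul]; exact add_mem (ha hy) (hb hy)

/-- The sum of the weight spaces of weight different from `f`. -/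
def otherWt (M : Type*) [AddCommGroup M] [Module Kv M] [Module U M] [IsScalarTower Kv U M]
    (f : Fin 2 → ℤ) : Submodule Kv M := ⨆ g, ⨆ _ : g ≠ f, wsp M g

lemma mem_otherWt {f g : Fin 2 → ℤ} (h : g ≠ f) {x : M} (hx : x ∈ wsp M g) :
    x ∈ otherWt M f :=
  Submodule.mem_iSup_of_mem g (Submodule.mem_iSup_of_mem h hx)

lemma eq_zero_of_mem_otherWt {f : Fin 2 → ℤ} {x : M} (hx : x ∈ wsp M f)
    (hx' : x ∈ otherWt M f) : x = 0 :=
  (Submodule.disjoint_def.1 (iSupIndep_wsp M f)) x hx hx'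

/-- The part of degree `d` of the span of the monomials. -/
lemma mem_span_of_mem_monSpan {R : Type*} [CommRing R] [Module R M] [SMul R Kv]
    [IsScalarTower R Kv M] {f : Fin 2 → ℤ} {x : M} (hx : x ∈ wsp M f) {d : Fin 2 → ℕ} {z : M}
    (hz : z ∈ monSpan R x) (hz' : z ∈ wsp M (lower f d)) :
    z ∈ Submodule.span R {y | ∃ u, FMon d u ∧ y = u • x} := by
  have h : monSpan R x ≤ Submodule.span R {y | ∃ u, FMon d u ∧ y = u • x} ⊔
      (otherWt M (lower f d)).restrictScalars R := by
    refine Submodule.span_le.2 ?_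
    rintro _ ⟨e, u, hu, rfl⟩
    by_cases hed : e = d
    · subst hed
      exact Submodule.mem_sup_left (Submodule.subset_span ⟨u, hu, rfl⟩)
    · refine Submodule.mem_sup_right ?_
      exact mem_otherWt (fun h => hed (lower_injective f h)) (hu.smul_mem_wsp hx)
  obtain ⟨y, hy, w, hw, rfl⟩ := Submodule.mem_sup.1 (h hz)
  have hy' : y ∈ wsp M (lower f d) := by
    have : Submodule.span R {y | ∃ u, FMon d u ∧ y = u • x} ≤
        (wsp M (lower f d)).restrictScalars R := by
      refine Submodule.span_le.2 ?_
      rintro _ ⟨u, hu, rfl⟩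
      exact hu.smul_mem_wsp hx
    exact this hy
  have hw' : w ∈ wsp M (lower f d) := by
    have := sub_mem hz' hy'
    rwa [add_sub_cancel_left] at this
  rw [eq_zero_of_mem_otherWt hw' hw, add_zero]
  exact hy

end Modules

/-! ### The irreducible module is nonzero -/

/-- The highest weight, as a function to the integers. -/
def wtΛ (Λ : Fin 2 → ℕ) : Fin 2 → ℤ := fun i => Λ i

/-- The span of the monomials of nonzero degree. -/
def lowSpan : Submodule Kv U := Submodule.span Kv {u | ∃ d, d ≠ 0 ∧ FMon d u}

section Modules

variable {M : Type*} [AddCommGroup M] [Module Kv M] [Module U M] [IsScalarTower Kv U M]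

lemma FMon.eq_one {d : Fin 2 → ℕ} {u : U} (hu : FMon d u) (hd : d = 0) : u = 1 := by
  induction hu with
  | one => rfl
  | step i r hu ih =>
    rename_i d u
    have h : ∀ j, d j + (Pi.single i r : Fin 2 → ℕ) j = 0 := fun j => congrFun hd j
    have hr : r = 0 := by have := h i; simp at this; omega
    subst hr
    rw [ih (funext fun j => by have := h j; simp at this ⊢; omega), dF_zero, one_mul]

/-- The triangular decomposition in the form needed here: acting on a highest vector, any element of
`U` is a scalar plus strictly lowering terms. -/
lemma exists_lowSpan {f : Fin 2 → ℤ} {x : M} (hx : IsHighest f x) (a : U) :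
    ∃ c : Kv, ∃ w ∈ lowSpan, a • x = (c • (1 : U) + w) • x := by
  have h := U_smul_mem_monSpan hx a (self_mem_monSpan Kv x)
  generalize a • x = z at h
  induction h using Submodule.span_induction with
  | mem y hy =>
    obtain ⟨d, u, hu, rfl⟩ := hy
    by_cases hd : d = 0
    · exact ⟨1, 0, zero_mem _, by rw [hu.eq_one hd]; simp⟩
    · exact ⟨0, u, Submodule.subset_span ⟨d, hd, hu⟩, by simp⟩
  | zero => exact ⟨0, 0, zero_mem _, by simp⟩
  | add y z _ _ hy hz =>
    obtain ⟨c, w, hw, rfl⟩ := hy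
    obtain ⟨c', w', hw', rfl⟩ := hz
    exact ⟨c + c', w + w', add_mem hw hw', by simp only [add_smul]; abel⟩
  | smul r y _ hy =>
    obtain ⟨c, w, hw, rfl⟩ := hy
    exact ⟨r * c, r • w, Submodule.smul_mem _ r hw, by simp only [mul_smul, ← smul_add, smul_assoc]⟩

lemma lowSpan_smul_mem {f : Fin 2 → ℤ} {x : M} (hx : x ∈ wsp M f) {w : U} (hw : w ∈ lowSpan) :
    w • x ∈ otherWt M f := by
  induction hw using Submodule.span_induction with
  | mem y hy =>
    obtain ⟨d, hd, hu⟩ := hy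
    refine mem_otherWt (fun h => hd (lower_injective f ?_)) (hu.smul_mem_wsp hx)
    rw [h, lower_zero]
  | zero => simp
  | add y z _ _ hy hz => rw [add_smul]; exact add_mem hy hz
  | smul r y _ hy => rw [smul_assoc]; exact Submodule.smul_mem _ r hy

lemma vermaIdeal_smul {Λ : Fin 2 → ℕ} {x : M} (hx : IsHighest (wtΛ Λ) x) {a : U}
    (ha : a ∈ vermaIdeal Λ) : a • x = 0 := by
  induction ha using Submodule.span_induction with
  | mem y hy =>
    rcases hy with ⟨i, rfl⟩ | ⟨i, rfl⟩
    · exact hx.E_smul i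
    · have := hx.mem_wsp i
      rw [HasWt, wtΛ, zpow_natCast] at this
      rw [sub_smul, algebraMap_smul, this, sub_self]
  | zero => simp
  | add y z _ _ hy hz => rw [add_smul, hy, hz, add_zero]
  | smul r y _ hy => rw [smul_eq_mul, mul_smul, hy, smul_zero]

end Modules

lemma isHighest_mk {Λ : Fin 2 → ℕ} {J : Submodule U U} (hJ : vermaIdeal Λ ≤ J) :
    IsHighest (wtΛ Λ) (Submodule.Quotient.mk 1 : U ⧸ J) := by
  constructor
  · intro i
    rw [← Submodule.Quotient.mk_smul, smul_eq_mul, mul_one, Submodule.Quotient.mk_eq_zero]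
    exact hJ (Submodule.subset_span (Or.inl ⟨i, rfl⟩))
  · intro i
    rw [HasWt, wtΛ, zpow_natCast, ← algebraMap_smul U (v ^ Λ i), ← sub_eq_zero, ← sub_smul,
      ← Submodule.Quotient.mk_smul, smul_eq_mul, mul_one, Submodule.Quotient.mk_eq_zero]
    exact hJ (Submodule.subset_span (Or.inr ⟨i, rfl⟩))

lemma mk_eq_smul_mk_one {J : Submodule U U} (a : U) :
    (Submodule.Quotient.mk a : U ⧸ J) = a • Submodule.Quotient.mk 1 := by
  rw [← Submodule.Quotient.mk_smul, smul_eq_mul, mul_one]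

/-- Modulo `vermaIdeal`, `a` is `c + w` with `c` a scalar and `w` lowering. In `U ⧸ J` this
annihilates the class of `1`; comparing weights, `c ≠ 0` would put `1` into `J`. Hence `c = 0`, and
`a` strictly lowers every highest vector of weight `Λ`, in particular that of the model. -/
lemma smul_mem_otherWt_of_mem {Λ : Fin 2 → ℕ} {M : Type*} [AddCommGroup M] [Module Kv M]
    [Module U M] [IsScalarTower Kv U M] {x : M} (hx : IsHighest (wtΛ Λ) x) {J : Submodule U U}
    (hJ : vermaIdeal Λ ≤ J) (hJ' : J ≠ ⊤) {a : U} (ha : a ∈ J) :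
    a • x ∈ otherWt M (wtΛ Λ) := by
  obtain ⟨c, w, hw, h⟩ := exists_lowSpan (isHighest_mk (le_refl (vermaIdeal Λ))) a
  rw [← mk_eq_smul_mk_one, ← mk_eq_smul_mk_one, Submodule.Quotient.eq] at h
  have hm := isHighest_mk hJ
  have h1 : (c • (1 : U) + w) • (Submodule.Quotient.mk 1 : U ⧸ J) = 0 := by
    rw [← mk_eq_smul_mk_one, Submodule.Quotient.mk_eq_zero]
    have := sub_mem ha (hJ h)
    rwa [sub_sub_cancel] at this
  have hc : c = 0 := by
    by_contra hc
    rw [add_smul, smul_assoc, one_smul, add_eq_zero_iff_eq_neg] at h1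
    have h2 := eq_zero_of_mem_otherWt (Submodule.smul_mem _ c hm.mem_wsp)
      (h1 ▸ neg_mem (lowSpan_smul_mem hm.mem_wsp hw))
    rw [smul_eq_zero_iff_right hc, Submodule.Quotient.mk_eq_zero] at h2
    exact hJ' ((Ideal.eq_top_iff_one J).2 h2)
  have h3 := vermaIdeal_smul hx h
  rw [sub_smul, sub_eq_zero, hc, zero_smul, zero_add] at h3
  rw [h3]
  exact lowSpan_smul_mem hx.mem_wsp hw

lemma exists_isHighest_ne_zero (Λ : Fin 2 → ℕ) :
    ∃ (_ : Module U Model.Space) (_ : IsScalarTower Kv U Model.Space) (x : Model.Space),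
      IsHighest (wtΛ Λ) x ∧ x ≠ 0 := by
  let inst : Module U Model.Space := Module.compHom _ (Model.rep (wtΛ Λ)).toRingHom
  have hs : ∀ (u : U) (x : Model.Space), u • x = Model.rep (wtΛ Λ) u x := fun _ _ => rfl
  have inst2 : IsScalarTower Kv U Model.Space := ⟨fun c u x => by
    rw [hs, hs, map_smul, LinearMap.smul_apply]⟩
  exact ⟨inst, inst2, Model.top, ⟨fun i => Model.rep_E_top _ i, fun i => Model.rep_K_top _ i⟩,
    Model.top_ne_zero⟩

lemma one_notMem_maxIdeal (Λ : Fin 2 → ℕ) : (1 : U) ∉ maxIdeal Λ := by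
  obtain ⟨inst, inst2, x, hx, hx0⟩ := exists_isHighest_ne_zero Λ
  -- A left ideal that contains every proper `J` above `vermaIdeal` and does not contain `1`;
  -- therefore the sum of all these `J` remains proper.
  let N : Submodule U U :=
    { carrier := {u | ∀ a : U, (a * u) • x ∈ otherWt Model.Space (wtΛ Λ)}
      add_mem' := fun hu hw a => by rw [mul_add, add_smul]; exact add_mem (hu a) (hw a)
      zero_mem' := fun a => by simp
      smul_mem' := fun b u hu a => by rw [smul_eq_mul, ← mul_assoc]; exact hu (a * b) }
  have h : maxIdeal Λ ≤ N := by
    refine sup_le ?_ (sSup_le ?_)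
    · intro u hu a
      rw [mul_smul, vermaIdeal_smul hx hu, smul_zero]
      exact zero_mem _
    · rintro J ⟨hJ, hJ'⟩ u hu a
      exact smul_mem_otherWt_of_mem hx hJ hJ' (J.smul_mem a hu)
  intro h1
  have := h h1 1
  rw [one_mul, one_smul] at this
  exact hx0 (eq_zero_of_mem_otherWt hx.mem_wsp this)

lemma isHighest_sv (Λ : Fin 2 → ℕ) : IsHighest (wtΛ Λ) (sv Λ) := isHighest_mk le_sup_left

lemma sv_ne_zero (Λ : Fin 2 → ℕ) : sv Λ ≠ 0 := by
  intro h
  exact one_notMem_maxIdeal Λ ((Submodule.Quotient.mk_eq_zero _).1 h)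

/-- There is no highest vector in `L(Λ)` of a weight strictly below the highest one. -/
lemma eq_zero_of_isHighest {Λ : Fin 2 → ℕ} {d : Fin 2 → ℕ} (hd : d ≠ 0) {x : L Λ}
    (hx : IsHighest (lower (wtΛ Λ) d) x) : x = 0 := by
  -- `J` is the left ideal of the submodule `U x`. All weights of `U x` lie strictly below `Λ`, so
  -- `J` is proper, hence inside `maxIdeal`; any lift of `x` lies in `J`, whence `x = 0`.
  let J : Submodule U U :=
    { carrier := {a | ∃ b : U, a • sv Λ = b • x}
      add_mem' := by
        rintro a a' ⟨b, hb⟩ ⟨b', hb'⟩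
        exact ⟨b + b', by rw [add_smul, add_smul, hb, hb']⟩
      zero_mem' := ⟨0, by simp⟩
      smul_mem' := by
        rintro c a ⟨b, hb⟩
        exact ⟨c * b, by rw [smul_eq_mul, mul_smul, mul_smul, hb]⟩ }
  have hJ : vermaIdeal Λ ≤ J := fun a ha => ⟨0, by
    rw [vermaIdeal_smul (isHighest_sv Λ) ha, zero_smul]⟩
  have hJ' : J ≠ ⊤ := by
    intro h
    obtain ⟨b, hb⟩ : (1 : U) ∈ J := h ▸ Submodule.mem_top
    rw [one_smul] at hb
    have h1 : sv Λ ∈ monSpan Kv x := by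
      rw [hb]; exact U_smul_mem_monSpan hx b (self_mem_monSpan Kv x)
    have h2 : monSpan Kv x ≤ otherWt (L Λ) (wtΛ Λ) := by
      refine Submodule.span_le.2 ?_
      rintro _ ⟨e, u, hu, rfl⟩
      refine mem_otherWt (fun h => hd ?_) (hu.smul_mem_wsp hx.mem_wsp)
      have h' : lower (wtΛ Λ) (d + e) = lower (wtΛ Λ) 0 := by
        rw [lower_zero]
        conv_rhs => rw [← h]
        funext i
        simp only [lower, Pi.add_apply, Nat.cast_add, mul_add, Finset.sum_add_distrib]
        rw [sub_add_eq_sub_sub]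
      have h'' := lower_injective _ h'
      funext i
      have := congrFun h'' i
      simp at this ⊢
      exact this.1
    exact sv_ne_zero Λ (eq_zero_of_mem_otherWt (isHighest_sv Λ).mem_wsp (h2 h1))
  have hmax : J ∈ {J : Submodule U U | vermaIdeal Λ ≤ J ∧ J ≠ ⊤} := ⟨hJ, hJ'⟩
  have hle : J ≤ maxIdeal Λ := (le_sSup hmax).trans le_sup_right
  obtain ⟨u, rfl⟩ : ∃ u, toL Λ u = x := Submodule.mkQ_surjective (maxIdeal Λ) x
  have hu : u • sv Λ = toL Λ u := by rw [sv, ← map_smul, smul_eq_mul, mul_one]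
  have hmem : u ∈ J := ⟨1, by rw [hu, one_smul]⟩
  exact (Submodule.Quotient.mk_eq_zero _).2 (hle hmem)

lemma exists_smul_sv {Λ : Fin 2 → ℕ} (x : L Λ) : ∃ u : U, x = u • sv Λ := by
  obtain ⟨u, rfl⟩ : ∃ u, toL Λ u = x := Submodule.mkQ_surjective (maxIdeal Λ) x
  exact ⟨u, by rw [sv, ← map_smul, smul_eq_mul, mul_one]⟩

lemma mem_monSpan_sv {Λ : Fin 2 → ℕ} (x : L Λ) : x ∈ monSpan Kv (sv Λ) := by
  obtain ⟨u, rfl⟩ := exists_smul_sv x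
  exact U_smul_mem_monSpan (isHighest_sv Λ) u (self_mem_monSpan Kv _)

lemma mem_monSpan_of_mem_LA {Λ : Fin 2 → ℕ} {x : L Λ} (hx : x ∈ LA Λ) :
    x ∈ monSpan A (sv Λ) := by
  obtain ⟨u, hu, rfl⟩ := hx
  exact UA_smul_mem_monSpan (isHighest_sv Λ) hu (self_mem_monSpan A _)

lemma sv_mem_LA (Λ : Fin 2 → ℕ) : sv Λ ∈ LA Λ := ⟨1, one_mem UA, by simp⟩

lemma UA_smul_mem_LA {Λ : Fin 2 → ℕ} {a : U} (ha : a ∈ UA) {x : L Λ} (hx : x ∈ LA Λ) :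
    a • x ∈ LA Λ := by
  obtain ⟨u, hu, rfl⟩ := hx
  exact ⟨a * u, mul_mem (S := Subalgebra A U) ha hu, by simp [mul_smul]⟩

lemma dE_mem_UA (i : Fin 2) (r : ℕ) : dE i r ∈ UA :=
  Algebra.subset_adjoin (Or.inl (Or.inl ⟨i, r, rfl⟩))

lemma dF_mem_UA (i : Fin 2) (r : ℕ) : dF i r ∈ UA :=
  Algebra.subset_adjoin (Or.inl (Or.inr ⟨i, r, rfl⟩))

/-! ### Integrability of `L(Λ)` -/

section Modules

variable {M : Type*} [AddCommGroup M] [Module Kv M] [Module U M] [IsScalarTower Kv U M]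

lemma dF_smul_F_smul (i : Fin 2) (n : ℕ) (x : M) :
    dF i n • F i • x = zint (n + 1) • dF i (n + 1) • x := by
  rw [← mul_smul, dF_mul_F, smul_assoc]

lemma E_smul_dF_smul_of_ne {i j : Fin 2} (h : i ≠ j) (s : ℕ) (x : M) :
    E i • dF j s • x = dF j s • E i • x := by
  rw [← mul_smul, E_mul_dF_diff h, mul_smul]

lemma E_smul_F_smul_of_ne {i j : Fin 2} (h : i ≠ j) (x : M) :
    E i • F j • x = F j • E i • x := by
  rw [← mul_smul, E_mul_F_diff h, mul_smul]

lemma dF_smul_eq_zero_iff {i : Fin 2} {k : ℕ} {x : M} : dF i k • x = 0 ↔ F i ^ k • x = 0 := by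
  rw [dF, smul_assoc, smul_eq_zero_iff_right (inv_ne_zero (qFact_ne_zero k))]

/-- A string of a locally nilpotent `F_i` ends where it should. -/
lemma dF_succ_smul_eq_zero {i : Fin 2} {n : ℕ} {x : M} (hx : HasWt i n x) (hE : E i • x = 0)
    (hF : ∃ k, F i ^ k • x = 0) : dF i (n + 1) • x = 0 := by
  -- Here `E_i F_i^{(k+1)} x = [n-k] F_i^{(k)} x`, and `[n-k] ≠ 0` for `k > n`, so vanishing
  -- descends to `k = n + 1`.
  have step : ∀ k, n + 1 ≤ k → dF i (k + 1) • x = 0 → dF i k • x = 0 := by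
    intro k hk h
    have := E_smul_dF_succ hx k
    rw [h, hE, smul_zero, smul_zero, zero_add] at this
    exact (smul_eq_zero_iff_right (zint_ne_zero (by omega))).1 this.symm
  obtain ⟨k, hk⟩ := hF
  have hk' : dF i (n + 1 + k) • x = 0 := by
    rw [dF_smul_eq_zero_iff, pow_add, mul_smul, hk, smul_zero]
  clear hk
  induction k with
  | zero => exact hk'
  | succ k ih => exact ih (step _ (by omega) hk')

/-- The string of a lowest vector. -/
lemma F_pow_smul_E_pow_smul {i : Fin 2} {N : ℤ} {y : M} (hy : HasWt i (-N) y)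
    (hF : F i • y = 0) (a b : ℕ) (hab : (a : ℤ) + b ≤ N) :
    ∃ c : Kv, c ≠ 0 ∧ F i ^ a • E i ^ (a + b) • y = c • E i ^ b • y := by
  induction a with
  | zero => exact ⟨1, one_ne_zero, by simp⟩
  | succ a ih =>
    obtain ⟨c, hc, h⟩ := ih (by push_cast at hab; omega)
    refine ⟨zint ((a + b : ℕ) + 1) * zint (N - (a + b : ℕ)) * c,
      mul_ne_zero (mul_ne_zero (zint_ne_zero (by omega))
        (zint_ne_zero (by push_cast at hab ⊢; omega))) hc, ?_⟩
    rw [pow_succ, mul_smul, add_right_comm, F_smul_E_pow_succ hy hF, smul_smul_comm_U, h, smul_smul]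

/-- If `F_i` is locally nilpotent, then `F_i^n` maps the weight space of weight `f` with `f_i = n`
onto its reflection. -/
lemma exists_dF_smul_eq {i : Fin 2} {f : Fin 2 → ℤ} {n : ℕ} (hf : f i = n) (s : ℕ) {z : M}
    (hz : z ∈ wsp M (fun j => f j - n * cartan j i)) (hs : F i ^ s • z = 0) :
    ∃ w ∈ wsp M f, dF i n • w = z := by
  induction s generalizing z with
  | zero => exact ⟨0, zero_mem _, by simpa using hs.symm⟩
  | succ s ih =>
    set y := F i ^ s • z with hy
    have hFy : F i • y = 0 := by rw [hy, ← mul_smul, ← pow_succ', hs]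
    have hyw : HasWt i (-((n : ℤ) + 2 * s)) y := by
      have : HasWt i (f i - n * cartan i i - s * cartan i i) y := (hz i).F_pow i s
      rw [cartan_self, hf] at this
      convert this using 1
      ring
    have hyE : ∀ r : ℕ, E i ^ r • y ∈ wsp M (fun j => f j - (n + s - r) * cartan j i) := by
      intro r j
      have := ((hz j).F_pow i s).E_pow i r
      convert this using 1
      ring
    obtain ⟨c, hc, h1⟩ := F_pow_smul_E_pow_smul hyw hFy s 0 (by push_cast; omega)
    obtain ⟨c', hc', h2⟩ := F_pow_smul_E_pow_smul hyw hFy n s (by omega)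
    rw [add_zero, pow_zero, one_smul] at h1
    -- Subtracting the string of the lowest vector `y = F_i^s z` lowers the nilpotency order of `z`.
    -- The subtracted term `E_i^s y` is itself, up to a nonzero scalar, `F_i^n E_i^(n+s) y`.
    obtain ⟨w, hw, hwz⟩ := ih (z := z - c⁻¹ • E i ^ s • y)
      (sub_mem hz (Submodule.smul_mem _ _ (by
        have := hyE s
        simpa using this)))
      (by rw [smul_sub, smul_smul_comm_U, h1, smul_smul, inv_mul_cancel₀ hc, one_smul, ← hy,
        sub_self])
    refine ⟨w + (c⁻¹ * c'⁻¹ * qFact n) • E i ^ (n + s) • y, add_mem hw (Submodule.smul_mem _ _ (by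
      have := hyE (n + s)
      simpa using this)), ?_⟩
    have h3 : dF i n • E i ^ (n + s) • y = ((qFact n)⁻¹ * c') • E i ^ s • y := by
      rw [dF, smul_assoc, h2, smul_smul]
    have h4 : c⁻¹ * c'⁻¹ * qFact n * ((qFact n)⁻¹ * c') = c⁻¹ := by
      have := qFact_ne_zero n
      field_simp
    rw [smul_add, hwz, smul_smul_comm_U, h3, smul_smul (c⁻¹ * c'⁻¹ * qFact n), h4, sub_add_cancel]

end Modules

/-- The vector is killed by both `E_j` (for `j = i` the scalar is `[0]`) and has weight strictly
below `Λ`, so irreducibility forces it to vanish. -/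
lemma dF_succ_smul_sv (Λ : Fin 2 → ℕ) (i : Fin 2) : dF i (Λ i + 1) • sv Λ = 0 := by
  have hsv := isHighest_sv Λ
  refine eq_zero_of_isHighest (d := 0 + Pi.single i (Λ i + 1)) ?_ ⟨fun j => ?_, ?_⟩
  · intro h
    have := congrFun h i
    simp at this
  · by_cases hij : j = i
    · subst hij
      rw [E_smul_dF_succ (hsv.mem_wsp j), hsv.E_smul, wtΛ, sub_self, zint_zero]
      simp
    · rw [E_smul_dF_smul_of_ne hij, hsv.E_smul, smul_zero]
  · have := (FMon.one.step i (Λ i + 1)).smul_mem_wsp hsv.mem_wsp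
    rwa [mul_one] at this

/-- Nilpotency on `sv` spreads to all monomials: for `j ≠ i` the Serre relation writes `F_i^(k+1)
F_j` as a combination of `F_j F_i^(k+1)` and `rootF F_i^k`, at the cost of one extra power. -/
lemma exists_F_pow_smul_eq_zero {Λ : Fin 2 → ℕ} (i : Fin 2) (x : L Λ) :
    ∃ k, F i ^ k • x = 0 := by
  have hmono : ∀ {k : ℕ} (l : ℕ) {y : L Λ}, F i ^ k • y = 0 → F i ^ (l + k) • y = 0 := by
    intro k l y h
    rw [pow_add, mul_smul, h, smul_zero]
  have hF : ∀ (j : Fin 2) (y : L Λ), (∃ k, F i ^ k • y = 0) → ∃ k, F i ^ k • F j • y = 0 := by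
    rintro j y ⟨k, hk⟩
    by_cases hij : i = j
    · subst hij
      exact ⟨k, by rw [← mul_smul, ← pow_succ, pow_succ', mul_smul, hk, smul_zero]⟩
    · refine ⟨k + 1, ?_⟩
      rw [← mul_smul, F_pow_succ_mul_F hij, add_smul, smul_assoc, smul_assoc, mul_smul, mul_smul,
        hk, pow_succ', mul_smul, hk]
      simp
  have hx := mem_monSpan_sv x
  induction hx using Submodule.span_induction with
  | mem y hy =>
    obtain ⟨d, u, hu, rfl⟩ := hy
    induction hu with
    | one => exact ⟨Λ i + 1, by rw [one_smul, ← dF_smul_eq_zero_iff, dF_succ_smul_sv]⟩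
    | step j r hu ih =>
      rename_i d u
      have : ∀ r : ℕ, ∃ k, F i ^ k • F j ^ r • u • sv Λ = 0 := by
        intro r
        induction r with
        | zero => simpa using ih
        | succ r ihr => rw [pow_succ', mul_smul]; exact hF j _ ihr
      obtain ⟨k, hk⟩ := this r
      exact ⟨k, by rw [mul_smul, dF, smul_assoc, smul_smul_comm_U, hk, smul_zero]⟩
  | zero => exact ⟨0, by simp⟩
  | add y z _ _ hy hz =>
    obtain ⟨k, hk⟩ := hy
    obtain ⟨l, hl⟩ := hz
    exact ⟨k + l, by rw [smul_add, hmono k hl, Nat.add_comm k l, hmono l hk, add_zero]⟩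
  | smul c y _ hy =>
    obtain ⟨k, hk⟩ := hy
    exact ⟨k, by rw [smul_smul_comm_U, hk, smul_zero]⟩

/-! ### Lusztig's symmetry on strings of depth at most one -/

lemma component_self {Λ : Fin 2 → ℕ} {i : Fin 2} {n : ℤ} {x : L Λ} (hx : x ∈ grade Λ i n) (m : ℤ) :
    component Λ i m x = if m = n then x else 0 := by
  have h : (LinearEquiv.ofBijective (DirectSum.coeLinearMap (grade Λ i))
      (isInternal_grade Λ i)).symm x = DirectSum.lof Kv ℤ (fun n => grade Λ i n) n ⟨x, hx⟩ :=
    (LinearEquiv.symm_apply_eq _).2 (DirectSum.coeLinearMap_lof (grade Λ i) n ⟨x, hx⟩).symm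
  rw [component, h]
  split_ifs with hm
  · subst hm
    rw [DirectSum.lof_apply]
  · rw [DirectSum.lof_eq_of, DirectSum.of_eq_of_ne _ _ _ hm]; rfl

lemma altSum_eq_sum {N R : ℕ} (h : N < R) (s : ℤ) :
    ∑ b ∈ Finset.range R, (-1) ^ b * v ^ (b * s) * zbin N b = altSum N s := by
  rw [altSum]
  refine (Finset.sum_subset (Finset.range_mono h) fun b _ hb => ?_).symm
  rw [Finset.mem_range] at hb
  rw [zbin_eq_zero (by omega), mul_zero]

lemma zint_sub_one {e : ℤ} (he : e = 1 ∨ e = -1) (k : ℤ) :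
    zint (k - 1) - v ^ e * zint k = -v ^ (e * k) := by
  rcases he with rfl | rfl
  · have := zint_add' k (-1)
    rw [zint_neg, zint_one, neg_neg] at this
    rw [sub_eq_add_neg k, this, one_mul]
    ring
  · have := zint_add k (-1)
    rw [zint_neg, zint_one] at this
    rw [sub_eq_add_neg k, this, neg_one_mul]
    ring

/-- As a function of `b` the exponent has slope `-ea`, which is an extreme root of the alternating
sum for `N = a + 1`. -/
lemma sum_zbin_eq_zero {e : ℤ} (he : e = 1 ∨ e = -1) (a : ℕ) (n : ℤ) {R : ℕ} (hR : a + 1 < R) :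
    ∑ b ∈ Finset.range R, (-1) ^ b * v ^ (e * (b - (a + 1 : ℕ) * (n - (a + 1 : ℕ) + b))) *
      zbin (a + 1 : ℕ) b = 0 := by
  have h : ∀ b : ℕ, (-1) ^ b * v ^ (e * (b - (a + 1 : ℕ) * (n - (a + 1 : ℕ) + b))) *
      zbin (a + 1 : ℕ) b = v ^ (-e * (a + 1) * (n - (a + 1))) *
        ((-1) ^ b * v ^ (b * (-e * a)) * zbin (a + 1 : ℕ) b) := by
    intro b
    have : v ^ (e * (b - (a + 1 : ℕ) * (n - (a + 1 : ℕ) + b))) =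
        v ^ (-e * (a + 1) * (n - (a + 1))) * v ^ (b * (-e * a)) := by
      rw [← zpow_add₀ v_ne_zero]; congr 1; push_cast; ring
    rw [this]; ring
  rw [Finset.sum_congr rfl fun b _ => h b, ← Finset.mul_sum, altSum_eq_sum hR]
  rcases he with rfl | rfl
  · rw [show -(1 : ℤ) * a = -a by ring, altSum_bot, mul_zero]
  · rw [show -(-1 : ℤ) * a = a by ring, altSum_top, mul_zero]

/-- Writing the quantum integer as a difference of two powers splits the sum into alternating sums
of slopes `-ea ± 1`, both roots for `N = a + 2`: the two outermost ones at one end. -/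
lemma sum_zint_mul_zbin_eq_zero {e : ℤ} (he : e = 1 ∨ e = -1) (a : ℕ) (n : ℤ) {R : ℕ}
    (hR : a + 2 < R) :
    ∑ b ∈ Finset.range R, (-1) ^ b * v ^ (e * (b - (a + 1 : ℕ) * (n - (a + 1 : ℕ) + b))) *
      (zint (n - (a + 1 : ℕ) + b + 1) * zbin (a + 2 : ℕ) b) = 0 := by
  have h : ∀ b : ℕ, (-1) ^ b * v ^ (e * (b - (a + 1 : ℕ) * (n - (a + 1 : ℕ) + b))) *
      (zint (n - (a + 1 : ℕ) + b + 1) * zbin (a + 2 : ℕ) b) =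
        (v ^ (-e * (a + 1) * (n - (a + 1)) + (n - a)) / (v - v⁻¹)) *
          ((-1) ^ b * v ^ (b * (-e * a + 1)) * zbin (a + 2 : ℕ) b) -
        (v ^ (-e * (a + 1) * (n - (a + 1)) - (n - a)) / (v - v⁻¹)) *
          ((-1) ^ b * v ^ (b * (-e * a - 1)) * zbin (a + 2 : ℕ) b) := by
    intro b
    have h1 : v ^ (e * (b - (a + 1 : ℕ) * (n - (a + 1 : ℕ) + b))) *
        v ^ (n - (a + 1 : ℕ) + b + 1) =
        v ^ (-e * (a + 1) * (n - (a + 1)) + (n - a)) * v ^ (b * (-e * a + 1)) := by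
      rw [← zpow_add₀ v_ne_zero, ← zpow_add₀ v_ne_zero]; congr 1; push_cast; ring
    have h2 : v ^ (e * (b - (a + 1 : ℕ) * (n - (a + 1 : ℕ) + b))) *
        v ^ (-(n - (a + 1 : ℕ) + b + 1)) =
        v ^ (-e * (a + 1) * (n - (a + 1)) - (n - a)) * v ^ (b * (-e * a - 1)) := by
      rw [← zpow_add₀ v_ne_zero, ← zpow_add₀ v_ne_zero]; congr 1; push_cast; ring
    rw [zint]
    linear_combination ((-1) ^ b * zbin (a + 2 : ℕ) b / (v - v⁻¹)) * (h1 - h2)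
  rw [Finset.sum_congr rfl fun b _ => h b, Finset.sum_sub_distrib, ← Finset.mul_sum,
    ← Finset.mul_sum, altSum_eq_sum hR, altSum_eq_sum hR]
  have t1 := altSum_top (a + 1)
  have t2 := altSum_bot (a + 1)
  push_cast at t1 t2
  rcases he with rfl | rfl
  · rw [show -(1 : ℤ) * a + 1 = 1 - a by ring, altSum_bot',
      show -(1 : ℤ) * a - 1 = -(a + 1) by ring, t2]
    ring
  · rw [show -(-1 : ℤ) * a + 1 = a + 1 by ring, t1,
      show -(-1 : ℤ) * a - 1 = a - 1 by ring, altSum_top']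
    ring

lemma dFZ_smul_F_smul {M : Type*} [AddCommGroup M] [Module Kv M] [Module U M]
    [IsScalarTower Kv U M] (i : Fin 2) (s : ℤ) (x : M) :
    dFZ i s • F i • x = zint (s + 1) • dFZ i (s + 1) • x := by
  rcases lt_or_ge s 0 with hs | hs
  · rw [dFZ_neg i hs, zero_smul]
    rcases lt_or_ge (s + 1) 0 with hs' | hs'
    · rw [dFZ_neg i hs', zero_smul, smul_zero]
    · rw [show s + 1 = 0 by omega, zint_zero, zero_smul]
  · lift s to ℕ using hs
    exact dF_smul_F_smul i s x

/-- Since `y` and `X` are highest, `E^{(b)} F^{(c)} z` is a combination of one divided power of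
`F_i` on `y` and one on `X`, and these do not depend on `b` for fixed `a`. Summing over `b` gives
zero for `a ≥ 1`; for `a = 0` only `b = 0, 1` survive. -/
lemma T_apply {Λ : Fin 2 → ℕ} {i : Fin 2} {n : ℕ} {e : ℤ} (he : e = 1 ∨ e = -1)
    {X y : L Λ} (hX : HasWt i (n + 2) X) (hEX : E i • X = 0) (hy : HasWt i n y)
    (hEy : E i • y = 0) (κ : Kv) {z : L Λ} (hz : z = y + κ • F i • X) :
    T Λ i e z = dF i n • z - v ^ e • E i • dF i (n + 1) • z := by
  have hzw : z ∈ grade Λ i n := by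
    rw [mem_grade, hz]
    have h1 := hX.F i
    rw [cartan_self, add_sub_cancel_right] at h1
    exact hy.add (h1.smul κ)
  have key : ∀ a b : ℕ, dE i b • dFZ i ((n : ℤ) - a + b) • z =
      zbin a b • dFZ i ((n : ℤ) - a) • y +
        (κ * (zint ((n : ℤ) - a + b + 1) * zbin (a + 1 : ℕ) b)) • dFZ i ((n : ℤ) - a + 1) • X := by
    intro a b
    rw [hz, smul_add, smul_add, smul_smul_comm_U, smul_smul_comm_U, dFZ_smul_F_smul,
      smul_smul_comm_U, dE_smul_dFZ_of_E_eq_zero hy hEy, dE_smul_dFZ_of_E_eq_zero hX hEX,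
      smul_smul (zint _), smul_smul κ]
    congr 2
    · congr 1; ring
    · congr 2; ring
    · congr 2; congr 1; push_cast; ring
    · congr 2; ring
  set g : ℕ × ℕ → L Λ := fun p => ((-1) ^ p.2 * v ^ (e * ((p.2 : ℤ) - p.1 * (n - p.1 + p.2)))) •
    dF i p.1 • dE i p.2 • dFZ i ((n : ℤ) - p.1 + p.2) • z with hg
  have hTg : T Λ i e z = ∑ᶠ t : {t : ℕ × ℕ × ℕ // (t.1 : ℤ) - t.2.1 + t.2.2 = n},
      g (t.1.1, t.1.2.1) := by
    rw [T, finsum_eq_single _ (n : ℤ)]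
    · refine finsum_congr fun t => ?_
      obtain ⟨⟨a, b, c⟩, ht⟩ := t
      have hc : (n : ℤ) - a + b = c := by simp only at ht; omega
      simp only [hg, component_self hzw, if_true, hc, dFZ_natCast]
    · intro m hm
      rw [← finsum_zero (α := {t : ℕ × ℕ × ℕ // (t.1 : ℤ) - t.2.1 + t.2.2 = m})]
      refine finsum_congr fun t => ?_
      rw [component_self hzw, if_neg hm]
      simp
  have hinj : Function.Injective
      (fun t : {t : ℕ × ℕ × ℕ // (t.1 : ℤ) - t.2.1 + t.2.2 = n} => (t.1.1, t.1.2.1)) := by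
    rintro ⟨⟨a, b, c⟩, h⟩ ⟨⟨a', b', c'⟩, h'⟩ heq
    simp only [Prod.mk.injEq] at heq h h'
    obtain ⟨rfl, rfl⟩ := heq
    have : c = c' := by omega
    subst this
    rfl
  -- `c = n - a + b` is determined by `(a, b)`. For `a ≥ n + 2` both divided powers in `key` have
  -- negative index, and for `b > a + 1` both binomials vanish, hence the ranges `n + 2` and `n +
  -- 3`.
  have hsum : T Λ i e z = ∑ p ∈ Finset.range (n + 2) ×ˢ Finset.range (n + 3), g p := by
    rw [hTg, ← finsum_mem_range (f := g) hinj]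
    refine finsum_mem_eq_sum_of_inter_support_eq _ ?_
    ext ⟨a, b⟩
    simp only [Set.mem_inter_iff, Function.mem_support, Finset.coe_product, Finset.coe_range,
      Set.mem_prod, Set.mem_Iio, and_congr_left_iff]
    intro hne
    constructor
    · intro _
      by_contra hab
      apply hne
      simp only [hg, key]
      by_cases ha : a < n + 2
      · rw [zbin_eq_zero (n := a) (by omega), zbin_eq_zero (n := a + 1) (by omega)]
        simp
      · rw [dFZ_neg i (by omega), dFZ_neg i (by omega)]
        simp
    · intro _
      by_cases hc : (n : ℤ) - a + b < 0
      · exact absurd (by simp [hg, dFZ_neg i hc]) hne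
      · exact ⟨⟨(a, b, ((n : ℤ) - a + b).toNat), by simp only; omega⟩, rfl⟩
  rw [hsum, Finset.sum_product, Finset.sum_eq_single 0]
  · rw [Finset.sum_range_succ', Finset.sum_range_succ', Finset.sum_eq_zero, zero_add]
    · have h1 : dFZ i ((n : ℤ) + 1) = dF i (n + 1) := dFZ_natCast i (n + 1)
      simp [hg, dF_zero, dE_zero, dE_one, h1]
      abel
    · intro b _
      simp only [hg, key]
      rw [zbin_eq_zero (n := 0) (by omega), zbin_eq_zero (n := 0 + 1) (by omega)]
      simp
  · intro a ha ha0
    obtain ⟨a, rfl⟩ := Nat.exists_eq_succ_of_ne_zero ha0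
    rw [Finset.mem_range] at ha
    have e1 := sum_zbin_eq_zero he a n (R := n + 3) (by omega)
    have e2 := sum_zint_mul_zbin_eq_zero he a n (R := n + 3) (by omega)
    have h : ∀ b : ℕ, g (a + 1, b) = dF i (a + 1) •
        (((-1) ^ b * v ^ (e * (b - (a + 1 : ℕ) * ((n : ℤ) - (a + 1 : ℕ) + b))) *
          zbin (a + 1 : ℕ) b) • dFZ i ((n : ℤ) - (a + 1 : ℕ)) • y +
        ((-1) ^ b * v ^ (e * (b - (a + 1 : ℕ) * ((n : ℤ) - (a + 1 : ℕ) + b))) *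
          (zint ((n : ℤ) - (a + 1 : ℕ) + b + 1) * zbin (a + 2 : ℕ) b) * κ) •
            dFZ i ((n : ℤ) - (a + 1 : ℕ) + 1) • X) := by
      intro b
      simp only [hg]
      rw [← smul_smul_comm_U, key, smul_add, smul_smul (_ * _), smul_smul (_ * _),
        show a + 1 + 1 = a + 2 from rfl]
      congr 3
      ring
    rw [Nat.succ_eq_add_one, Finset.sum_congr rfl fun b _ => h b, ← Finset.smul_sum,
      Finset.sum_add_distrib, ← Finset.sum_smul, ← Finset.sum_smul, ← Finset.sum_mul, e1, e2]
    simp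
  · simp

/-! ### The reflection of a two-dimensional weight space -/

/-- `x, y` is a basis of the weight space of weight `f`, adapted to the integral form. -/
structure IsWtBasis (Λ : Fin 2 → ℕ) (f : Fin 2 → ℤ) (x y : L Λ) : Prop where
  left_mem_LA : x ∈ LA Λ
  right_mem_LA : y ∈ LA Λ
  left_mem : x ∈ wsp (L Λ) f
  right_mem : y ∈ wsp (L Λ) f
  indep (α β : Kv) : α • x + β • y = 0 → α = 0 ∧ β = 0
  exists_coeff (z : L Λ) : z ∈ wsp (L Λ) f →
    ∃ α β : Kv, z = α • x + β • y ∧ (z ∈ LA Λ → α ∈ A ∧ β ∈ A)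

lemma IsWtBasis.symm {Λ : Fin 2 → ℕ} {f : Fin 2 → ℤ} {x y : L Λ} (h : IsWtBasis Λ f x y) :
    IsWtBasis Λ f y x where
  left_mem_LA := h.right_mem_LA
  right_mem_LA := h.left_mem_LA
  left_mem := h.right_mem
  right_mem := h.left_mem
  indep α β hab := (h.indep β α (by rw [add_comm]; exact hab)).symm
  exists_coeff z hz := by
    obtain ⟨α, β, h1, h2⟩ := h.exists_coeff z hz
    exact ⟨β, α, by rw [add_comm]; exact h1, fun h3 => (h2 h3).symm⟩

lemma IsWtBasis.coeff_mem {Λ : Fin 2 → ℕ} {f : Fin 2 → ℤ} {x y : L Λ} (h : IsWtBasis Λ f x y)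
    {α β : Kv} (hz : α • x + β • y ∈ LA Λ) : α ∈ A ∧ β ∈ A := by
  obtain ⟨α', β', h1, h2⟩ := h.exists_coeff (α • x + β • y)
    (add_mem (Submodule.smul_mem _ _ h.left_mem) (Submodule.smul_mem _ _ h.right_mem))
  have := h.indep (α - α') (β - β') (by
    rw [sub_smul, sub_smul, ← sub_eq_zero.2 h1]; abel)
  rw [sub_eq_zero.1 this.1, sub_eq_zero.1 this.2]
  exact h2 hz

/-! ### Strings: the symmetry and the transport of a basis -/

/-- A string situation: `X` is an `E_i`-highest vector of weight `f + α_i`, and `Y` is a vector of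
weight `f` with `E_i Y = [k] X`. -/
structure IsString (Λ : Fin 2 → ℕ) (i : Fin 2) (f : Fin 2 → ℤ) (n : ℕ) (k : ℤ) (X Y : L Λ) :
    Prop where
  wt_eq : f i = n
  mem_X : X ∈ wsp (L Λ) (fun j => f j + cartan j i)
  mem_Y : Y ∈ wsp (L Λ) f
  E_X : E i • X = 0
  E_Y : E i • Y = zint k • X

namespace IsString

variable {Λ : Fin 2 → ℕ} {i : Fin 2} {f : Fin 2 → ℤ} {n : ℕ} {k : ℤ} {X Y : L Λ}

lemma hasWt_X (h : IsString Λ i f n k X Y) : HasWt i (n + 2) X := by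
  have : HasWt i (f i + cartan i i) X := h.mem_X i
  rwa [h.wt_eq, cartan_self] at this

lemma hasWt_Y (h : IsString Λ i f n k X Y) : HasWt i n Y := by
  have := h.mem_Y i
  rwa [h.wt_eq] at this

lemma E_F_X (h : IsString Λ i f n k X Y) : E i • F i • X = zint (n + 2) • X := by
  rw [E_smul_F_smul h.hasWt_X, h.E_X, smul_zero, zero_add]

/-- The `E_i`-highest component of `Y`. -/
lemma exists_decomp (h : IsString Λ i f n k X Y) :
    ∃ y : L Λ, HasWt i n y ∧ E i • y = 0 ∧ Y = y + (zint k / zint (n + 2)) • F i • X := by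
  have h2 : zint ((n : ℤ) + 2) ≠ 0 := zint_ne_zero (by omega)
  have h1 := h.hasWt_X.F i
  rw [cartan_self, add_sub_cancel_right] at h1
  -- The coefficient is dictated by `E_i F_i X = [n+2] X` and `E_i Y = [k] X`.
  refine ⟨Y + (-(zint k / zint (n + 2))) • F i • X, h.hasWt_Y.add (h1.smul _), ?_, ?_⟩
  · rw [smul_add, smul_smul_comm_U, h.E_F_X, h.E_Y, smul_smul, ← add_smul]
    have : zint k + -(zint k / zint (n + 2)) * zint (n + 2) = 0 := by field_simp; ring
    rw [this, zero_smul]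
  · rw [neg_smul]; abel

/-- `T_apply` with zero highest component gives the coefficient `[n+1] - v^e [n+2] = -v^{e(n+2)}`.
-/
lemma T_F_X (h : IsString Λ i f n k X Y) {e : ℤ} (he : e = 1 ∨ e = -1) :
    T Λ i e (F i • X) = -v ^ (e * (n + 2)) • dF i (n + 1) • X := by
  have h0 : HasWt i n (0 : L Λ) := by simp [HasWt]
  rw [T_apply he h.hasWt_X h.E_X h0 (smul_zero _) 1 (z := F i • X) (by simp), dF_smul_F_smul,
    dF_smul_F_smul, smul_smul_comm_U, E_smul_dF_succ h.hasWt_X, h.E_X, smul_zero, zero_add,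
    smul_smul, smul_smul, ← sub_smul, ← zint_sub_one he]
  congr 1
  push_cast
  rw [show (n : ℤ) + 2 - (n + 1) = 1 by ring, zint_one, show (n : ℤ) + 2 - 1 = n + 1 by ring,
    show (n : ℤ) + 1 + 1 = n + 2 by ring, mul_one]

/-- `E_i F_i^{(n+1)} Y = [k] F_i^{(n+1)} X`, since the commutator contributes `[0]`; the coefficient
is then `[k-1] - v^e [k] = -v^{ek}`. The vector `W` is left to the caller, who supplies it as a
monomial. -/
lemma T_Y (h : IsString Λ i f n k X Y) {e : ℤ} (he : e = 1 ∨ e = -1) {W : L Λ}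
    (hW : dF i n • Y = W + zint (k - 1) • dF i (n + 1) • X) :
    T Λ i e Y = -v ^ (e * k) • dF i (n + 1) • X + W := by
  obtain ⟨y, hy, hEy, hYy⟩ := h.exists_decomp
  rw [T_apply he h.hasWt_X h.E_X hy hEy _ hYy, E_smul_dF_succ h.hasWt_Y, sub_self, zint_zero,
    zero_smul, add_zero, h.E_Y, smul_smul_comm_U, hW, ← zint_sub_one he, sub_smul, mul_smul]
  abel

/-- The element inverting, up to units, the passage from `F_i X, Y` to the reflected basis. -/
def back (i : Fin 2) (n : ℕ) : U := dE i n - v • (F i * dE i (n + 1))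

lemma back_smul {M : Type*} [AddCommGroup M] [Module Kv M] [Module U M] [IsScalarTower Kv U M]
    (i : Fin 2) (n : ℕ) (x : M) :
    back i n • x = dE i n • x - v • F i • dE i (n + 1) • x := by
  rw [back, sub_smul, smul_assoc, mul_smul]

lemma back_X (h : IsString Λ i f n k X Y) :
    back i n • dF i (n + 1) • X = -v ^ ((n : ℤ) + 2) • F i • X := by
  have h1 := dE_smul_dF_of_E_eq_zero h.hasWt_X h.E_X n 1
  have h2 := dE_smul_dF_of_E_eq_zero h.hasWt_X h.E_X (n + 1) 0
  rw [add_comm 1 n, dF_one, Nat.cast_one, show (n : ℤ) + 2 - 1 = n + 1 by ring,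
    zbin_succ_self] at h1
  have h3 := zbin_succ_self (n + 1)
  push_cast at h3
  rw [zero_add, dF_zero, one_smul, Nat.cast_zero, sub_zero,
    show (n : ℤ) + 2 = n + 1 + 1 by ring, h3, show (n : ℤ) + 1 + 1 = n + 2 by ring] at h2
  rw [back_smul, h1, h2, smul_smul_comm_U, smul_smul, ← sub_smul]
  congr 1
  have := zint_sub_one (Or.inl rfl : (1 : ℤ) = 1 ∨ (1 : ℤ) = -1) ((n : ℤ) + 2)
  rw [zpow_one, one_mul, show (n : ℤ) + 2 - 1 = n + 1 by ring] at this
  exact this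

/-- `back` mirrors the two surviving terms of `T_apply`, with `E_i` and `F_i` exchanged. It restores
the highest component `y` exactly, and `back_X` handles the `F_i X` component. -/
lemma back_Y (h : IsString Λ i f n k X Y) :
    back i n • dF i n • Y = Y - (v ^ ((n : ℤ) + 1) * zint k) • F i • X := by
  obtain ⟨y, hy, hEy, hYy⟩ := h.exists_decomp
  have h2 : zint ((n : ℤ) + 2) ≠ 0 := zint_ne_zero (by omega)
  have h3 := dE_smul_dF_of_E_eq_zero hy hEy n 0
  rw [zero_add, dF_zero, one_smul, Nat.cast_zero, sub_zero, zbin_self, one_smul] at h3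
  have h4 : dE i (n + 1) • dF i n • y = 0 := by
    have := dE_smul_dFZ_of_E_eq_zero hy hEy (n + 1) n
    rwa [dFZ_natCast, dFZ_neg i (by push_cast; omega : (n : ℤ) - (n + 1 : ℕ) < 0), zero_smul,
      smul_zero] at this
  have h5 : back i n • dF i n • y = y := by
    rw [back_smul, h3, h4, smul_zero, smul_zero, sub_zero]
  have h6 : back i n • dF i n • F i • X =
      -(zint ((n : ℤ) + 1) * v ^ ((n : ℤ) + 2)) • F i • X := by
    rw [dF_smul_F_smul, smul_smul_comm_U, h.back_X, smul_smul, mul_neg]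
  have e : zint ((n : ℤ) + 1) * v ^ ((n : ℤ) + 2) = v ^ ((n : ℤ) + 1) * zint (n + 2) - 1 := by
    have := zint_add (-1) (n + 2)
    rw [zint_neg, zint_one, neg_neg, zpow_one,
      show -1 + ((n : ℤ) + 2) = n + 1 by ring] at this
    have h7 := zint_add (n + 2) (-1)
    rw [zint_neg, zint_one, show (n : ℤ) + 2 + -1 = n + 1 by ring] at h7
    rw [h7]
    have e1 : v ^ (-1 : ℤ) * v ^ ((n : ℤ) + 2) = v ^ ((n : ℤ) + 1) := by
      rw [← zpow_add₀ v_ne_zero]; congr 1; ring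
    have e2 : v ^ (-((n : ℤ) + 2)) * v ^ ((n : ℤ) + 2) = 1 := by
      rw [← zpow_add₀ v_ne_zero]; simp
    linear_combination zint (n + 2) * e1 - e2
  have h7 : back i n • dF i n • Y = y +
      (zint k / zint (n + 2)) • -(zint ((n : ℤ) + 1) * v ^ ((n : ℤ) + 2)) • F i • X := by
    rw [← h6, ← smul_smul_comm_U, ← smul_smul_comm_U]
    nth_rw 1 [← h5]
    rw [← smul_add, ← smul_add, ← hYy]
  rw [h7, e]
  conv_rhs => rw [hYy]
  rw [smul_smul, add_sub_assoc, ← sub_smul]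
  congr 2
  field_simp
  ring

/-- Spanning comes from surjectivity of `F_i^{(n)}` onto the reflected weight space. Independence
and integrality of coefficients are pulled back by `back`, which preserves `LA` and has a triangular
matrix over `𝒜` with diagonal `-v^{n+2}, 1`. -/
lemma isWtBasis (h : IsString Λ i f n k X Y) (hb : IsWtBasis Λ f (F i • X) Y)
    (hX : X ∈ LA Λ) {W : L Λ} (hW : dF i n • Y = W + zint (k - 1) • dF i (n + 1) • X) :
    IsWtBasis Λ (fun j => f j - n * cartan j i) (dF i (n + 1) • X) W := by
  have hWe : W = dF i n • Y - zint (k - 1) • dF i (n + 1) • X := by rw [hW]; abel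
  have hXm : dF i (n + 1) • X ∈ wsp (L Λ) (fun j => f j - n * cartan j i) := by
    intro j
    convert (h.mem_X j).dF i (n + 1) using 1
    push_cast; ring
  have hWm : W ∈ wsp (L Λ) (fun j => f j - n * cartan j i) := by
    rw [hWe]
    exact sub_mem (fun j => (h.mem_Y j).dF i n) (Submodule.smul_mem _ _ hXm)
  have hback : ∀ α β : Kv, back i n • (α • dF i (n + 1) • X + β • W) =
      (-v ^ ((n : ℤ) + 2) * α + β * (zint (k - 1) * v ^ ((n : ℤ) + 2) -
        v ^ ((n : ℤ) + 1) * zint k)) • F i • X + β • Y := by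
    intro α β
    rw [hWe, smul_add, smul_smul_comm_U, smul_smul_comm_U _ (back i n), smul_sub,
      smul_smul_comm_U _ (back i n), h.back_X, h.back_Y]
    simp only [smul_sub, smul_smul, neg_smul, smul_neg, add_smul, mul_sub, sub_smul, neg_mul]
    rw [mul_comm α]
    abel
  have hbackLA : ∀ z ∈ LA Λ, back i n • z ∈ LA Λ := by
    intro z hz
    rw [back_smul]
    refine sub_mem (UA_smul_mem_LA (dE_mem_UA i n) hz) (A_smul_mem v_mem_A ?_)
    rw [← dF_one]
    exact UA_smul_mem_LA (dF_mem_UA i 1) (UA_smul_mem_LA (dE_mem_UA i (n + 1)) hz)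
  have hXLA : dF i (n + 1) • X ∈ LA Λ := UA_smul_mem_LA (dF_mem_UA i _) hX
  have hv := v_zpow_ne_zero ((n : ℤ) + 2)
  refine ⟨hXLA, ?_, hXm, hWm, ?_, ?_⟩
  · rw [hWe]
    exact sub_mem (UA_smul_mem_LA (dF_mem_UA i n) hb.right_mem_LA)
      (A_smul_mem (zint_mem_A _) hXLA)
  · intro α β hab
    have h1 := hback α β
    rw [hab, smul_zero] at h1
    obtain ⟨h2, rfl⟩ := hb.indep _ _ h1.symm
    rw [zero_mul, add_zero, neg_mul, neg_eq_zero] at h2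
    exact ⟨(mul_eq_zero.1 h2).resolve_left hv, rfl⟩
  · intro z hz
    obtain ⟨s, hs⟩ := exists_F_pow_smul_eq_zero i z
    obtain ⟨w, hw, rfl⟩ := exists_dF_smul_eq h.wt_eq s hz hs
    obtain ⟨α, β, rfl, -⟩ := hb.exists_coeff w hw
    have hz' : dF i n • (α • F i • X + β • Y) =
        (α * zint (n + 1) + β * zint (k - 1)) • dF i (n + 1) • X + β • W := by
      rw [smul_add, smul_smul_comm_U, smul_smul_comm_U _ (dF i n), dF_smul_F_smul, hW]
      simp only [smul_add, smul_smul, add_smul]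
      abel
    -- The preimage under `F_i^{(n)}` need not be integral, so integrality of the coefficients has
    -- to be proved with `back`.
    refine ⟨_, _, hz', fun hLA => ?_⟩
    rw [hz'] at hLA
    generalize α * zint (n + 1) + β * zint (k - 1) = γ at hLA ⊢
    have h1 := hbackLA _ hLA
    rw [hback] at h1
    obtain ⟨h2, h3⟩ := hb.coeff_mem h1
    refine ⟨?_, h3⟩
    have h4 := sub_mem h2 (mul_mem h3 (sub_mem
      (mul_mem (zint_mem_A (k - 1)) (v_zpow_mem_A ((n : ℤ) + 2)))
      (mul_mem (v_zpow_mem_A ((n : ℤ) + 1)) (zint_mem_A k))))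
    rw [add_sub_cancel_right] at h4
    have h5 := mul_mem (v_zpow_mem_A (-((n : ℤ) + 2))) (neg_mem h4)
    rwa [neg_mul, neg_neg, ← mul_assoc, ← zpow_add₀ v_ne_zero, neg_add_cancel, zpow_zero,
      one_mul] at h5

end IsString

/-! ### The bar involution and crystal vectors -/

/-- `barScalar` evaluates numerator and denominator at `v⁻¹`; transcendence ensures that no
denominator vanishes there, which makes it a ring homomorphism. -/
lemma transcendental_v_inv : Transcendental ℚ (v⁻¹ : Kv) := by
  intro h
  refine RatFunc.transcendental_X (K := ℚ) ?_
  convert h.inv using 1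
  · exact Subsingleton.elim _ _
  · exact (inv_inv v).symm

lemma eval₂_v_inv_ne_zero {p : Polynomial ℚ} (hp : p ≠ 0) :
    Polynomial.eval₂ (RatFunc.C : ℚ →+* Kv) v⁻¹ p ≠ 0 := by
  intro h
  refine transcendental_v_inv ⟨p, hp, ?_⟩
  rw [Polynomial.aeval_def, ← h]
  congr 1
  exact Subsingleton.elim _ _

/-- The bar involution of the scalars as a ring homomorphism. -/
def barHom : Kv →+* Kv where
  toFun := barScalar
  map_one' := by simp [barScalar]
  map_zero' := by simp [barScalar]
  map_add' x y := RatFunc.eval_add _ _ (eval₂_v_inv_ne_zero x.denom_ne_zero)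
    (eval₂_v_inv_ne_zero y.denom_ne_zero)
  map_mul' x y := RatFunc.eval_mul _ _ (eval₂_v_inv_ne_zero x.denom_ne_zero)
    (eval₂_v_inv_ne_zero y.denom_ne_zero)

lemma barHom_v : barHom v = v⁻¹ := by
  change barScalar v = v⁻¹
  simp [barScalar, v]

lemma barHom_qFact (n : ℕ) : barHom (qFact n) = qFact n := by
  rw [qFact, map_prod]
  refine Finset.prod_congr rfl fun k _ => ?_
  rw [qInt, map_div₀, map_sub, map_sub, map_pow, map_pow, map_inv₀, barHom_v, inv_inv,
    ← neg_sub (v ^ _), ← neg_sub v, neg_div_neg_eq]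

lemma Bar.dF {Λ : Fin 2 → ℕ} (i : Fin 2) (k : ℕ) {x : L Λ} (hx : Bar Λ x x) :
    Bar Λ (dF i k • x) (dF i k • x) := by
  have h : Bar Λ (QSL3.F i ^ k • x) (QSL3.F i ^ k • x) := by
    induction k with
    | zero => simpa using hx
    | succ k ih => rw [pow_succ', mul_smul]; exact Bar.F i ih
  have h2 := Bar.smul (qFact k)⁻¹ h
  have h3 : barScalar (qFact k)⁻¹ = (qFact k)⁻¹ := by
    change barHom (qFact k)⁻¹ = _
    rw [map_inv₀, barHom_qFact]
  rw [h3] at h2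
  rw [QSL3.dF, smul_assoc]
  exact h2

lemma Ftilde_dF {Λ : Fin 2 → ℕ} {i : Fin 2} {x : L Λ} (hx : E i • x = 0) (k : ℕ) :
    Ftilde Λ i (dF i k • x) (dF i (k + 1) • x) := by
  refine ⟨Finsupp.single k x, fun n => ?_, ?_, ?_⟩
  · rw [Finsupp.single_apply]
    split_ifs
    · exact hx
    · simp
  · rw [Finsupp.sum_single_index]; simp
  · rw [Finsupp.sum_single_index]; simp

/-- A bar-invariant vector of the integral form of the form `F̃_{i₁} ⋯ F̃_{iₖ} sv`. -/
structure IsExact (Λ : Fin 2 → ℕ) (x : L Λ) : Prop where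
  crystal : CrystalVector Λ x
  mem_LA : x ∈ LA Λ
  bar : Bar Λ x x

lemma isExact_sv (Λ : Fin 2 → ℕ) : IsExact Λ (sv Λ) := ⟨.sv, sv_mem_LA Λ, .sv⟩

lemma IsExact.dF {Λ : Fin 2 → ℕ} {x : L Λ} (h : IsExact Λ x) {i : Fin 2} (hx : QSL3.E i • x = 0)
    (k : ℕ) : IsExact Λ (dF i k • x) := by
  refine ⟨?_, UA_smul_mem_LA (dF_mem_UA i k) h.mem_LA, h.bar.dF i k⟩
  induction k with
  | zero => rw [dF_zero, one_smul]; exact h.crystal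
  | succ k ih => exact CrystalVector.step i ih (Ftilde_dF hx k)

lemma IsExact.F {Λ : Fin 2 → ℕ} {x : L Λ} (h : IsExact Λ x) {i : Fin 2} (hx : QSL3.E i • x = 0) :
    IsExact Λ (QSL3.F i • x) := by
  rw [← dF_one]; exact h.dF hx 1

lemma IsExact.isCanonical {Λ : Fin 2 → ℕ} {x : L Λ} (h : IsExact Λ x) (hx : x ≠ 0) :
    IsCanonical Λ x :=
  ⟨hx, h.mem_LA, h.bar, x, h.crystal, 0, zero_mem _, by simp⟩

lemma IsWtBasis.isCanonicalBasis {Λ : Fin 2 → ℕ} {f : Fin 2 → ℤ} {x y : L Λ}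
    (h : IsWtBasis Λ f x y) (hx : IsExact Λ x) (hy : IsExact Λ y) {a b : ℤ} (ha : f 0 = a)
    (hb : f 1 = b) : IsCanonicalBasis Λ a b x y := by
  have hw : wtSpace Λ a b = wsp (L Λ) f := by
    ext z
    rw [mem_wsp, Fin.forall_fin_two, ha, hb]
    rfl
  refine ⟨hx.isCanonical ?_, hy.isCanonical ?_, LinearIndependent.pair_iff.2 h.indep, ?_, ?_⟩
  · rintro rfl
    have := (h.indep 1 0 (by simp)).1
    exact one_ne_zero this
  · rintro rfl
    have := (h.indep 0 1 (by simp)).2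
    exact one_ne_zero this
  · rw [hw]
    apply le_antisymm
    · rw [Submodule.span_le]
      rintro z (rfl | rfl)
      · exact h.left_mem
      · exact h.right_mem
    · intro z hz
      obtain ⟨α, β, rfl, -⟩ := h.exists_coeff z hz
      exact Submodule.mem_span_pair.2 ⟨α, β, rfl⟩
  · rw [hw]
    apply le_antisymm
    · rw [Submodule.span_le]
      rintro z (rfl | rfl)
      · exact ⟨h.left_mem_LA, h.left_mem⟩
      · exact ⟨h.right_mem_LA, h.right_mem⟩
    · rintro z ⟨hz1, hz2⟩
      obtain ⟨α, β, rfl, h3⟩ := h.exists_coeff z hz2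
      obtain ⟨hα, hβ⟩ := h3 hz1
      exact Submodule.mem_span_pair.2 ⟨⟨α, hα⟩, ⟨β, hβ⟩, rfl⟩

/-! ### The weight space `Λ - α₁ - α₂` -/

/-- The weight `Λ - pα_i - qα_j`. -/
def wt2 (Λ : Fin 2 → ℕ) (i j : Fin 2) (p q : ℤ) : Fin 2 → ℤ :=
  fun l => Λ l - p * cartan l i - q * cartan l j

lemma lower_one {Λ : Fin 2 → ℕ} {i j : Fin 2} (h : i ≠ j) :
    lower (wtΛ Λ) 1 = wt2 Λ i j 1 1 := by
  funext l
  fin_cases i <;> fin_cases j <;> simp [lower, wt2, wtΛ] at h ⊢ <;> ring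

/-- The two degrees are treated together: removing a nontrivial factor from degree `(1, 1)` leaves a
simple degree. Factors `F_i^{(0)} = 1` are allowed in a monomial and skipped. -/
lemma FMon.eq_of_degree {d : Fin 2 → ℕ} {u : U} (hu : FMon d u) :
    (∀ k, d = Pi.single k 1 → u = F k) ∧
      (d = 1 → ∃ i j : Fin 2, i ≠ j ∧ u = F i * F j) := by
  induction hu with
  | one =>
    refine ⟨fun k h => ?_, fun h => ?_⟩
    · have := congrFun h k; simp at this
    · have := congrFun h 0; simp at this
  | step i r hu ih =>
    rename_i d u
    rcases Nat.eq_zero_or_pos r with rfl | hr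
    · rw [dF_zero, one_mul, Pi.single_zero, add_zero]
      exact ih
    refine ⟨fun k h => ?_, fun h => ?_⟩
    · have hk := congrFun h i
      by_cases hik : k = i
      · subst hik
        simp only [Pi.add_apply, Pi.single_eq_same] at hk
        obtain rfl : r = 1 := by omega
        have hd : d = 0 := by
          have : d + Pi.single k 1 = 0 + Pi.single k 1 := by rw [h, zero_add]
          exact add_right_cancel this
        rw [hu.eq_one hd, mul_one, dF_one]
      · simp only [Pi.add_apply, Pi.single_eq_same, Pi.single_eq_of_ne (Ne.symm hik)] at hk
        omega
    · have hi := congrFun h i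
      simp only [Pi.add_apply, Pi.single_eq_same, Pi.one_apply] at hi
      obtain rfl : r = 1 := by omega
      obtain ⟨j, hij, hdj⟩ : ∃ j, i ≠ j ∧ d = Pi.single j 1 := by
        have h0 := congrFun h 0
        have h1 := congrFun h 1
        fin_cases i
        · refine ⟨1, by simp, ?_⟩
          simp at h0 h1
          funext l
          fin_cases l
          · simpa using h0
          · simpa using h1
        · refine ⟨0, by simp, ?_⟩
          simp at h0 h1
          funext l
          fin_cases l
          · simpa using h0
          · simpa using h1
      exact ⟨i, j, hij, by rw [ih.1 j hdj, dF_one]⟩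

lemma mem_span_pair_of_mem_monSpan {Λ : Fin 2 → ℕ} {R : Type*} [CommRing R] [Module R (L Λ)]
    [SMul R Kv] [IsScalarTower R Kv (L Λ)] {i j : Fin 2} (h : i ≠ j) {z : L Λ}
    (hz : z ∈ wsp (L Λ) (wt2 Λ i j 1 1)) (hz' : z ∈ monSpan R (sv Λ)) :
    z ∈ Submodule.span R {F i • F j • sv Λ, F j • F i • sv Λ} := by
  rw [← lower_one h] at hz
  refine Submodule.span_mono ?_ (mem_span_of_mem_monSpan (isHighest_sv Λ).mem_wsp hz' hz)
  rintro _ ⟨u, hu, rfl⟩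
  obtain ⟨k, l, hkl, rfl⟩ := hu.eq_of_degree.2 rfl
  rw [mul_smul]
  have : (k = i ∧ l = j) ∨ (k = j ∧ l = i) := by
    fin_cases i <;> fin_cases j <;> fin_cases k <;> fin_cases l <;> simp at h hkl ⊢
  rcases this with ⟨rfl, rfl⟩ | ⟨rfl, rfl⟩
  · exact Or.inl rfl
  · exact Or.inr rfl

section Strings

variable {Λ : Fin 2 → ℕ} {i j : Fin 2} {a b : ℕ}

lemma E_smul_dF_succ_sv (Λ : Fin 2 → ℕ) (i : Fin 2) (s : ℕ) :
    E i • dF i (s + 1) • sv Λ = zint (Λ i - s) • dF i s • sv Λ := by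
  have h := isHighest_sv Λ
  rw [E_smul_dF_succ (h.mem_wsp i), h.E_smul, smul_zero, zero_add, wtΛ]

lemma E_smul_F_sv (Λ : Fin 2 → ℕ) (i : Fin 2) : E i • F i • sv Λ = zint (Λ i) • sv Λ := by
  have h := isHighest_sv Λ
  rw [E_smul_F_smul (h.mem_wsp i), h.E_smul, smul_zero, zero_add, wtΛ]

lemma dF_dF_sv_mem_wsp (Λ : Fin 2 → ℕ) (i j : Fin 2) (p q : ℕ) :
    dF j q • dF i p • sv Λ ∈ wsp (L Λ) (wt2 Λ i j p q) :=
  fun l => (((isHighest_sv Λ).mem_wsp l).dF i p).dF j q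

lemma dF_dF_sv_mem_wsp' (Λ : Fin 2 → ℕ) (i j : Fin 2) (p q : ℕ) :
    dF i p • dF j q • sv Λ ∈ wsp (L Λ) (wt2 Λ i j p q) := by
  intro l
  convert (((isHighest_sv Λ).mem_wsp l).dF j q).dF i p using 1
  simp only [wt2, wtΛ]
  ring

/-- Applying `E_i` and `E_j` to a linear relation gives a `2 × 2` system of determinant
`[μ_i+1][μ_j+1] - [μ_i][μ_j] = [μ_i+μ_j+1] ≠ 0`. Spanning holds because these are the only monomials
of degree `(1, 1)`. -/
lemma isWtBasis_base (hij : i ≠ j) (hi : Λ i = a + 1) (hj : Λ j = b + 1) :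
    IsWtBasis Λ (wt2 Λ i j 1 1) (F i • F j • sv Λ) (F j • F i • sv Λ) := by
  have hsv := isHighest_sv Λ
  have hF : ∀ k, F k ∈ UA := fun k => dF_one k ▸ dF_mem_UA k 1
  have hm1 : F i • F j • sv Λ ∈ wsp (L Λ) (wt2 Λ i j 1 1) := by
    have := dF_dF_sv_mem_wsp' Λ i j 1 1
    rwa [dF_one, dF_one, Nat.cast_one] at this
  have hm2 : F j • F i • sv Λ ∈ wsp (L Λ) (wt2 Λ i j 1 1) := by
    have := dF_dF_sv_mem_wsp Λ i j 1 1
    rwa [dF_one, dF_one, Nat.cast_one] at this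
  refine ⟨UA_smul_mem_LA (hF i) (UA_smul_mem_LA (hF j) (sv_mem_LA Λ)),
    UA_smul_mem_LA (hF j) (UA_smul_mem_LA (hF i) (sv_mem_LA Λ)), hm1, hm2, ?_, ?_⟩
  · have key : ∀ {k l : Fin 2}, k ≠ l → ∀ (α β : Kv), Λ l ≠ 0 →
        α • F k • F l • sv Λ + β • F l • F k • sv Λ = 0 →
        α * zint (Λ k + 1) + β * zint (Λ k) = 0 := by
      intro k l hkl α β hl hab
      have h1 : HasWt k ((Λ k : ℤ) + 1) (F l • sv Λ) := by
        have := (hsv.mem_wsp k).F l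
        rwa [cartan_ne hkl, sub_neg_eq_add] at this
      have h2 : E k • F l • sv Λ = 0 := by rw [E_smul_F_smul_of_ne hkl, hsv.E_smul, smul_zero]
      have h3 : E k • F k • F l • sv Λ = zint (Λ k + 1) • F l • sv Λ := by
        rw [E_smul_F_smul h1, h2, smul_zero, zero_add]
      have h4 : E k • F l • F k • sv Λ = zint (Λ k) • F l • sv Λ := by
        rw [E_smul_F_smul_of_ne hkl, E_smul_F_sv, smul_smul_comm_U]
      have h5 : F l • sv Λ ≠ 0 := by
        intro h
        have := E_smul_F_sv Λ l
        rw [h, smul_zero] at this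
        exact smul_ne_zero (zint_ne_zero (by omega)) (sv_ne_zero Λ) this.symm
      have := congrArg (fun x => E k • x) hab
      simp only [smul_add, smul_zero] at this
      rw [smul_smul_comm_U, smul_smul_comm_U, h3, h4, smul_smul, smul_smul, ← add_smul] at this
      exact (smul_eq_zero.1 this).resolve_right h5
    intro α β hab
    have k1 := key hij α β (by omega) hab
    have k2 := key hij.symm β α (by omega) (by rw [add_comm]; exact hab)
    have det := zint_mul_sub (Λ i + 1) (Λ j + 1) 1
    rw [add_sub_cancel_right, add_sub_cancel_right, zint_one, one_mul] at det
    have hne : zint ((Λ i : ℤ) + 1 + (Λ j + 1) - 1) ≠ 0 := zint_ne_zero (by omega)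
    constructor
    · refine (mul_eq_zero.1 (?_ : α * zint ((Λ i : ℤ) + 1 + (Λ j + 1) - 1) = 0)).resolve_right hne
      linear_combination α * det + zint (Λ j + 1) * k1 - zint (Λ i) * k2
    · refine (mul_eq_zero.1 (?_ : β * zint ((Λ i : ℤ) + 1 + (Λ j + 1) - 1) = 0)).resolve_right hne
      linear_combination β * det + zint (Λ i + 1) * k2 - zint (Λ j) * k1
  · intro z hz
    -- For integral `z` the coefficients are taken in `𝒜` from the start; otherwise the integrality
    -- clause is vacuous.
    by_cases hLA : z ∈ LA Λ
    · obtain ⟨α, β, h⟩ := Submodule.mem_span_pair.1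
        (mem_span_pair_of_mem_monSpan hij hz (mem_monSpan_of_mem_LA hLA))
      exact ⟨α, β, h.symm, fun _ => ⟨α.2, β.2⟩⟩
    · obtain ⟨α, β, h⟩ := Submodule.mem_span_pair.1
        (mem_span_pair_of_mem_monSpan hij hz (mem_monSpan_sv z))
      exact ⟨α, β, h.symm, fun h' => absurd h' hLA⟩

/-! ### The three reflections -/

lemma isString_first (hij : i ≠ j) (hi : Λ i = a + 1) :
    IsString Λ i (wt2 Λ i j 1 1) a (a + 1) (F j • sv Λ) (F j • F i • sv Λ) where
  wt_eq := by
    rw [wt2, cartan_self, cartan_ne hij, hi]; push_cast; ring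
  mem_X := by
    intro l
    convert ((isHighest_sv Λ).mem_wsp l).F j using 1
    simp only [wt2, wtΛ]; ring
  mem_Y := by
    have := dF_dF_sv_mem_wsp Λ i j 1 1
    rwa [dF_one, dF_one, Nat.cast_one] at this
  E_X := by rw [E_smul_F_smul_of_ne hij, (isHighest_sv Λ).E_smul, smul_zero]
  E_Y := by
    rw [E_smul_F_smul_of_ne hij, E_smul_F_sv, smul_smul_comm_U, hi]; push_cast; rfl

lemma dF_smul_first (hij : i ≠ j) :
    dF i a • F j • F i • sv Λ = F j • dF i (a + 1) • sv Λ +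
      zint ((a : ℤ) + 1 - 1) • dF i (a + 1) • F j • sv Λ := by
  have := congrArg (fun u : U => u • sv Λ) (dF_mul_dF_mul_F hij a 0)
  simp only [zero_add, dF_one, dF_zero, mul_one, add_smul, mul_smul, smul_assoc, Nat.cast_zero,
    sub_zero] at this
  rw [add_sub_cancel_right]
  exact this

lemma isString_second (hij : i ≠ j) (hj : Λ j = b + 1) :
    IsString Λ j (wt2 Λ i j (a + 1 : ℕ) 1) (a + b) (b + 1) (dF i (a + 1) • sv Λ)
      (dF i (a + 1) • F j • sv Λ) where
  wt_eq := by
    rw [wt2, cartan_self, cartan_ne hij.symm, hj]; push_cast; ring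
  mem_X := by
    intro l
    convert ((isHighest_sv Λ).mem_wsp l).dF i (a + 1) using 1
    simp only [wt2, wtΛ]; ring
  mem_Y := by
    have := dF_dF_sv_mem_wsp' Λ i j (a + 1) 1
    rwa [dF_one, Nat.cast_one] at this
  E_X := by rw [E_smul_dF_smul_of_ne hij.symm, (isHighest_sv Λ).E_smul, smul_zero]
  E_Y := by
    rw [E_smul_dF_smul_of_ne hij.symm, E_smul_F_sv, smul_smul_comm_U, hj]; push_cast; rfl

lemma dF_smul_second (hij : i ≠ j) :
    dF j (a + b) • dF i (a + 1) • F j • sv Λ =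
      F i • dF j (a + b + 1) • dF i a • sv Λ +
        zint ((b : ℤ) + 1 - 1) • dF j (a + b + 1) • dF i (a + 1) • sv Λ := by
  have := congrArg (fun u : U => u • sv Λ) (dF_mul_dF_mul_F hij.symm (a + b) a)
  simp only [add_smul, mul_smul, smul_assoc] at this
  rw [this]
  congr 3
  push_cast; ring

/-- For `a > 0`, `E_i F_i^{(a)} sv` is a multiple of `F_i^{(a-1)} sv`, which is `E_j`-highest of
`K_j`-weight `a + b`, so `F_j^{(a+b+1)}` kills it. -/
lemma E_smul_dF_dF_sv (hij : i ≠ j) (hi : Λ i = a + 1) (hj : Λ j = b + 1) :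
    E i • dF j (a + b + 1) • dF i a • sv Λ = 0 := by
  have hsv := isHighest_sv Λ
  rw [E_smul_dF_smul_of_ne hij]
  cases a with
  | zero => rw [dF_zero, one_smul, hsv.E_smul, smul_zero]
  | succ a =>
    rw [E_smul_dF_succ_sv, smul_smul_comm_U, dF_succ_smul_eq_zero, smul_zero]
    · have := (hsv.mem_wsp j).dF i a
      rw [cartan_ne hij.symm, wtΛ, hj] at this
      convert this using 1
      push_cast; ring
    · rw [E_smul_dF_smul_of_ne hij.symm, hsv.E_smul, smul_zero]
    · exact exists_F_pow_smul_eq_zero j _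

lemma isString_third (hij : i ≠ j) (hi : Λ i = a + 1) (hj : Λ j = b + 1) :
    IsString Λ i (wt2 Λ i j (a + 1 : ℕ) (a + b + 1 : ℕ)) b 1
      (dF j (a + b + 1) • dF i a • sv Λ) (dF j (a + b + 1) • dF i (a + 1) • sv Λ) where
  wt_eq := by
    rw [wt2, cartan_self, cartan_ne hij, hi]; push_cast; ring
  mem_X := by
    intro l
    convert dF_dF_sv_mem_wsp Λ i j a (a + b + 1) l using 1
    simp only [wt2]; push_cast; ring
  mem_Y := dF_dF_sv_mem_wsp Λ i j (a + 1) (a + b + 1)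
  E_X := E_smul_dF_dF_sv hij hi hj
  E_Y := by
    rw [E_smul_dF_smul_of_ne hij, E_smul_dF_succ_sv, smul_smul_comm_U, hi]
    congr 2
    push_cast; ring

lemma isWtBasis_first (hij : i ≠ j) (hi : Λ i = a + 1) (hj : Λ j = b + 1) :
    IsWtBasis Λ (wt2 Λ i j (a + 1 : ℕ) 1) (dF i (a + 1) • F j • sv Λ)
      (F j • dF i (a + 1) • sv Λ) := by
  have hX : F j • sv Λ ∈ LA Λ := by
    rw [← dF_one]; exact UA_smul_mem_LA (dF_mem_UA j 1) (sv_mem_LA Λ)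
  have := (isString_first hij hi).isWtBasis (isWtBasis_base hij hi hj) hX (dF_smul_first hij)
  convert this using 1
  funext l
  simp only [wt2]; push_cast; ring

lemma isWtBasis_second (hij : i ≠ j) (hi : Λ i = a + 1) (hj : Λ j = b + 1) :
    IsWtBasis Λ (wt2 Λ i j (a + 1 : ℕ) (a + b + 1 : ℕ)) (dF j (a + b + 1) • dF i (a + 1) • sv Λ)
      (F i • dF j (a + b + 1) • dF i a • sv Λ) := by
  have := (isString_second (a := a) hij hj).isWtBasis (isWtBasis_first hij hi hj).symm
    (UA_smul_mem_LA (dF_mem_UA i _) (sv_mem_LA Λ)) (dF_smul_second hij)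
  convert this using 1
  funext l
  simp only [wt2]; push_cast; ring

lemma dF_smul_third (x y : L Λ) : x = x + zint (1 - 1) • y := by
  rw [sub_self, zint_zero, zero_smul, add_zero]

lemma isWtBasis_third (hij : i ≠ j) (hi : Λ i = a + 1) (hj : Λ j = b + 1) :
    IsWtBasis Λ (wt2 Λ i j (a + b + 1 : ℕ) (a + b + 1 : ℕ))
      (dF i b • dF j (a + b + 1) • dF i (a + 1) • sv Λ)
      (dF i (b + 1) • dF j (a + b + 1) • dF i a • sv Λ) := by
  have := (isString_third hij hi hj).isWtBasis (isWtBasis_second hij hi hj).symm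
    (UA_smul_mem_LA (dF_mem_UA j _) (UA_smul_mem_LA (dF_mem_UA i _) (sv_mem_LA Λ)))
    (dF_smul_third _ _)
  convert this.symm using 1
  funext l
  simp only [wt2]; push_cast; ring

lemma verma_smul_sv (hij : i ≠ j) :
    dF i b • dF j (a + b + 1) • dF i (a + 1) • sv Λ =
      dF j (a + 1) • dF i (b + a + 1) • dF j b • sv Λ := by
  have := congrArg (fun u : U => u • sv Λ) (verma_dF hij b (a + 1))
  simp only [mul_smul] at this
  rw [show a + b + 1 = b + (a + 1) by ring, this, add_assoc b a 1]

/-- The first six symmetries, for an ordered pair of distinct nodes. -/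
theorem T_formulas (hij : i ≠ j) (hi : Λ i = a + 1) (hj : Λ j = b + 1) {e : ℤ}
    (he : e = 1 ∨ e = -1) :
    T Λ i e (F i • F j • sv Λ)
      = -v ^ (e * ((a + 1 : ℕ) + 1)) • dF i (a + 1) • F j • sv Λ ∧
    T Λ i e (F j • F i • sv Λ)
      = -v ^ (e * (a + 1 : ℕ)) • dF i (a + 1) • F j • sv Λ + F j • dF i (a + 1) • sv Λ ∧
    T Λ j e (F j • dF i (a + 1) • sv Λ)
      = -v ^ (e * ((a + 1 : ℕ) + (b + 1 : ℕ))) • dF j (a + b + 1) • dF i (a + 1) • sv Λ ∧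
    T Λ j e (dF i (a + 1) • F j • sv Λ)
      = -v ^ (e * (b + 1 : ℕ)) • dF j (a + b + 1) • dF i (a + 1) • sv Λ
        + F i • dF j (a + b + 1) • dF i a • sv Λ ∧
    T Λ i e (F i • dF j (a + b + 1) • dF i a • sv Λ)
      = -v ^ (e * ((b + 1 : ℕ) + 1)) • dF i (b + 1) • dF j (a + b + 1) • dF i a • sv Λ ∧
    T Λ i e (dF j (a + b + 1) • dF i (a + 1) • sv Λ)
      = -v ^ e • dF i (b + 1) • dF j (a + b + 1) • dF i a • sv Λ
        + dF i b • dF j (a + b + 1) • dF i (a + 1) • sv Λ := by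
  have s1 := isString_first hij hi
  have s2 := isString_second (a := a) hij hj
  have s3 := isString_third hij hi hj
  refine ⟨?_, ?_, ?_, ?_, ?_, ?_⟩
  · rw [s1.T_F_X he]; congr 3
  · rw [s1.T_Y he (dF_smul_first hij)]; push_cast; rfl
  · rw [s2.T_F_X he]; congr 3; push_cast; ring
  · rw [s2.T_Y he (dF_smul_second hij)]; push_cast; rfl
  · rw [s3.T_F_X he]; congr 3
  · rw [s3.T_Y he (dF_smul_third _ _), mul_one]

/-! ### The basis vectors as exact crystal vectors -/

lemma isExact_F_sv (hij : i ≠ j) : IsExact Λ (F j • sv Λ) ∧ E i • F j • sv Λ = 0 :=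
  ⟨(isExact_sv Λ).F ((isHighest_sv Λ).E_smul j), by
    rw [E_smul_F_smul_of_ne hij, (isHighest_sv Λ).E_smul, smul_zero]⟩

lemma isExact_dF_sv (hij : i ≠ j) (r : ℕ) :
    IsExact Λ (dF j r • sv Λ) ∧ E i • dF j r • sv Λ = 0 :=
  ⟨(isExact_sv Λ).dF ((isHighest_sv Λ).E_smul j) r, by
    rw [E_smul_dF_smul_of_ne hij, (isHighest_sv Λ).E_smul, smul_zero]⟩

lemma isExact_dF_dF_sv (hij : i ≠ j) (p q : ℕ) : IsExact Λ (dF j q • dF i p • sv Λ) :=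
  (isExact_dF_sv hij.symm p).1.dF (isExact_dF_sv hij.symm p).2 q

lemma isExact_dF_dF_dF_sv (hij : i ≠ j) (hi : Λ i = a + 1) (hj : Λ j = b + 1) (r : ℕ) :
    IsExact Λ (dF i r • dF j (a + b + 1) • dF i a • sv Λ) :=
  (isExact_dF_dF_sv hij a (a + b + 1)).dF (E_smul_dF_dF_sv hij hi hj) r

lemma isExact_F_dF_dF_sv (hij : i ≠ j) (hi : Λ i = a + 1) (hj : Λ j = b + 1) :
    IsExact Λ (F i • dF j (a + b + 1) • dF i a • sv Λ) :=
  (isExact_dF_dF_sv hij a (a + b + 1)).F (E_smul_dF_dF_sv hij hi hj)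

end Strings

end QSL3

end

open QSL3 in
theorem mainTheorem7 (Λ : Fin 2 → ℕ) (m₁ m₂ : ℕ) (hm₁ : Λ 0 = m₁) (hm₂ : Λ 1 = m₂)
    (h₁ : 1 ≤ m₁) (h₂ : 1 ≤ m₂) :
    -- the canonical bases of the six weight spaces
    (IsCanonicalBasis Λ (m₁ - 1) (m₂ - 1)
        (F 0 • F 1 • sv Λ) (F 1 • F 0 • sv Λ) ∧
      IsCanonicalBasis Λ (-m₁ + 1) (m₁ + m₂ - 2)
        (dF 0 m₁ • F 1 • sv Λ) (F 1 • dF 0 m₁ • sv Λ) ∧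
      IsCanonicalBasis Λ (m₁ + m₂ - 2) (-m₂ + 1)
        (dF 1 m₂ • F 0 • sv Λ) (F 0 • dF 1 m₂ • sv Λ) ∧
      IsCanonicalBasis Λ (m₂ - 1) (-m₁ - m₂ + 2)
        (dF 1 (m₁ + m₂ - 1) • dF 0 m₁ • sv Λ)
        (F 0 • dF 1 (m₁ + m₂ - 1) • dF 0 (m₁ - 1) • sv Λ) ∧
      IsCanonicalBasis Λ (-m₁ - m₂ + 2) (m₁ - 1)
        (dF 0 (m₁ + m₂ - 1) • dF 1 m₂ • sv Λ)
        (F 1 • dF 0 (m₁ + m₂ - 1) • dF 1 (m₂ - 1) • sv Λ) ∧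
      IsCanonicalBasis Λ (-m₂ + 1) (-m₁ + 1)
        (dF 0 (m₂ - 1) • dF 1 (m₁ + m₂ - 1) • dF 0 m₁ • sv Λ)
        (dF 0 m₂ • dF 1 (m₁ + m₂ - 1) • dF 0 (m₁ - 1) • sv Λ) ∧
      dF 0 (m₂ - 1) • dF 1 (m₁ + m₂ - 1) • dF 0 m₁ • sv Λ
        = dF 1 m₁ • dF 0 (m₁ + m₂ - 1) • dF 1 (m₂ - 1) • sv Λ ∧
      dF 0 m₂ • dF 1 (m₁ + m₂ - 1) • dF 0 (m₁ - 1) • sv Λ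
        = dF 1 (m₁ - 1) • dF 0 (m₁ + m₂ - 1) • dF 1 m₂ • sv Λ) ∧
    -- the symmetries, for both signs
    ∀ e : ℤ, e = 1 ∨ e = -1 →
      T Λ 0 e (F 0 • F 1 • sv Λ) = -v ^ (e * (m₁ + 1)) • dF 0 m₁ • F 1 • sv Λ ∧
      T Λ 0 e (F 1 • F 0 • sv Λ)
        = -v ^ (e * m₁) • dF 0 m₁ • F 1 • sv Λ + F 1 • dF 0 m₁ • sv Λ ∧
      T Λ 1 e (F 1 • F 0 • sv Λ) = -v ^ (e * (m₂ + 1)) • dF 1 m₂ • F 0 • sv Λ ∧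
      T Λ 1 e (F 0 • F 1 • sv Λ)
        = -v ^ (e * m₂) • dF 1 m₂ • F 0 • sv Λ + F 0 • dF 1 m₂ • sv Λ ∧
      T Λ 1 e (F 1 • dF 0 m₁ • sv Λ)
        = -v ^ (e * (m₁ + m₂)) • dF 1 (m₁ + m₂ - 1) • dF 0 m₁ • sv Λ ∧
      T Λ 1 e (dF 0 m₁ • F 1 • sv Λ)
        = -v ^ (e * m₂) • dF 1 (m₁ + m₂ - 1) • dF 0 m₁ • sv Λ
          + F 0 • dF 1 (m₁ + m₂ - 1) • dF 0 (m₁ - 1) • sv Λ ∧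
      T Λ 0 e (F 0 • dF 1 m₂ • sv Λ)
        = -v ^ (e * (m₁ + m₂)) • dF 0 (m₁ + m₂ - 1) • dF 1 m₂ • sv Λ ∧
      T Λ 0 e (dF 1 m₂ • F 0 • sv Λ)
        = -v ^ (e * m₁) • dF 0 (m₁ + m₂ - 1) • dF 1 m₂ • sv Λ
          + F 1 • dF 0 (m₁ + m₂ - 1) • dF 1 (m₂ - 1) • sv Λ ∧
      T Λ 0 e (F 0 • dF 1 (m₁ + m₂ - 1) • dF 0 (m₁ - 1) • sv Λ)
        = -v ^ (e * (m₂ + 1)) • dF 0 m₂ • dF 1 (m₁ + m₂ - 1) • dF 0 (m₁ - 1) • sv Λ ∧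
      T Λ 0 e (dF 1 (m₁ + m₂ - 1) • dF 0 m₁ • sv Λ)
        = -v ^ e • dF 0 m₂ • dF 1 (m₁ + m₂ - 1) • dF 0 (m₁ - 1) • sv Λ
          + dF 0 (m₂ - 1) • dF 1 (m₁ + m₂ - 1) • dF 0 m₁ • sv Λ ∧
      T Λ 1 e (F 1 • dF 0 (m₁ + m₂ - 1) • dF 1 (m₂ - 1) • sv Λ)
        = -v ^ (e * (m₁ + 1)) • dF 1 m₁ • dF 0 (m₁ + m₂ - 1) • dF 1 (m₂ - 1) • sv Λ ∧
      T Λ 1 e (dF 0 (m₁ + m₂ - 1) • dF 1 m₂ • sv Λ)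
        = -v ^ e • dF 1 m₁ • dF 0 (m₁ + m₂ - 1) • dF 1 (m₂ - 1) • sv Λ
          + dF 1 (m₁ - 1) • dF 0 (m₁ + m₂ - 1) • dF 1 m₂ • sv Λ := by
  obtain ⟨a, rfl⟩ := Nat.exists_eq_add_of_le' h₁
  obtain ⟨b, rfl⟩ := Nat.exists_eq_add_of_le' h₂
  have h01 : (0 : Fin 2) ≠ 1 := by decide
  have h10 : (1 : Fin 2) ≠ 0 := by decide
  have ep : a + 1 + (b + 1) - 1 = a + b + 1 := by omega
  have eq1 := isExact_dF_dF_dF_sv h10 hm₂ hm₁ (a + 1)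
  have eq2 := isWtBasis_second h10 hm₂ hm₁
  have eq3 := isExact_F_dF_dF_sv h10 hm₂ hm₁
  have v1 := verma_smul_sv (Λ := Λ) (a := a) (b := b) h01
  have v2 := verma_smul_sv (Λ := Λ) (a := b) (b := a) h10
  -- Exchanging the nodes produces the exponent `b + a + 1` in place of `a + b + 1`.
  rw [add_comm b a] at eq1 eq2 eq3 v1 v2
  rw [ep, Nat.add_sub_cancel, Nat.add_sub_cancel]
  refine ⟨⟨?_, ?_, ?_, ?_, ?_, ?_, v1, v2.symm⟩, fun e he => ?_⟩
  · refine (isWtBasis_base h01 hm₁ hm₂).isCanonicalBasis ((isExact_F_sv h01).1.F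
      (isExact_F_sv h01).2) ((isExact_F_sv h10).1.F (isExact_F_sv h10).2) ?_ ?_ <;>
      simp [wt2, cartan, hm₁, hm₂] <;> ring
  · refine (isWtBasis_first h01 hm₁ hm₂).isCanonicalBasis ((isExact_F_sv h01).1.dF
      (isExact_F_sv h01).2 _) ((isExact_dF_sv h10 _).1.F (isExact_dF_sv h10 _).2) ?_ ?_ <;>
      simp [wt2, cartan, hm₁, hm₂] <;> ring
  · refine (isWtBasis_first h10 hm₂ hm₁).isCanonicalBasis ((isExact_F_sv h10).1.dF
      (isExact_F_sv h10).2 _) ((isExact_dF_sv h01 _).1.F (isExact_dF_sv h01 _).2) ?_ ?_ <;>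
      simp [wt2, cartan, hm₁, hm₂] <;> ring
  · refine (isWtBasis_second h01 hm₁ hm₂).isCanonicalBasis (isExact_dF_dF_sv h01 _ _)
      (isExact_F_dF_dF_sv h01 hm₁ hm₂) ?_ ?_ <;>
      simp [wt2, cartan, hm₁, hm₂] <;> ring
  · refine eq2.isCanonicalBasis (isExact_dF_dF_sv h10 _ _) eq3 ?_ ?_ <;>
      simp [wt2, cartan, hm₁, hm₂] <;> ring
  -- In its given form the first vector applies `F_0^{(b)}` to a vector that `E_0` does not kill;
  -- `v1` rewrites it with the nodes exchanged, where `eq1` shows that it is exact.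
  · refine (isWtBasis_third h01 hm₁ hm₂).isCanonicalBasis (v1 ▸ eq1)
      (isExact_dF_dF_dF_sv h01 hm₁ hm₂ _) ?_ ?_ <;>
      simp [wt2, cartan, hm₁, hm₂] <;> ring
  · obtain ⟨t1, t2, t3, t4, t5, t6⟩ := T_formulas h01 hm₁ hm₂ he
    obtain ⟨s1, s2, s3, s4, s5, s6⟩ := T_formulas h10 hm₂ hm₁ he
    rw [add_comm b a] at s3 s4 s5 s6
    rw [add_comm ((b + 1 : ℕ) : ℤ)] at s3
    exact ⟨t1, t2, s1, s2, t3, t4, s3, s4, t5, t6, s5, s6⟩
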